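/- Let $\mathfrak H$ be a real separable Hilbert space and let $X=\{X(h):h\in\mathfrak H\}$ be an isonormal Gaussian process over $\mathfrak H$ on a probability space $(\Omega,\mathcal F,P)$, i.e. a centered Gaussian family with $E[X(g)X(h)]=\langle g,h\rangle_{\mathfrak H}$. For $q\ge 1$ let $\mathfrak H^{\odot q}\subset\mathfrak H^{\otimes q}$ be the $q$-th symmetric (Hilbert) tensor power of $\mathfrak H$, and let $I_q:\mathfrak H^{\odot q}\to L^2(\Omega)$ be the multiple Wiener–Itô integral of order $q$, i.e. the continuous linear map determined by $I_q(h^{\otimes q})=H_q(X(h))$ for $\|h\|_{\mathfrak H}=1$, where $H_q(x)=(-1)^q e^{x^2/2}\frac{d^q}{dx^q}e^{-x^2/2}$. For a smooth cylindrical random variable $F=g(X(\varphi_1),\dots,X(\varphi_n))$ ($n\ge1$, $g\in C_c^\infty(\mathbb R^n)$, $\varphi_i\in\mathfrak H$) put $DF=\sum_i \partial_i g(X(\varphi_1),\dots,X(\varphi_n))\,\varphi_i$ and $D^2F=\sum_{i,j}\partial_i\partial_j g(X(\varphi_1),\dots,X(\varphi_n))\,\varphi_i\otimes\varphi_j$.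 Let $\mathbb D^{2,p}$ be the closure of these random variables for the norm $\big(E|F|^p+E\|DF\|_{\mathfrak H}^p+E\|D^2F\|_{\mathfrak H^{\otimes2}}^p\big)^{1/p}$, with $D$ and $D^2$ extended by continuity. For $u,v\in\mathfrak H^{\otimes 2}$ let $\langle u,e\rangle\in\mathfrak H$ be the partial inner product with $e\in\mathfrak H$ in the last variable, let $\|u\|_{op}$ be the operator norm of the Hilbert–Schmidt operator $\mathfrak H\to\mathfrak H$, $e\mapsto\langle u,e\rangle$, and let $u\otimes_1 v=\sum_i\langle u,e_i\rangle\otimes\langle v,e_i\rangle\in\mathfrak H^{\otimes2}$, where $(e_i)$ is a complete orthonormal system of $\mathfrak H$. **Theorem.** Fix $q\ge2$, and let $F_k=I_q(f_k)$, with $f_k\in\mathfrak H^{\odot q}$, be a sequence of multiple Wiener–Itô integrals such that $E[F_k^2]\to1$ as $k\to\infty$. Then $F_k\in\mathbb D^{2,4}$ for every $k$, and the following three conditions are equivalent as $k\to\infty$: (i) $F_k$ converges in law to $Z\sim\mathcal N(0,1)$; (ii) $\|D^2F_k\otimes_1D^2F_k\|_{\mathfrak H^{\otimes2}}\to0$ in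 $L^2(\Omega)$; (iii) $\|D^2F_k\|_{op}\to0$ in $L^4(\Omega)$. -/

import Mathlib

open MeasureTheory ProbabilityTheory Filter Topology
open scoped TensorProduct ENNReal RealInnerProductSpace

noncomputable section

namespace WienerChaos

universe u v

/-! ### Hilbert tensor products and tensor powers -/

section Tensor

/-- The Hilbert tensor product of two real Hilbert spaces: the completion of the algebraic
tensor product for the inner product with `⟪a ⊗ b, c ⊗ d⟫ = ⟪a, c⟫ * ⟪b, d⟫`. -/
abbrev HilbertTensor (E F : Type u) [NormedAddCommGroup E] [InnerProductSpace ℝ E]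
    [NormedAddCommGroup F] [InnerProductSpace ℝ F] : Type u :=
  UniformSpace.Completion (E ⊗[ℝ] F)

/-- The continuous bilinear map `(x, y) ↦ x ⊗ y` into the Hilbert tensor product. -/
def tmulL (E F : Type u) [NormedAddCommGroup E] [InnerProductSpace ℝ E]
    [NormedAddCommGroup F] [InnerProductSpace ℝ F] : E →L[ℝ] F →L[ℝ] HilbertTensor E F :=
  (ContinuousLinearMap.compL ℝ F (E ⊗[ℝ] F) (HilbertTensor E F)
    UniformSpace.Completion.toComplL).comp (TensorProduct.mkL ℝ E F)

/-- A real Hilbert space as a bundled object (used only for the recursion in `hilbertPowAux`). -/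
structure RealHilbert where
  carrier : Type u
  [group : NormedAddCommGroup carrier]
  [inner : InnerProductSpace ℝ carrier]
  [complete : CompleteSpace carrier]

attribute [instance] RealHilbert.group RealHilbert.inner RealHilbert.complete

/-- Bundled Hilbert tensor powers: `ℝ` (in the universe of `H`), `H`, `H ⊗ H`, `H ⊗ (H ⊗ H)`, … -/
def hilbertPowAux (H : Type u) [NormedAddCommGroup H] [InnerProductSpace ℝ H] [CompleteSpace H] :
    ℕ → RealHilbert.{u}
  | 0 => ⟨EuclideanSpace ℝ PUnit.{u + 1}⟩
  | 1 => ⟨H⟩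
  | n + 2 => ⟨HilbertTensor H (hilbertPowAux H (n + 1)).carrier⟩

/-- The `q`-th Hilbert tensor power of `H`. -/
abbrev HilbertPow (H : Type u) [NormedAddCommGroup H] [InnerProductSpace ℝ H] [CompleteSpace H]
    (q : ℕ) : Type u :=
  (hilbertPowAux H q).carrier

variable {H : Type u} [NormedAddCommGroup H] [InnerProductSpace ℝ H] [CompleteSpace H]

/-- The pure power `h ⊗ h ⊗ ⋯ ⊗ h` with `q` factors. -/
def purePow (h : H) : (q : ℕ) → HilbertPow H q
  | 0 => (EuclideanSpace.single PUnit.unit (1 : ℝ) : EuclideanSpace ℝ PUnit.{u + 1})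
  | 1 => h
  | n + 2 => tmulL H (HilbertPow H (n + 1)) h (purePow h (n + 1))

variable (H) in
/-- The `q`-th symmetric tensor power of `H`: the closed linear span of the pure powers. -/
def symPow (q : ℕ) : Submodule ℝ (HilbertPow H q) :=
  (Submodule.span ℝ (Set.range fun h : H => purePow h q)).topologicalClosure

/-- The operator `H → H` attached to `u` in `H ⊗ H`: it sends `e` to the partial inner product
`⟨u, e⟩` taken in the last variable, i.e. the vector with `⟪⟨u, e⟩, x⟫ = ⟪u, x ⊗ e⟫` for all `x`.
It is the Hilbert-Schmidt operator associated with `u`; `(a ⊗ b)` goes to `e ↦ ⟪b, e⟫ a`. -/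
def toOp (u : HilbertTensor H H) : H →L[ℝ] H :=
  LinearMap.mkContinuous
    { toFun := fun e =>
        (InnerProductSpace.toDual ℝ H).symm ((innerSL ℝ u).comp ((tmulL H H).flip e))
      map_add' := fun e e' => by
        rw [← map_add, map_add, ContinuousLinearMap.comp_add]
      map_smul' := fun c e => by
        rw [map_smul, ContinuousLinearMap.comp_smul, map_smulₛₗ]
        simp }
    (‖innerSL ℝ u‖ * ‖(tmulL H H).flip‖) (fun e => by
      simp only [LinearMap.coe_mk, AddHom.coe_mk, LinearIsometryEquiv.norm_map]
      calc ‖(innerSL ℝ u).comp ((tmulL H H).flip e)‖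
          ≤ ‖innerSL ℝ u‖ * ‖(tmulL H H).flip e‖ := ContinuousLinearMap.opNorm_comp_le _ _
        _ ≤ ‖innerSL ℝ u‖ * (‖(tmulL H H).flip‖ * ‖e‖) := by
          gcongr
          exact ContinuousLinearMap.le_opNorm _ _
        _ = ‖innerSL ℝ u‖ * ‖(tmulL H H).flip‖ * ‖e‖ := by ring)

theorem inner_toOp (u : HilbertTensor H H) (e x : H) :
    ⟪toOp u e, x⟫ = ⟪u, tmulL H H x e⟫ := by
  simp [toOp]

/-- The contraction of order one of `u` and `v` in `H ⊗ H`, computed in the complete orthonormal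
system `b`: `u ⊗₁ v = ∑ i, ⟨u, b i⟩ ⊗ ⟨v, b i⟩`. -/
def contraction {ι : Type v} (b : HilbertBasis ι ℝ H) (u w : HilbertTensor H H) :
    HilbertTensor H H :=
  ∑' i, tmulL H H (toOp u (b i)) (toOp w (b i))

end Tensor

/-! ### Isonormal Gaussian processes and multiple Wiener-Itô integrals -/

section Gaussian

variable {H : Type u} [NormedAddCommGroup H] [InnerProductSpace ℝ H]
  {Ω : Type v} [MeasurableSpace Ω]

/-- `X` is an isonormal Gaussian process over `H`: a centered Gaussian family indexed by `H` with
covariance `E[X(g) X(h)] = ⟪g, h⟫`. -/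
structure IsIsonormal (X : H → Ω → ℝ) (P : Measure Ω) : Prop where
  gaussian : IsGaussianProcess X P
  centered : ∀ h, ∫ ω, X h ω ∂P = 0
  covariance : ∀ g h, ∫ ω, X g ω * X h ω ∂P = ⟪g, h⟫

/-- The graph of the multiple integral `I_q`, which is the continuous linear extension of
`h^{⊗ q} ↦ H_q(X(h))`, `‖h‖ = 1`, to the `q`-th symmetric tensor power: the closed linear span of
the pairs `(h^{⊗ q}, H_q(X(h)))`, `‖h‖ = 1`. Mathlib's `Polynomial.hermite` is
`(-1)^q exp(x²/2) (d/dx)^q exp(-x²/2)`. -/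
def integralGraph [CompleteSpace H] (X : H → Ω → ℝ) (P : Measure Ω) (q : ℕ) :
    Submodule ℝ (HilbertPow H q × Lp ℝ 2 P) :=
  (Submodule.span ℝ {p : HilbertPow H q × Lp ℝ 2 P | ∃ h : H, ‖h‖ = 1 ∧ p.1 = purePow h q ∧
    p.2 =ᵐ[P] fun ω => Polynomial.aeval (X h ω) (Polynomial.hermite q)}).topologicalClosure

/-- `F = I_q(f)`. -/
def IsMultipleIntegral [CompleteSpace H] (X : H → Ω → ℝ) (P : Measure Ω) (q : ℕ)
    (f : symPow H q) (F : Lp ℝ 2 P) : Prop :=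
  ((f : HilbertPow H q), F) ∈ integralGraph X P q

/-! ### Malliavin derivatives of order one and two -/

/-- Partial derivative with respect to the `i`-th variable. -/
def pderiv {n : ℕ} (i : Fin n) (g : (Fin n → ℝ) → ℝ) (x : Fin n → ℝ) : ℝ :=
  fderiv ℝ g x (Pi.single i 1)

variable (H) in
/-- Data of a smooth cylindrical random variable `g(X(φ₁), …, X(φₙ))`, with `n ≥ 1` and `g` smooth
with compact support. -/
structure Cylinder where
  n : ℕ
  n_pos : 0 < n
  φ : Fin n → H
  g : (Fin n → ℝ) → ℝ
  smooth : ContDiff ℝ ((⊤ : ℕ∞) : WithTop ℕ∞) g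
  compact : HasCompactSupport g

/-- The random variable `g(X(φ₁), …, X(φₙ))`. -/
def Cylinder.val (S : Cylinder H) (X : H → Ω → ℝ) (ω : Ω) : ℝ :=
  S.g fun i => X (S.φ i) ω

/-- The Malliavin derivative `∑ᵢ ∂ᵢg(X(φ₁), …, X(φₙ)) φᵢ`. -/
def Cylinder.deriv₁ (S : Cylinder H) (X : H → Ω → ℝ) (ω : Ω) : H :=
  ∑ i, pderiv i S.g (fun k => X (S.φ k) ω) • S.φ i

/-- The second Malliavin derivative `∑ᵢⱼ ∂ᵢ∂ⱼg(X(φ₁), …, X(φₙ)) φᵢ ⊗ φⱼ`. -/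
def Cylinder.deriv₂ (S : Cylinder H) (X : H → Ω → ℝ) (ω : Ω) : HilbertTensor H H :=
  ∑ i, ∑ j, pderiv i (pderiv j S.g) (fun k => X (S.φ k) ω) • tmulL H H (S.φ i) (S.φ j)

/-- `F` is in `𝔻^{2,p}` with `DF = D₁` and `D²F = D₂`: some sequence of smooth cylindrical random
variables converges to `F` in `L^p`, while its first and second derivatives converge to `D₁` and
`D₂` in `L^p`. That is, `𝔻^{2,p}` is the closure of the smooth cylindrical random variables for
`(E|F|^p + E‖DF‖^p + E‖D²F‖^p)^{1/p}`, and the derivatives are extended by continuity. -/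
def IsMalliavinTwice (X : H → Ω → ℝ) (P : Measure Ω) (p : ℝ≥0∞) (F : Ω → ℝ) (D₁ : Ω → H)
    (D₂ : Ω → HilbertTensor H H) : Prop :=
  MemLp F p P ∧ MemLp D₁ p P ∧ MemLp D₂ p P ∧
    ∃ S : ℕ → Cylinder H,
      Tendsto (fun m => eLpNorm (fun ω => (S m).val X ω - F ω) p P) atTop (𝓝 0) ∧
      Tendsto (fun m => eLpNorm (fun ω => (S m).deriv₁ X ω - D₁ ω) p P) atTop (𝓝 0) ∧
      Tendsto (fun m => eLpNorm (fun ω => (S m).deriv₂ X ω - D₂ ω) p P) atTop (𝓝 0)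

/-- `F ∈ 𝔻^{2,p}`. -/
def MemD2 (X : H → Ω → ℝ) (P : Measure Ω) (p : ℝ≥0∞) (F : Ω → ℝ) : Prop :=
  ∃ D₁ D₂, IsMalliavinTwice X P p F D₁ D₂

/-- `D₂` is (a version of) the second Malliavin derivative `D²F` of `F ∈ 𝔻^{2,2}`. -/
def IsSecondMalliavinDeriv (X : H → Ω → ℝ) (P : Measure Ω) (F : Ω → ℝ)
    (D₂ : Ω → HilbertTensor H H) : Prop :=
  ∃ D₁, IsMalliavinTwice X P 2 F D₁ D₂

end Gaussian

end WienerChaos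

end

/-! Finite sums `∑ c_h H_q(X(h))` over unit vectors (`wickVal`) approximate `F_k` in `L²`. In an
orthonormal basis of the span of the `h`, such a sum and its derivatives are polynomials in finitely
many independent standard Gaussians. The estimates are therefore proved for polynomials, against a
functional `GaussFun` that knows only normalization, integration by parts and positivity. The
annihilation and creation operators `pd`, `cr` and their commutation relation give the chaos
decomposition, the eigenvalues of the number operator, the Gaussian Poincaré inequality and, by
induction on the order, bounds of `L⁴` and `L⁸` norms by `L²` norms (`hyper₄`, `hyper₈`).

Write `T` for the operator of `D²F`. Conditions (ii) and (iii) are equivalent because `D²F ⊗₁ D²F`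
is the kernel of `T T*`, so that `‖T‖² ≤ ‖T T*‖_HS ≤ ‖T‖ ‖T‖_HS`, and `‖T‖_HS` is bounded in `L⁴` by
hypercontractivity.

(iii) implies (i): the Poincaré inequality for `‖DF‖²` gives `Var ‖DF‖² ≤ 4 E[‖T‖² ‖DF‖²]`, so `q⁻¹
‖DF‖²` tends to `1` in `L²`. Since `q E[F f(F)] = E[f'(F) ‖DF‖²]`, the functions `f(x) = sin(t x +
a)` show that the characteristic function nearly solves `u' = -t u`, whose solution is the Gaussian
one.

(i) implies (iii): the `L⁸` bound turns convergence in law into `limsup E F⁴ ≤ 3`. The fourth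
cumulant dominates the norms of the contractions `f ⊗_r f`, `0 < r < q` (`sum_contrSq_le`).
Iterating the Poincaré inequality, these dominate `E ‖T* T‖²_HS ≥ E ‖T‖⁴` (`contr_grad_le`).

A general `F_k` is replaced by a Wick sum whose error is at most `1/(k+1)` in `L²`, and in `L⁴` for
the second derivative; all three conditions survive. This uses that `D²` is closed and well defined,
the latter by integrating by parts twice. -/

noncomputable section

/-! ### Creation and annihilation operators, chaoses, the Gaussian Poincaré inequality. -/

namespace GaussPoly

variable {ι : Type*}

/-- Partial derivative of a polynomial, as a linear map. -/
def pd (i : ι) : MvPolynomial ι ℝ →ₗ[ℝ] MvPolynomial ι ℝ := (MvPolynomial.pderiv i).toLinearMap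

theorem pd_mul (i : ι) (p r : MvPolynomial ι ℝ) : pd i (p * r) = pd i p * r + p * pd i r := by
  simp [pd, Derivation.leibniz]; ring

@[simp] theorem pd_one (i : ι) : pd i (1 : MvPolynomial ι ℝ) = 0 := by simp [pd]

@[simp] theorem pd_C (i : ι) (a : ℝ) : pd i (MvPolynomial.C a : MvPolynomial ι ℝ) = 0 := by
  simp [pd]

theorem pd_X [DecidableEq ι] (i j : ι) : pd i (MvPolynomial.X j : MvPolynomial ι ℝ) =
    if i = j then 1 else 0 := by
  simp [pd, MvPolynomial.pderiv_X, Pi.single_apply, eq_comm]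

theorem pd_comm (i j : ι) (p : MvPolynomial ι ℝ) : pd i (pd j p) = pd j (pd i p) := by
  classical
  induction p using MvPolynomial.induction_on with
  | C a => simp
  | add p q hp hq => simp [hp, hq]
  | mul_X p k hp =>
    have h : ∀ a b : ι, pd a (pd b (MvPolynomial.X k : MvPolynomial ι ℝ)) = 0 := by
      intro a b; rw [pd_X]; split_ifs <;> simp
    simp only [pd_mul, map_add, hp, h]; ring

/-- The creation operator `p ↦ xᵢ p - ∂ᵢ p`, adjoint to `∂ᵢ` for the Gaussian expectation. -/
def cr (i : ι) : MvPolynomial ι ℝ →ₗ[ℝ] MvPolynomial ι ℝ :=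
  LinearMap.mulLeft ℝ (MvPolynomial.X i) - pd i

theorem cr_apply (i : ι) (p : MvPolynomial ι ℝ) : cr i p = MvPolynomial.X i * p - pd i p := rfl

/-- The canonical commutation relation `[∂ᵢ, cr j] = δᵢⱼ`, from which the facts on chaoses, on the
number operator and on Wick powers below are derived. -/
theorem pd_cr [DecidableEq ι] (i j : ι) (p : MvPolynomial ι ℝ) :
    pd i (cr j p) = cr j (pd i p) + if i = j then p else 0 := by
  rw [cr_apply, cr_apply, map_sub, pd_mul, pd_X, pd_comm]
  split_ifs <;> ring

theorem cr_comm (i k : ι) (r : MvPolynomial ι ℝ) : cr i (cr k r) = cr k (cr i r) := by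
  classical
  rw [cr_apply i (cr k r), pd_cr i k, cr_apply k (cr i r), pd_cr k i, cr_apply k r, cr_apply i r,
    cr_apply k (pd i r), cr_apply i (pd k r), pd_comm i k]
  by_cases h : i = k
  · subst h; rfl
  · rw [if_neg h, if_neg (Ne.symm h)]; ring

/-- The algebraic description of a Wiener chaos. -/
def chaos (ι : Type*) : ℕ → Submodule ℝ (MvPolynomial ι ℝ)
  | 0 => Submodule.span ℝ {1}
  | n + 1 => ⨆ i : ι, (chaos ι n).map (cr i)

theorem cr_mem_chaos {n : ℕ} (i : ι) {p : MvPolynomial ι ℝ} (hp : p ∈ chaos ι n) :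
    cr i p ∈ chaos ι (n + 1) :=
  Submodule.mem_iSup_of_mem i (Submodule.mem_map_of_mem hp)

theorem chaos_succ_induction {n : ℕ} {S : Submodule ℝ (MvPolynomial ι ℝ)}
    (h : ∀ i, ∀ p ∈ chaos ι n, cr i p ∈ S) : chaos ι (n + 1) ≤ S :=
  iSup_le fun i => Submodule.map_le_iff_le_comap.2 fun p hp => h i p hp

theorem pd_chaos_zero {p : MvPolynomial ι ℝ} (hp : p ∈ chaos ι 0) (i : ι) : pd i p = 0 := by
  obtain ⟨c, rfl⟩ := Submodule.mem_span_singleton.1 hp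
  simp

theorem pd_mem_chaos {n : ℕ} (i : ι) {p : MvPolynomial ι ℝ} (hp : p ∈ chaos ι (n + 1)) :
    pd i p ∈ chaos ι n := by
  classical
  induction n generalizing p with
  | zero =>
    refine chaos_succ_induction (S := (chaos ι 0).comap (pd i)) (fun j r hr => ?_) hp
    rw [Submodule.mem_comap, pd_cr, pd_chaos_zero hr, map_zero, zero_add]
    split_ifs
    · exact hr
    · exact zero_mem _
  | succ n ih =>
    refine chaos_succ_induction (S := (chaos ι (n + 1)).comap (pd i)) (fun j r hr => ?_) hp
    rw [Submodule.mem_comap, pd_cr]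
    refine add_mem (cr_mem_chaos j (ih hr)) ?_
    split_ifs
    · exact hr
    · exact zero_mem _

/-- The sum of the chaoses contains the constants and is stable under `cr` and `pd`, hence under
multiplication by a variable, which is `cr k + pd k`. -/
theorem iSup_chaos : ⨆ n, chaos ι n = ⊤ := by
  classical
  rw [eq_top_iff]
  rintro p -
  have hpd : ∀ i, (⨆ n, chaos ι n) ≤ (⨆ n, chaos ι n).comap (pd i) := by
    refine fun i => iSup_le fun n => ?_
    cases n with
    | zero => intro r hr; simp [pd_chaos_zero hr]
    | succ n => exact fun r hr => Submodule.mem_iSup_of_mem n (pd_mem_chaos i hr)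
  have hcr : ∀ i, (⨆ n, chaos ι n) ≤ (⨆ n, chaos ι n).comap (cr i) :=
    fun i => iSup_le fun n r hr => Submodule.mem_iSup_of_mem (n + 1) (cr_mem_chaos i hr)
  induction p using MvPolynomial.induction_on with
  | C a =>
    refine Submodule.mem_iSup_of_mem 0 (Submodule.mem_span_singleton.2 ⟨a, ?_⟩)
    rw [MvPolynomial.smul_eq_C_mul, mul_one]
  | add p q hp hq => exact add_mem hp hq
  | mul_X p k hp =>
    have : p * MvPolynomial.X k = cr k p + pd k p := by rw [cr_apply]; ring
    rw [this]
    exact add_mem (hcr k hp) (hpd k hp)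

section Number

variable [Fintype ι]

/-- The number operator, minus the Ornstein-Uhlenbeck generator. -/
def num (ι : Type*) [Fintype ι] : MvPolynomial ι ℝ →ₗ[ℝ] MvPolynomial ι ℝ :=
  ∑ i, cr i ∘ₗ pd i

theorem num_apply (p : MvPolynomial ι ℝ) : num ι p = ∑ i, cr i (pd i p) := by
  simp [num]

/-- `cr j` raises an eigenvalue of the number operator by one; induction then gives
`num_of_mem_chaos`. -/
theorem num_cr (j : ι) (p : MvPolynomial ι ℝ) : num ι (cr j p) = cr j (num ι p) + cr j p := by
  classical
  have h : ∀ i, cr i (pd i (cr j p)) = cr j (cr i (pd i p)) + if i = j then cr i p else 0 := by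
    intro i
    rw [pd_cr, map_add, cr_comm]
    split_ifs
    · rfl
    · rw [map_zero]
  rw [num_apply, num_apply, Finset.sum_congr rfl fun i _ => h i, Finset.sum_add_distrib, map_sum,
    Finset.sum_ite_eq' Finset.univ j, if_pos (Finset.mem_univ j)]

theorem pd_num (j : ι) (p : MvPolynomial ι ℝ) : pd j (num ι p) = num ι (pd j p) + pd j p := by
  classical
  have h : ∀ i, pd j (cr i (pd i p)) = cr i (pd i (pd j p)) + if j = i then pd i p else 0 := by
    intro i
    rw [pd_cr, pd_comm]
  rw [num_apply, num_apply, map_sum, Finset.sum_congr rfl fun i _ => h i, Finset.sum_add_distrib,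
    Finset.sum_ite_eq Finset.univ j, if_pos (Finset.mem_univ j)]

theorem num_of_mem_chaos {n : ℕ} {p : MvPolynomial ι ℝ} (hp : p ∈ chaos ι n) :
    num ι p = (n : ℝ) • p := by
  induction n generalizing p with
  | zero => simp [num_apply, pd_chaos_zero hp]
  | succ n ih =>
    have h := chaos_succ_induction
      (S := LinearMap.ker (num ι - ((n + 1 : ℕ) : ℝ) • LinearMap.id)) (fun j r hr => ?_) hp
    · rwa [LinearMap.mem_ker, LinearMap.sub_apply, LinearMap.smul_apply, LinearMap.id_apply,
        sub_eq_zero] at h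
    · simp [num_cr, ih hr, add_smul]

/-- The number operator is multiplication by `n` on the chaos of order `n`, hence invertible there
for `n ≥ 1`; only the constants are missed. Solving `num r = p - c` is what starts the proof of the
Poincaré inequality. -/
theorem exists_num_add (p : MvPolynomial ι ℝ) : ∃ r c, p = num ι r + MvPolynomial.C c := by
  have hp : p ∈ ⨆ n, chaos ι n := by rw [iSup_chaos]; trivial
  induction hp using Submodule.iSup_induction' with
  | mem n p hp =>
    cases n with
    | zero =>
      obtain ⟨c, rfl⟩ := Submodule.mem_span_singleton.1 hp
      exact ⟨0, c, by simp [MvPolynomial.smul_eq_C_mul]⟩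
    | succ n =>
      refine ⟨((n + 1 : ℕ) : ℝ)⁻¹ • p, 0, ?_⟩
      rw [map_smul, num_of_mem_chaos hp, smul_smul, inv_mul_cancel₀ (by positivity)]
      simp
  | zero => exact ⟨0, 0, by simp⟩
  | add p q _ _ hp hq =>
    obtain ⟨r, c, rfl⟩ := hp
    obtain ⟨r', c', rfl⟩ := hq
    exact ⟨r + r', c + c', by simp only [map_add]; ring⟩

end Number

/-- A normalized positive functional on polynomials satisfying the Gaussian integration by parts
formula, i.e. the expectation under the standard Gaussian measure. -/
structure GaussFun (ι : Type*) where
  E : MvPolynomial ι ℝ →ₗ[ℝ] ℝ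
  one : E 1 = 1
  ibp : ∀ i p, E (MvPolynomial.X i * p) = E (pd i p)
  nonneg : ∀ p, (∀ x, 0 ≤ MvPolynomial.eval x p) → 0 ≤ E p

namespace GaussFun

variable (G : GaussFun ι)

theorem mono {p r : MvPolynomial ι ℝ} (h : ∀ x, MvPolynomial.eval x p ≤ MvPolynomial.eval x r) :
    G.E p ≤ G.E r := by
  have := G.nonneg (r - p) fun x => by simpa using h x
  simpa using this

theorem C (c : ℝ) : G.E (MvPolynomial.C c) = c := by
  have : (MvPolynomial.C c : MvPolynomial ι ℝ) = c • 1 := by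
    rw [MvPolynomial.smul_eq_C_mul, mul_one]
  rw [this, map_smul, G.one, smul_eq_mul, mul_one]

theorem C_mul (c : ℝ) (p : MvPolynomial ι ℝ) : G.E (MvPolynomial.C c * p) = c * G.E p := by
  rw [← MvPolynomial.smul_eq_C_mul, map_smul, smul_eq_mul]

theorem sq_nonneg (p : MvPolynomial ι ℝ) : 0 ≤ G.E (p ^ 2) :=
  G.nonneg _ fun x => by rw [map_pow]; positivity

theorem cr_mul (i : ι) (p r : MvPolynomial ι ℝ) : G.E (cr i p * r) = G.E (p * pd i r) := by
  rw [cr_apply, sub_mul, mul_assoc, map_sub, G.ibp, pd_mul, map_add]; ring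

theorem mul_cr (i : ι) (p r : MvPolynomial ι ℝ) : G.E (p * cr i r) = G.E (pd i p * r) := by
  rw [mul_comm, cr_mul, mul_comm]

variable [Fintype ι]

theorem mul_num (p r : MvPolynomial ι ℝ) : G.E (p * num ι r) = ∑ i, G.E (pd i p * pd i r) := by
  rw [num_apply, Finset.mul_sum, map_sum]
  exact Finset.sum_congr rfl fun i _ => G.mul_cr i _ _

/-- The Gaussian Poincaré inequality. -/
theorem poincare (p : MvPolynomial ι ℝ) :
    G.E (p ^ 2) ≤ G.E p ^ 2 + ∑ i, G.E (pd i p ^ 2) := by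
  obtain ⟨r, c, rfl⟩ := exists_num_add p
  have h0 : G.E (num ι r) = 0 := by simpa using G.mul_num 1 r
  -- With `V = E((num r)²)`: `V` equals both `E⟨∇ num r, ∇r⟩` and `E|∇r|² + E|∇²r|²`. Hence `2V ≤
  -- E|∇ num r|² + E|∇r|² ≤ E|∇ num r|² + V`.
  have e1 : G.E (num ι r ^ 2) = ∑ i, G.E (pd i (num ι r) * pd i r) := by rw [sq, mul_num]
  have e2 : G.E (num ι r ^ 2) = ∑ i, G.E (pd i r ^ 2) + ∑ i, ∑ j, G.E (pd j (pd i r) ^ 2) := by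
    rw [e1, ← Finset.sum_add_distrib]
    refine Finset.sum_congr rfl fun i _ => ?_
    rw [pd_num, add_mul, map_add, mul_comm, mul_num, add_comm]
    simp only [sq]
  have e3 : (0 : ℝ) ≤ ∑ i, ∑ j, G.E (pd j (pd i r) ^ 2) :=
    Finset.sum_nonneg fun i _ => Finset.sum_nonneg fun j _ => G.sq_nonneg _
  have e4 : 2 * ∑ i, G.E (pd i (num ι r) * pd i r) ≤
      ∑ i, G.E (pd i (num ι r) ^ 2) + ∑ i, G.E (pd i r ^ 2) := by
    rw [Finset.mul_sum, ← Finset.sum_add_distrib]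
    refine Finset.sum_le_sum fun i _ => ?_
    have := G.sq_nonneg (pd i (num ι r) - pd i r)
    have h2 : (pd i (num ι r) - pd i r) ^ 2 = pd i (num ι r) ^ 2 + pd i r ^ 2
        - (2 : ℝ) • (pd i (num ι r) * pd i r) := by
      rw [MvPolynomial.smul_eq_C_mul, map_ofNat]; ring
    rw [h2, map_sub, map_add, map_smul, smul_eq_mul] at this
    linarith
  have e5 : G.E ((num ι r + MvPolynomial.C c) ^ 2) = G.E (num ι r ^ 2) + c ^ 2 := by
    have : (num ι r + MvPolynomial.C c) ^ 2 = num ι r ^ 2 + MvPolynomial.C (2 * c) * num ι r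
        + MvPolynomial.C (c ^ 2) := by
      simp only [map_mul, map_pow, map_ofNat]; ring
    rw [this, map_add, map_add, C_mul, C, h0]; ring
  rw [e5, map_add, h0, C]
  simp only [map_add, pd_C, add_zero, zero_add]
  linarith

/-- The expected squared gradient of an element of the `n`-th chaos. -/
theorem sum_pd_sq {n : ℕ} {p : MvPolynomial ι ℝ} (hp : p ∈ chaos ι n) :
    ∑ i, G.E (pd i p ^ 2) = n * G.E (p ^ 2) := by
  have := G.mul_num p p
  rw [num_of_mem_chaos hp, mul_smul_comm, map_smul, smul_eq_mul] at this
  simp only [sq, this]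

end GaussFun

end GaussPoly

/-! ### Hypercontractivity and second order Poincaré estimates. -/

namespace GaussPoly

open MvPolynomial (eval)

variable {ι : Type}

theorem pd_sum_sq {S : Type} [Fintype S] (g : S → MvPolynomial ι ℝ) (i : ι) :
    pd i (∑ s, g s ^ 2) = 2 * ∑ s, g s * pd i (g s) := by
  rw [map_sum, Finset.mul_sum]
  exact Finset.sum_congr rfl fun s _ => by rw [sq, pd_mul]; ring

theorem eval_sum_sq_nonneg {S : Type} [Fintype S] (g : S → MvPolynomial ι ℝ) (x : ι → ℝ) :
    0 ≤ eval x (∑ s, g s ^ 2) := by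
  rw [map_sum]
  exact Finset.sum_nonneg fun s _ => by rw [map_pow]; positivity

variable [Fintype ι]

/-- Constants in the `L²`-`L⁴` hypercontractivity estimate. -/
def hyperConst₄ : ℕ → ℝ
  | 0 => 1
  | n + 1 => 2 + 16 * ((n + 1 : ℕ) : ℝ) ^ 2 * hyperConst₄ n

/-- Constants in the `L²`-`L⁸` hypercontractivity estimate. -/
def hyperConst₈ : ℕ → ℝ
  | 0 => 1
  | n + 1 => 2 * hyperConst₄ (n + 1) ^ 2 + 1048576 * ((n + 1 : ℕ) : ℝ) ^ 4 * hyperConst₈ n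

theorem hyperConst₈_nonneg : ∀ n, 0 ≤ hyperConst₈ n
  | 0 => zero_le_one
  | n + 1 => by
    have := hyperConst₈_nonneg n
    rw [hyperConst₈]; positivity

/-- Chain rule and Cauchy-Schwarz in `s`: `|∇|g|²|² ≤ 4 |g|² |∇g|²`, where `∇g` is a family indexed
by `ι × S`. -/
theorem sum_sq_pd_sum_sq_le {S : Type} [Fintype S] (g : S → MvPolynomial ι ℝ) (x : ι → ℝ) :
    ∑ i, eval x (pd i (∑ s, g s ^ 2)) ^ 2 ≤
      4 * (eval x (∑ s, g s ^ 2) * eval x (∑ z : ι × S, pd z.1 (g z.2) ^ 2)) := by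
  have h : ∀ i, eval x (pd i (∑ s, g s ^ 2)) ^ 2 ≤
      4 * ((∑ s, eval x (g s) ^ 2) * ∑ s, eval x (pd i (g s)) ^ 2) := by
    intro i
    rw [pd_sum_sq, map_mul, map_ofNat, map_sum, mul_pow]
    simp only [map_mul]
    have := Finset.sum_mul_sq_le_sq_mul_sq Finset.univ (fun s => eval x (g s))
      (fun s => eval x (pd i (g s)))
    linarith
  refine (Finset.sum_le_sum fun i _ => h i).trans (le_of_eq ?_)
  rw [← Finset.mul_sum, ← Finset.mul_sum, Fintype.sum_prod_type]
  simp only [map_sum, map_pow]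

namespace GaussFun

variable (G : GaussFun ι)

theorem E_sum_pd_sq {S : Type} [Fintype S] {n : ℕ} {g : S → MvPolynomial ι ℝ}
    (hg : ∀ s, g s ∈ chaos ι n) :
    G.E (∑ z : ι × S, pd z.1 (g z.2) ^ 2) = n * G.E (∑ s, g s ^ 2) := by
  rw [map_sum G.E, map_sum G.E, Finset.mul_sum,
    Fintype.sum_prod_type_right (fun z : ι × S => G.E (pd z.1 (g z.2) ^ 2))]
  refine Finset.sum_congr rfl fun s _ => ?_
  dsimp only
  rw [G.sum_pd_sq (hg s)]

/-- Induction on the order of the chaos. The Poincaré inequality for `|g|²` costs `4 E(|g|² |∇g|²) ≤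
½ E|g|⁴ + 8 E|∇g|⁴`; the first half is absorbed on the left and the induction hypothesis bounds the
rest. The statement is about families because `∇g` is one, of order lower by one. -/
theorem hyper₄ {n : ℕ} {S : Type} [Fintype S] {g : S → MvPolynomial ι ℝ}
    (hg : ∀ s, g s ∈ chaos ι n) :
    G.E ((∑ s, g s ^ 2) ^ 2) ≤ hyperConst₄ n * G.E (∑ s, g s ^ 2) ^ 2 := by
  induction n generalizing S with
  | zero =>
    have h0 : ∀ i, pd i (∑ s, g s ^ 2) = 0 := fun i => by
      rw [pd_sum_sq]; simp [pd_chaos_zero (hg _)]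
    refine (G.poincare _).trans (le_of_eq ?_)
    simp only [h0, hyperConst₄]
    simp
  | succ n ih =>
    have h1 := G.poincare (∑ s, g s ^ 2)
    have h2 := ih (S := ι × S) (g := fun z => pd z.1 (g z.2)) fun z => pd_mem_chaos _ (hg _)
    rw [G.E_sum_pd_sq hg] at h2
    have h3 : ∑ i, G.E (pd i (∑ s, g s ^ 2) ^ 2) ≤
        G.E ((1 / 2 : ℝ) • (∑ s, g s ^ 2) ^ 2 +
          (8 : ℝ) • (∑ z : ι × S, pd z.1 (g z.2) ^ 2) ^ 2) := by
      rw [← map_sum]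
      refine G.mono fun x => ?_
      have := sum_sq_pd_sum_sq_le g x
      rw [map_sum, map_add, MvPolynomial.smul_eval, MvPolynomial.smul_eval]
      simp only [map_pow (eval x) _ 2] at this ⊢
      nlinarith [_root_.sq_nonneg (eval x (∑ s, g s ^ 2) -
        4 * eval x (∑ z : ι × S, pd z.1 (g z.2) ^ 2))]
    rw [map_add, map_smul, map_smul, smul_eq_mul, smul_eq_mul] at h3
    rw [hyperConst₄]
    nlinarith

/-- The same induction, with the Poincaré inequality applied to `|g|⁴`. Its mean is bounded by
`hyper₄`, and its squared gradient is at most `16 |g|⁶ |∇g|²`. -/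
theorem hyper₈ {n : ℕ} {S : Type} [Fintype S] {g : S → MvPolynomial ι ℝ}
    (hg : ∀ s, g s ∈ chaos ι n) :
    G.E ((∑ s, g s ^ 2) ^ 4) ≤ hyperConst₈ n * G.E (∑ s, g s ^ 2) ^ 4 := by
  have hsq : ∀ i, ∀ p : MvPolynomial ι ℝ, pd i (p ^ 2) = 2 * p * pd i p := by
    intro i p; rw [sq, pd_mul]; ring
  induction n generalizing S with
  | zero =>
    have h1 := G.poincare ((∑ s, g s ^ 2) ^ 2)
    have h2 := G.poincare (∑ s, g s ^ 2)
    have h0 : ∀ i, pd i (∑ s, g s ^ 2) = 0 := fun i => by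
      rw [pd_sum_sq]; simp [pd_chaos_zero (hg _)]
    simp only [hsq, h0, mul_zero, ne_eq, OfNat.ofNat_ne_zero, not_false_eq_true, zero_pow, map_zero,
      Finset.sum_const_zero, add_zero] at h1 h2
    rw [← pow_mul] at h1
    have h3 := G.sq_nonneg (∑ s, g s ^ 2)
    rw [hyperConst₈, one_mul]
    calc _ ≤ _ := h1
      _ ≤ (G.E (∑ s, g s ^ 2) ^ 2) ^ 2 := by gcongr
      _ = _ := by ring
  | succ n ih =>
    have h1 := G.poincare ((∑ s, g s ^ 2) ^ 2)
    rw [← pow_mul] at h1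
    have h2 := ih (S := ι × S) (g := fun z => pd z.1 (g z.2)) fun z => pd_mem_chaos _ (hg _)
    rw [G.E_sum_pd_sq hg] at h2
    have h3 : ∑ i, G.E (pd i ((∑ s, g s ^ 2) ^ 2) ^ 2) ≤
        G.E ((1 / 2 : ℝ) • (∑ s, g s ^ 2) ^ 4 +
          (524288 : ℝ) • (∑ z : ι × S, pd z.1 (g z.2) ^ 2) ^ 4) := by
      rw [← map_sum]
      refine G.mono fun x => ?_
      have h := sum_sq_pd_sum_sq_le g x
      have hP := eval_sum_sq_nonneg g x
      have hN := eval_sum_sq_nonneg (fun z : ι × S => pd z.1 (g z.2)) x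
      rw [map_sum, map_add, MvPolynomial.smul_eval, MvPolynomial.smul_eval]
      have h' : ∑ i, eval x (pd i ((∑ s, g s ^ 2) ^ 2) ^ 2) =
          4 * eval x (∑ s, g s ^ 2) ^ 2 * ∑ i, eval x (pd i (∑ s, g s ^ 2)) ^ 2 := by
        rw [Finset.mul_sum]
        refine Finset.sum_congr rfl fun i _ => ?_
        rw [hsq, map_pow, map_mul, map_mul, map_ofNat]; ring
      rw [h', map_pow, map_pow (eval x) _ 4]
      revert h hP hN
      generalize eval x (∑ s, g s ^ 2) = P
      generalize eval x (∑ z : ι × S, pd z.1 (g z.2) ^ 2) = N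
      generalize ∑ i, eval x (pd i (∑ s, g s ^ 2)) ^ 2 = D
      intro h hP hN
      have h4 : 4 * P ^ 2 * D ≤ 16 * P ^ 3 * N := by
        calc 4 * P ^ 2 * D ≤ 4 * P ^ 2 * (4 * (P * N)) := by gcongr
          _ = _ := by ring
      refine h4.trans ?_
      -- If `32 N ≤ P`, then `16 P³ N` is at most half of `P⁴` and can be absorbed; otherwise `P³ ≤
      -- (32 N)³`, and `16 · 32³ = 524288`.
      rcases le_total (32 * N) P with hc | hc
      · have : 16 * P ^ 3 * N ≤ 1 / 2 * P ^ 4 := by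
          calc 16 * P ^ 3 * N = 1 / 2 * P ^ 3 * (32 * N) := by ring
            _ ≤ 1 / 2 * P ^ 3 * P := by gcongr
            _ = _ := by ring
        have : 0 ≤ N ^ 4 := by positivity
        linarith
      · have : 16 * P ^ 3 * N ≤ 524288 * N ^ 4 := by
          calc 16 * P ^ 3 * N ≤ 16 * (32 * N) ^ 3 * N := by gcongr
            _ = _ := by ring
        have : 0 ≤ P ^ 4 := by positivity
        linarith
    rw [map_add, map_smul, map_smul, smul_eq_mul, smul_eq_mul] at h3
    have h5 : G.E ((∑ s, g s ^ 2) ^ 2) ^ 2 ≤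
        (hyperConst₄ (n + 1) * G.E (∑ s, g s ^ 2) ^ 2) ^ 2 := by
      have := G.sq_nonneg (∑ s, g s ^ 2)
      have := G.hyper₄ hg
      gcongr
    rw [hyperConst₈]
    norm_num at h1 h2 h3 h5 ⊢
    nlinarith

/-- The second order Poincaré estimate for the squared gradient. -/
theorem variance_gradient_le (p : MvPolynomial ι ℝ) :
    G.E ((∑ i, pd i p ^ 2) ^ 2) ≤ G.E (∑ i, pd i p ^ 2) ^ 2 +
      4 * G.E (∑ i, (∑ j, pd i (pd j p) * pd j p) ^ 2) := by
  have h : ∀ i, G.E (pd i (∑ j, pd j p ^ 2) ^ 2) =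
      4 * G.E ((∑ j, pd i (pd j p) * pd j p) ^ 2) := by
    intro i
    have e : pd i (∑ j, pd j p ^ 2) ^ 2 =
        MvPolynomial.C 4 * (∑ j, pd i (pd j p) * pd j p) ^ 2 := by
      rw [pd_sum_sq, mul_pow, map_ofNat,
        Finset.sum_congr rfl fun j _ => mul_comm (pd j p) (pd i (pd j p))]
      ring
    rw [e, C_mul]
  have := G.poincare (∑ i, pd i p ^ 2)
  rwa [Finset.sum_congr rfl fun i _ => h i, ← Finset.mul_sum, ← map_sum] at this

/-- The sum of the second moments of the contractions `∑ᵢ ∂ᵢu ∂ᵢv`. -/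
def contr {S T : Type} [Fintype S] [Fintype T] (u : S → MvPolynomial ι ℝ)
    (v : T → MvPolynomial ι ℝ) : ℝ :=
  ∑ s, ∑ t, G.E ((∑ i, pd i (u s) * pd i (v t)) ^ 2)

/-- The Poincaré inequality for each entry, the product rule and `(a + b)² ≤ 2a² + 2b²`. It trades a
random contraction for its means, which are deterministic contractions of kernels, plus random
contractions in which one factor has been differentiated once more. -/
theorem contr_le {S T : Type} [Fintype S] [Fintype T] (u : S → MvPolynomial ι ℝ)
    (v : T → MvPolynomial ι ℝ) :
    G.contr u v ≤ ∑ s, ∑ t, G.E (∑ i, pd i (u s) * pd i (v t)) ^ 2 +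
      2 * G.contr (fun z : ι × S => pd z.1 (u z.2)) v +
      2 * G.contr u (fun z : ι × T => pd z.1 (v z.2)) := by
  have key : ∀ s t, G.E ((∑ i, pd i (u s) * pd i (v t)) ^ 2) ≤
      G.E (∑ i, pd i (u s) * pd i (v t)) ^ 2 +
      (2 * ∑ k, G.E ((∑ i, pd i (pd k (u s)) * pd i (v t)) ^ 2) +
      2 * ∑ k, G.E ((∑ i, pd i (u s) * pd i (pd k (v t))) ^ 2)) := by
    intro s t
    refine (G.poincare _).trans (add_le_add le_rfl ?_)
    rw [Finset.mul_sum, Finset.mul_sum, ← Finset.sum_add_distrib]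
    refine Finset.sum_le_sum fun k _ => ?_
    have h : pd k (∑ i, pd i (u s) * pd i (v t)) =
        ∑ i, pd i (pd k (u s)) * pd i (v t) + ∑ i, pd i (u s) * pd i (pd k (v t)) := by
      rw [map_sum, ← Finset.sum_add_distrib]
      exact Finset.sum_congr rfl fun i _ => by rw [pd_mul, pd_comm k i, pd_comm k i]
    rw [h]
    generalize ∑ i, pd i (pd k (u s)) * pd i (v t) = a
    generalize ∑ i, pd i (u s) * pd i (pd k (v t)) = b
    have := G.sq_nonneg (a - b)
    have e : (a + b) ^ 2 = (2 : ℝ) • a ^ 2 + (2 : ℝ) • b ^ 2 - (a - b) ^ 2 := by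
      rw [MvPolynomial.smul_eq_C_mul, MvPolynomial.smul_eq_C_mul, map_ofNat]; ring
    rw [e, map_sub, map_add, map_smul, map_smul, smul_eq_mul, smul_eq_mul]
    linarith
  refine (Finset.sum_le_sum fun s _ => Finset.sum_le_sum fun t _ => key s t).trans (le_of_eq ?_)
  simp only [contr, Finset.sum_add_distrib, ← Finset.mul_sum]
  rw [Fintype.sum_prod_type_right, add_assoc]
  congr 3
  · refine Finset.sum_congr rfl fun s _ => Finset.sum_comm
  · refine Finset.sum_congr rfl fun s _ => ?_
    rw [Fintype.sum_prod_type_right]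

end GaussFun

end GaussPoly

/-! ### Wick powers, Hermite polynomials and iterated derivatives of Wick products. -/

namespace GaussPoly

open MvPolynomial (eval)

variable {ι : Type} [Fintype ι]

/-- Directional derivative of a polynomial. -/
def pdv (a : ι → ℝ) : Module.End ℝ (MvPolynomial ι ℝ) := ∑ i, a i • pd i

/-- Directional creation operator. -/
def crv (a : ι → ℝ) : Module.End ℝ (MvPolynomial ι ℝ) := ∑ i, a i • cr i

theorem pdv_apply (a : ι → ℝ) (p : MvPolynomial ι ℝ) : pdv a p = ∑ i, a i • pd i p := by
  simp [pdv]

theorem crv_apply (a : ι → ℝ) (p : MvPolynomial ι ℝ) : crv a p = ∑ i, a i • cr i p := by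
  simp [crv]

theorem pdv_one (a : ι → ℝ) : pdv a 1 = 0 := by simp [pdv_apply]

theorem pdv_mul (a : ι → ℝ) (p r : MvPolynomial ι ℝ) :
    pdv a (p * r) = pdv a p * r + p * pdv a r := by
  simp only [pdv_apply, pd_mul, smul_add, Finset.sum_add_distrib, Finset.sum_mul, Finset.mul_sum,
    smul_mul_assoc, mul_smul_comm]

theorem pd_crv (i : ι) (a : ι → ℝ) (p : MvPolynomial ι ℝ) :
    pd i (crv a p) = crv a (pd i p) + a i • p := by
  classical
  have h : ∀ j, pd i (a j • cr j p) = a j • cr j (pd i p) + if i = j then a j • p else 0 := by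
    intro j
    rw [map_smul, pd_cr, smul_add]
    split_ifs
    · rfl
    · rw [smul_zero]
  rw [crv_apply, crv_apply, map_sum, Finset.sum_congr rfl fun j _ => h j, Finset.sum_add_distrib,
    Finset.sum_ite_eq Finset.univ i, if_pos (Finset.mem_univ i)]

theorem pdv_crv (a b : ι → ℝ) (p : MvPolynomial ι ℝ) :
    pdv a (crv b p) = crv b (pdv a p) + (a ⬝ᵥ b) • p := by
  simp only [pdv_apply, pd_crv, smul_add, Finset.sum_add_distrib, map_sum, map_smul, dotProduct,
    Finset.sum_smul, smul_smul]

/-- The Wick power `:(a · x)ⁿ:`. -/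
def wick (a : ι → ℝ) : ℕ → MvPolynomial ι ℝ
  | 0 => 1
  | n + 1 => crv a (wick a n)

theorem wick_mem_chaos (a : ι → ℝ) (n : ℕ) : wick a n ∈ chaos ι n := by
  induction n with
  | zero => exact Submodule.mem_span_singleton_self 1
  | succ n ih =>
    rw [wick, crv_apply]
    exact sum_mem fun i _ => Submodule.smul_mem _ _ (cr_mem_chaos i ih)

/-- At `n = 0` the truncated `n - 1` is harmless, its coefficient being `0`. -/
theorem pd_wick (i : ι) (a : ι → ℝ) (n : ℕ) : pd i (wick a n) = (n * a i) • wick a (n - 1) := by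
  induction n with
  | zero => simp [wick]
  | succ n ih =>
    rw [wick, pd_crv, ih, map_smul, Nat.add_sub_cancel, Nat.cast_succ, add_mul, add_smul, one_mul]
    cases n with
    | zero => simp
    | succ n => rfl

theorem pdv_wick (c a : ι → ℝ) (n : ℕ) :
    pdv c (wick a n) = (n * (c ⬝ᵥ a)) • wick a (n - 1) := by
  simp only [pdv_apply, pd_wick, smul_smul, ← Finset.sum_smul, dotProduct, Finset.mul_sum]
  congr 1
  exact Finset.sum_congr rfl fun i _ => by ring

theorem eval_crv (a x : ι → ℝ) (p : MvPolynomial ι ℝ) :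
    eval x (crv a p) = (a ⬝ᵥ x) * eval x p - eval x (pdv a p) := by
  simp only [crv_apply, pdv_apply, map_sum, MvPolynomial.smul_eval, cr_apply, map_sub, map_mul,
    MvPolynomial.eval_X, dotProduct, Finset.sum_mul, ← Finset.sum_sub_distrib]
  exact Finset.sum_congr rfl fun i _ => by ring

/-- Both sides satisfy `w_{n+2} = (a·x) w_{n+1} - (n+1) w_n`; the last term carries a factor `a ⬝ᵥ
a` on the Wick side, which is why unit length is required. -/
theorem eval_wick (a x : ι → ℝ) (ha : a ⬝ᵥ a = 1) (n : ℕ) :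
    eval x (wick a n) = Polynomial.aeval (a ⬝ᵥ x) (Polynomial.hermite n) := by
  have hd : ∀ n : ℕ, Polynomial.derivative (Polynomial.hermite (n + 1)) =
      ((n : Polynomial ℤ) + 1) * Polynomial.hermite n := by
    intro n
    induction n with
    | zero => simp [Polynomial.hermite_succ]
    | succ n ih =>
      rw [Polynomial.hermite_succ (n + 1), Polynomial.derivative_sub, Polynomial.derivative_mul, ih]
      rw [Polynomial.hermite_succ n]
      simp only [Polynomial.derivative_mul, Polynomial.derivative_X, Polynomial.derivative_add,
        Polynomial.derivative_natCast, Polynomial.derivative_one]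
      push_cast
      ring
  induction n using Nat.twoStepInduction with
  | zero => simp [wick]
  | one => simp [wick, eval_crv, pdv_one, Polynomial.hermite_succ]
  | more n ih0 ih1 =>
    rw [wick, eval_crv, ih1, pdv_wick, ha, Polynomial.hermite_succ (n + 1), hd,
      MvPolynomial.smul_eval, Nat.add_sub_cancel, ih0]
    simp

/-- A two-parameter family of polynomials obeying the derivation rule of `:(b · x)ᵐ (b' · x)ⁿ:`. -/
structure IsWickFamily (b b' : ι → ℝ) (F : ℕ → ℕ → MvPolynomial ι ℝ) : Prop where
  zero : F 0 0 = 1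
  pdv_eq : ∀ c m n, pdv c (F m n) =
    (m * (c ⬝ᵥ b)) • F (m - 1) n + (n * (c ⬝ᵥ b')) • F m (n - 1)

/-- The ordinary product and the Wick product of `isWickFamily_crv`, its component of top order,
obey the same derivation rule. Their iterated derivatives down to constants therefore agree, which
yields `E(w p²) = E(w²)` in `sum_contrSq_le`. -/
theorem isWickFamily_mul (b b' : ι → ℝ) : IsWickFamily b b' fun m n => wick b m * wick b' n where
  zero := by simp [wick]
  pdv_eq c m n := by rw [pdv_mul, pdv_wick, pdv_wick, smul_mul_assoc, mul_smul_comm]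

theorem isWickFamily_crv (b b' : ι → ℝ) : IsWickFamily b b' fun m n => (crv b ^ m) (wick b' n) where
  zero := by simp [wick]
  pdv_eq c m n := by
    induction m with
    | zero => simp [pdv_wick]
    | succ m ih =>
      simp only [pow_succ', Module.End.mul_apply]
      rw [pdv_crv, ih, map_add, map_smul, map_smul, Nat.add_sub_cancel, Nat.cast_succ, add_mul,
        add_smul, one_mul]
      cases m with
      | zero => simp [add_comm]
      | succ m =>
        simp only [Nat.add_sub_cancel, pow_succ', Module.End.mul_apply]
        abel

/-- Lowering operator in the first index. -/
def lowerL (V : Type) [AddCommGroup V] [Module ℝ V] (x : ℝ) : Module.End ℝ (ℕ → ℕ → V) where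
  toFun F m n := (m * x) • F (m - 1) n
  map_add' F G := by ext; simp
  map_smul' c F := by ext; simp [smul_comm c]

/-- Lowering operator in the second index. -/
def lowerR (V : Type) [AddCommGroup V] [Module ℝ V] (y : ℝ) : Module.End ℝ (ℕ → ℕ → V) where
  toFun F m n := (n * y) • F m (n - 1)
  map_add' F G := by ext; simp
  map_smul' c F := by ext; simp [smul_comm c]

section Lower

variable {V : Type} [AddCommGroup V] [Module ℝ V]

theorem lowerL_apply (x : ℝ) (F : ℕ → ℕ → V) (m n : ℕ) :
    lowerL V x F m n = (m * x) • F (m - 1) n := rfl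

theorem lowerR_apply (y : ℝ) (F : ℕ → ℕ → V) (m n : ℕ) :
    lowerR V y F m n = (n * y) • F m (n - 1) := rfl

theorem lowerL_pow (x : ℝ) (k : ℕ) (F : ℕ → ℕ → V) (m n : ℕ) :
    (lowerL V x ^ k) F m n = (m.descFactorial k * x ^ k) • F (m - k) n := by
  induction k generalizing F with
  | zero => simp
  | succ k ih =>
    rw [pow_succ, Module.End.mul_apply, ih, lowerL_apply, smul_smul, Nat.descFactorial_succ,
      Nat.sub_sub]
    congr 1
    push_cast; ring

theorem lowerR_pow (y : ℝ) (k : ℕ) (F : ℕ → ℕ → V) (m n : ℕ) :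
    (lowerR V y ^ k) F m n = (n.descFactorial k * y ^ k) • F m (n - k) := by
  induction k generalizing F with
  | zero => simp
  | succ k ih =>
    rw [pow_succ, Module.End.mul_apply, ih, lowerR_apply, smul_smul, Nat.descFactorial_succ,
      Nat.sub_sub]
    congr 1
    push_cast; ring

theorem lower_commute (x y : ℝ) : Commute (lowerL V x) (lowerR V y) := by
  refine LinearMap.ext fun F => ?_
  ext m n
  simp only [Module.End.mul_apply, lowerL_apply, lowerR_apply, smul_smul]
  rw [mul_comm]

end Lower

namespace IsWickFamily

variable {b b' : ι → ℝ} {F : ℕ → ℕ → MvPolynomial ι ℝ}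

/-- Differentiation acts on the family as the sum of two commuting operators that lower one index
each, so its powers are given by the binomial theorem (`pdv_pow`). -/
theorem pdv_pow_eq_lower (hF : IsWickFamily b b' F) (c : ι → ℝ) (k m n : ℕ) :
    (pdv c ^ k) (F m n) = 
      ((lowerL (MvPolynomial ι ℝ) (c ⬝ᵥ b) + lowerR (MvPolynomial ι ℝ) (c ⬝ᵥ b')) ^ k) F m n := by
  induction k generalizing m n with
  | zero => simp
  | succ k ih =>
    rw [pow_succ, Module.End.mul_apply, hF.pdv_eq, map_add, map_smul, map_smul, ih, ih,
      pow_succ' (lowerL (MvPolynomial ι ℝ) (c ⬝ᵥ b) + _), Module.End.mul_apply, LinearMap.add_apply]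
    rfl

theorem pdv_pow (hF : IsWickFamily b b' F) (c : ι → ℝ) (k m n : ℕ) :
    (pdv c ^ k) (F m n) = ∑ r ∈ Finset.range (k + 1),
      (k.choose r * (m.descFactorial r * (c ⬝ᵥ b) ^ r) *
        (n.descFactorial (k - r) * (c ⬝ᵥ b') ^ (k - r))) • F (m - r) (n - (k - r)) := by
  rw [hF.pdv_pow_eq_lower, (lower_commute _ _).add_pow, LinearMap.sum_apply, Finset.sum_apply,
    Finset.sum_apply]
  refine Finset.sum_congr rfl fun r _ => ?_
  rw [← nsmul_eq_mul', LinearMap.smul_apply, Pi.smul_apply, Pi.smul_apply, Module.End.mul_apply,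
    lowerL_pow, lowerR_pow, smul_smul, ← Nat.cast_smul_eq_nsmul ℝ, smul_smul]
  congr 1; ring

theorem pdv_pow_add (hF : IsWickFamily b b' F) (d : ι → ℝ) (m n : ℕ) :
    (pdv d ^ (m + n)) (F m n) = ((m + n).factorial * ((d ⬝ᵥ b) ^ m * (d ⬝ᵥ b') ^ n)) • 1 := by
  induction h : m + n generalizing m n with
  | zero =>
    obtain ⟨rfl, rfl⟩ : m = 0 ∧ n = 0 := by omega
    simp [hF.zero]
  | succ k ih =>
    rw [pow_succ, Module.End.mul_apply, hF.pdv_eq, map_add, map_smul, map_smul]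
    have h1 : (m * (d ⬝ᵥ b)) • (pdv d ^ k) (F (m - 1) n) =
        (m * (k.factorial * ((d ⬝ᵥ b) ^ m * (d ⬝ᵥ b') ^ n))) • (1 : MvPolynomial ι ℝ) := by
      cases m with
      | zero => simp
      | succ m =>
        rw [Nat.add_sub_cancel, ih m n (by omega), smul_smul]
        congr 1; ring
    have h2 : (n * (d ⬝ᵥ b')) • (pdv d ^ k) (F m (n - 1)) =
        (n * (k.factorial * ((d ⬝ᵥ b) ^ m * (d ⬝ᵥ b') ^ n))) • (1 : MvPolynomial ι ℝ) := by
      cases n with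
      | zero => simp
      | succ n =>
        rw [Nat.add_sub_cancel, ih m n (by omega), smul_smul]
        congr 1; ring
    rw [h1, h2, ← add_smul, ← add_mul, ← Nat.cast_add, h, Nat.factorial_succ]
    congr 1
    push_cast; ring

/-- The `q` derivatives along `c` leave bidegree `(q - r, r)` with a binomial weight, and the `q`
derivatives along `d` consume the rest. One factor `C(q,r) q!` comes from the binomial coefficient
and the final `q!`, the other from the two falling factorials. -/
theorem pdv_pow_pdv_pow (hF : IsWickFamily b b' F) (c d : ι → ℝ) (q : ℕ) :
    (pdv d ^ q) ((pdv c ^ q) (F q q)) = (∑ r ∈ Finset.range (q + 1),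
      ((q.choose r * q.factorial : ℕ) : ℝ) ^ 2 * ((c ⬝ᵥ b) ^ r * (c ⬝ᵥ b') ^ (q - r) *
        ((d ⬝ᵥ b) ^ (q - r) * (d ⬝ᵥ b') ^ r))) • 1 := by
  rw [hF.pdv_pow, map_sum, Finset.sum_smul]
  refine Finset.sum_congr rfl fun r hr => ?_
  have hr' : r ≤ q := Nat.lt_succ_iff.1 (Finset.mem_range.1 hr)
  have h := hF.pdv_pow_add d (q - r) r
  rw [Nat.sub_add_cancel hr'] at h
  rw [map_smul, Nat.sub_sub_self hr', h, smul_smul]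
  congr 1
  have h1 : (q.descFactorial r : ℝ) * (q.descFactorial (q - r)) =
      q.choose r * q.factorial := by
    have e1 := Nat.descFactorial_eq_factorial_mul_choose q r
    have e2 := Nat.factorial_mul_descFactorial (n := q) (k := q - r) (Nat.sub_le _ _)
    rw [Nat.sub_sub_self hr'] at e2
    rw [← e2, e1]
    push_cast; ring
  push_cast
  calc _ = ((q.descFactorial r : ℝ) * (q.descFactorial (q - r))) * (q.choose r * q.factorial) *
        ((c ⬝ᵥ b) ^ r * (c ⬝ᵥ b') ^ (q - r) * ((d ⬝ᵥ b) ^ (q - r) * (d ⬝ᵥ b') ^ r)) := by ring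
    _ = _ := by rw [h1]; ring

end IsWickFamily

namespace GaussFun

variable (G : GaussFun ι)

theorem crv_mul (a : ι → ℝ) (p r : MvPolynomial ι ℝ) :
    G.E (crv a p * r) = G.E (p * pdv a r) := by
  simp only [crv_apply, pdv_apply, Finset.sum_mul, Finset.mul_sum, map_sum, smul_mul_assoc,
    mul_smul_comm, map_smul, cr_mul]

theorem crv_pow_mul (a : ι → ℝ) (k : ℕ) (p r : MvPolynomial ι ℝ) :
    G.E ((crv a ^ k) p * r) = G.E (p * (pdv a ^ k) r) := by
  induction k generalizing r with
  | zero => simp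
  | succ k ih =>
    rw [pow_succ', Module.End.mul_apply, crv_mul, ih, pow_succ, Module.End.mul_apply]

theorem E_wick_succ (b : ι → ℝ) (n : ℕ) : G.E (wick b (n + 1)) = 0 := by
  have := G.crv_mul b (wick b n) 1
  rwa [mul_one, pdv_one, mul_zero, map_zero] at this

theorem E_wick_mul_wick (a b : ι → ℝ) (m n : ℕ) :
    G.E (wick a m * wick b n) = if m = n then n.factorial * (a ⬝ᵥ b) ^ n else 0 := by
  induction m generalizing n with
  | zero =>
    cases n with
    | zero => simp [wick, G.one]
    | succ n => rw [wick, one_mul, E_wick_succ]; simp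
  | succ m ih =>
    rw [wick, crv_mul, pdv_wick, mul_smul_comm, map_smul, ih]
    cases n with
    | zero => simp
    | succ n =>
      simp only [Nat.add_sub_cancel, add_left_inj, Nat.factorial_succ]
      split_ifs
      · push_cast; rw [smul_eq_mul]; ring
      · simp

end GaussFun

end GaussPoly

/-! ### Norms of contractions and the fourth cumulant. -/

namespace GaussPoly

open MvPolynomial (eval)

variable {ι : Type} [Fintype ι] {J : Type}

/-- `α s j` is the coordinate of index `s` of the tensor power `aⱼ^{⊗k}`; the Gram matrix of tensor
powers is the entrywise power. With these coordinates, norms of contractions become sums of squares.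
-/
theorem exists_gram_pow (a : J → ι → ℝ) (k : ℕ) : ∃ (S : Type) (_ : Fintype S) (α : S → J → ℝ),
    ∀ j l, ∑ s, α s j * α s l = (a j ⬝ᵥ a l) ^ k := by
  induction k with
  | zero => exact ⟨Unit, inferInstance, fun _ _ => 1, by simp⟩
  | succ k ih =>
    obtain ⟨S, hS, α, h⟩ := ih
    refine ⟨ι × S, inferInstance, fun z j => a j z.1 * α z.2 j, fun j l => ?_⟩
    rw [pow_succ', ← h, dotProduct, Finset.sum_mul_sum, Fintype.sum_prod_type]
    exact Finset.sum_congr rfl fun i _ => Finset.sum_congr rfl fun s _ => by ring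

variable [Fintype J]

/-- The squared norm of the contraction of order `r` of `∑ⱼ cⱼ aⱼ^{⊗ q}` with itself. -/
def contrSq (c : J → ℝ) (a : J → ι → ℝ) (q r : ℕ) : ℝ :=
  ∑ j, ∑ k, ∑ l, ∑ m, c j * c k * (c l * c m) *
    ((a j ⬝ᵥ a l) ^ r * (a j ⬝ᵥ a m) ^ (q - r) * ((a k ⬝ᵥ a l) ^ (q - r) * (a k ⬝ᵥ a m) ^ r))

/-- Squaring doubles the pair `(j, l)`; summation over `s` and `t` then replaces the products of `α`
and those of `β` by their Gram matrices. -/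
theorem sum_sq_bilin {S T : Type} [Fintype S] [Fintype T] (c : J → ℝ) (g : J → J → ℝ)
    (α : S → J → ℝ) (β : T → J → ℝ) (A : J → J → ℝ) (B : J → J → ℝ)
    (hα : ∀ j l, ∑ s, α s j * α s l = A j l) (hβ : ∀ j l, ∑ t, β t j * β t l = B j l) :
    ∑ s, ∑ t, (∑ j, ∑ l, c j * c l * (α s j * β t l * g j l)) ^ 2 =
      ∑ j, ∑ k, ∑ l, ∑ m, c j * c k * (c l * c m) * (g j l * A j m * (B k l * g m k)) := by
  have h1 : ∀ s t, (∑ j, ∑ l, c j * c l * (α s j * β t l * g j l)) ^ 2 =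
      ∑ j, ∑ k, ∑ l, ∑ m, c j * c k * (c l * c m) *
        (g j l * (α s j * α s m) * ((β t k * β t l) * g m k)) := by
    intro s t
    rw [sq, Finset.sum_mul_sum]
    simp_rw [Finset.sum_mul_sum]
    refine Finset.sum_congr rfl fun j _ => ?_
    have e : ∀ F : J → J → J → ℝ, ∑ m, ∑ l, ∑ k, F m l k = ∑ k, ∑ l, ∑ m, F m l k := by
      intro F
      rw [Finset.sum_comm]
      simp_rw [Finset.sum_comm (γ := J) (s := Finset.univ) (t := Finset.univ)
        (f := fun m k => F m _ k)]
      rw [Finset.sum_comm]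
    rw [e]
    exact Finset.sum_congr rfl fun k _ => Finset.sum_congr rfl fun l _ =>
      Finset.sum_congr rfl fun m _ => by ring
  simp_rw [h1, ← hα, ← hβ]
  have e2 : ∀ F : S → T → J → ℝ, ∑ s, ∑ t, ∑ j, F s t j = ∑ j, ∑ s, ∑ t, F s t j := by
    intro F
    simp_rw [Finset.sum_comm (γ := T) (α := J)]
    rw [Finset.sum_comm]
  rw [e2]
  refine Finset.sum_congr rfl fun j _ => ?_
  rw [e2]
  refine Finset.sum_congr rfl fun k _ => ?_
  rw [e2]
  refine Finset.sum_congr rfl fun l _ => ?_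
  rw [e2]
  refine Finset.sum_congr rfl fun m _ => ?_
  rw [Finset.mul_sum, Finset.sum_mul (f := fun t => β t k * β t l), Finset.sum_mul_sum]
  simp_rw [Finset.mul_sum]

theorem sum_sq_bilin_pow {S T : Type} [Fintype S] [Fintype T] (c : J → ℝ) (a : J → ι → ℝ)
    (q r : ℕ) (α : S → J → ℝ) (β : T → J → ℝ)
    (hα : ∀ j l, ∑ s, α s j * α s l = (a j ⬝ᵥ a l) ^ (q - r))
    (hβ : ∀ j l, ∑ t, β t j * β t l = (a j ⬝ᵥ a l) ^ (q - r)) :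
    ∑ s, ∑ t, (∑ j, ∑ l, c j * c l * (α s j * β t l * (a j ⬝ᵥ a l) ^ r)) ^ 2 =
      contrSq c a q r := by
  rw [sum_sq_bilin c _ α β _ _ hα hβ, contrSq]
  refine Finset.sum_congr rfl fun j _ => Finset.sum_congr rfl fun k _ =>
    Finset.sum_congr rfl fun l _ => Finset.sum_congr rfl fun m _ => ?_
  rw [dotProduct_comm (a m) (a k)]

theorem contrSq_nonneg (c : J → ℝ) (a : J → ι → ℝ) (q r : ℕ) : 0 ≤ contrSq c a q r := by
  obtain ⟨S, _, α, h⟩ := exists_gram_pow a (q - r)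
  rw [← sum_sq_bilin_pow c a q r α α h h]
  positivity

/-- The extreme contractions, of order `0` here and `q` in `contrSq_self`, both equal the fourth
power of the norm of the kernel. Together they account for `2 (E F²)²` in the fourth moment. -/
theorem contrSq_zero (c : J → ℝ) (a : J → ι → ℝ) (q : ℕ) :
    contrSq c a q 0 = (∑ j, ∑ k, c j * c k * (a j ⬝ᵥ a k) ^ q) ^ 2 := by
  rw [sq, Finset.sum_mul_sum, contrSq]
  refine Finset.sum_congr rfl fun j _ => Finset.sum_congr rfl fun k _ => ?_
  rw [Finset.sum_comm, Finset.sum_mul_sum]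
  refine Finset.sum_congr rfl fun l _ => Finset.sum_congr rfl fun m _ => ?_
  simp only [pow_zero, Nat.sub_zero]; ring

theorem contrSq_self (c : J → ℝ) (a : J → ι → ℝ) (q : ℕ) :
    contrSq c a q q = (∑ j, ∑ k, c j * c k * (a j ⬝ᵥ a k) ^ q) ^ 2 := by
  rw [sq, Finset.sum_mul_sum, contrSq]
  refine Finset.sum_congr rfl fun j _ => Finset.sum_congr rfl fun k _ => ?_
  rw [Finset.sum_mul_sum]
  refine Finset.sum_congr rfl fun l _ => Finset.sum_congr rfl fun m _ => ?_
  simp only [pow_zero, Nat.sub_self]; ring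

/-- The Wick polynomial `∑ⱼ cⱼ :(aⱼ · x)^q:`. -/
def wickSum (c : J → ℝ) (a : J → ι → ℝ) (q : ℕ) : MvPolynomial ι ℝ := ∑ j, c j • wick (a j) q

theorem wickSum_mem_chaos (c : J → ℝ) (a : J → ι → ℝ) (q : ℕ) : wickSum c a q ∈ chaos ι q :=
  sum_mem fun _ _ => Submodule.smul_mem _ _ (wick_mem_chaos _ _)

theorem pd_wickSum (i : ι) (c : J → ℝ) (a : J → ι → ℝ) (q : ℕ) :
    pd i (wickSum c a q) = (q : ℝ) • wickSum (fun j => c j * a j i) a (q - 1) := by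
  rw [wickSum, wickSum, map_sum, Finset.smul_sum]
  refine Finset.sum_congr rfl fun j _ => ?_
  rw [map_smul, pd_wick, smul_smul, smul_smul]
  congr 1; ring

/-- By adjointness, pairing with `(crv (a j) ^ q) (wick (a k) q)` differentiates `F l m q q` in
total `2q` times, down to a constant. Only the derivation rule of `F` enters, so its ordinary and
Wick versions give the same value. -/
theorem pdv_pow_pdv_pow_double_sum (c : J → ℝ) (a : J → ι → ℝ) (q : ℕ)
    {F : J → J → ℕ → ℕ → MvPolynomial ι ℝ} (hF : ∀ l m, IsWickFamily (a l) (a m) (F l m))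
    (G : GaussFun ι) :
    G.E ((∑ j, ∑ k, (c j * c k) • (crv (a j) ^ q) (wick (a k) q)) *
      ∑ l, ∑ m, (c l * c m) • F l m q q) =
      ∑ r ∈ Finset.range (q + 1), ((q.choose r * q.factorial : ℕ) : ℝ) ^ 2 * contrSq c a q r := by
  have hw : ∀ b : ι → ℝ, wick b q = (crv b ^ q) 1 := by
    intro b
    generalize q = n
    induction n with
    | zero => rfl
    | succ n ih => rw [wick, pow_succ', Module.End.mul_apply, ih]
  have h : ∀ j k l m, G.E ((crv (a j) ^ q) (wick (a k) q) * F l m q q) =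
      ∑ r ∈ Finset.range (q + 1), ((q.choose r * q.factorial : ℕ) : ℝ) ^ 2 *
        ((a j ⬝ᵥ a l) ^ r * (a j ⬝ᵥ a m) ^ (q - r) *
          ((a k ⬝ᵥ a l) ^ (q - r) * (a k ⬝ᵥ a m) ^ r)) := by
    intro j k l m
    rw [G.crv_pow_mul, hw, G.crv_pow_mul, one_mul, (hF l m).pdv_pow_pdv_pow, map_smul, G.one,
      smul_eq_mul, mul_one]
  have h2 : G.E ((∑ j, ∑ k, (c j * c k) • (crv (a j) ^ q) (wick (a k) q)) *
      ∑ l, ∑ m, (c l * c m) • F l m q q) = ∑ j, ∑ k, ∑ l, ∑ m, c j * c k * (c l * c m) *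
        G.E ((crv (a j) ^ q) (wick (a k) q) * F l m q q) := by
    simp_rw [Finset.sum_mul, Finset.mul_sum, map_sum, smul_mul_assoc, mul_smul_comm, map_smul,
      smul_eq_mul, mul_assoc]
  have e : ∀ f : ℕ → J → ℝ, ∑ r ∈ Finset.range (q + 1), ∑ j, f r j =
      ∑ j, ∑ r ∈ Finset.range (q + 1), f r j := fun f => Finset.sum_comm
  rw [h2]
  simp_rw [contrSq, Finset.mul_sum]
  rw [e]; refine Finset.sum_congr rfl fun j _ => ?_
  rw [e]; refine Finset.sum_congr rfl fun k _ => ?_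
  rw [e]; refine Finset.sum_congr rfl fun l _ => ?_
  rw [e]; refine Finset.sum_congr rfl fun m _ => ?_
  rw [h, Finset.mul_sum]
  exact Finset.sum_congr rfl fun r _ => by ring

namespace GaussFun

variable (G : GaussFun ι)

theorem E_wickSum_sq (c : J → ℝ) (a : J → ι → ℝ) (q : ℕ) :
    G.E (wickSum c a q ^ 2) = q.factorial * ∑ j, ∑ k, c j * c k * (a j ⬝ᵥ a k) ^ q := by
  rw [sq, wickSum, Finset.sum_mul_sum, map_sum, Finset.mul_sum]
  refine Finset.sum_congr rfl fun j _ => ?_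
  rw [map_sum, Finset.mul_sum]
  refine Finset.sum_congr rfl fun k _ => ?_
  rw [smul_mul_smul_comm, map_smul, E_wick_mul_wick, if_pos rfl, smul_eq_mul]; ring

/-- The fourth cumulant of an element of a Wiener chaos controls the norms of its contractions. -/
theorem sum_contrSq_le (c : J → ℝ) (a : J → ι → ℝ) {q : ℕ} (hq : 0 < q) :
    ∑ r ∈ Finset.Ioo 0 q, ((q.choose r * q.factorial : ℕ) : ℝ) ^ 2 * contrSq c a q r ≤
      G.E (wickSum c a q ^ 4) - 3 * G.E (wickSum c a q ^ 2) ^ 2 := by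
  set p := wickSum c a q with hp
  set w := ∑ j, ∑ k, (c j * c k) • (crv (a j) ^ q) (wick (a k) q) with hw
  have hp2 : p ^ 2 = ∑ l, ∑ m, (c l * c m) • (wick (a l) q * wick (a m) q) := by
    rw [sq, hp, wickSum, Finset.sum_mul_sum]
    exact Finset.sum_congr rfl fun j _ => Finset.sum_congr rfl fun k _ => smul_mul_smul_comm _ _ _ _
  have h1 := pdv_pow_pdv_pow_double_sum c a q
    (F := fun l m i j => wick (a l) i * wick (a m) j) (fun l m => isWickFamily_mul _ _) G
  have h2 := pdv_pow_pdv_pow_double_sum c a q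
    (F := fun l m i j => (crv (a l) ^ i) (wick (a m) j)) (fun l m => isWickFamily_crv _ _) G
  rw [← hp2, ← hw] at h1
  rw [← hw] at h2
  have h0 : G.E w = 0 := by
    rw [hw, map_sum]
    refine Finset.sum_eq_zero fun j _ => ?_
    rw [map_sum]
    refine Finset.sum_eq_zero fun k _ => ?_
    obtain ⟨n, rfl⟩ := Nat.exists_eq_succ_of_ne_zero hq.ne'
    have := G.crv_mul (a j) ((crv (a j) ^ n) (wick (a k) (n + 1))) 1
    rw [map_smul, Nat.succ_eq_add_one, pow_succ', Module.End.mul_apply]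
    rw [mul_one, pdv_one, mul_zero, map_zero] at this
    rw [this, smul_zero]
  -- `w` is the component of `p²` of order `2q`. Since `E w = 0` and `E(w p²) = E(w²)`, positivity
  -- of this square says `E(w²) + (E p²)² ≤ E p⁴`.
  have h3 := G.sq_nonneg (p ^ 2 - w - MvPolynomial.C (G.E (p ^ 2)))
  have h4 : (p ^ 2 - w - MvPolynomial.C (G.E (p ^ 2))) ^ 2 = p ^ 4 + w * w
      - MvPolynomial.C 2 * (w * p ^ 2) - MvPolynomial.C (2 * G.E (p ^ 2)) * p ^ 2
      + MvPolynomial.C (2 * G.E (p ^ 2)) * w + MvPolynomial.C (G.E (p ^ 2) ^ 2) := by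
    simp only [map_mul, map_pow, map_ofNat]; ring
  rw [h4, map_add, map_add, map_sub, map_sub, map_add, C_mul, C_mul, C_mul, C, h0, h1, h2] at h3
  have hsplit : ∑ r ∈ Finset.range (q + 1),
      ((q.choose r * q.factorial : ℕ) : ℝ) ^ 2 * contrSq c a q r = 2 * G.E (p ^ 2) ^ 2 +
      ∑ r ∈ Finset.Ioo 0 q, ((q.choose r * q.factorial : ℕ) : ℝ) ^ 2 * contrSq c a q r := by
    have : Finset.range (q + 1) = insert 0 (insert q (Finset.Ioo 0 q)) := by
      ext r; simp only [Finset.mem_range, Finset.mem_insert, Finset.mem_Ioo]; omega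
    rw [this, Finset.sum_insert (by simp [hq.ne]), Finset.sum_insert (by simp), contrSq_zero,
      contrSq_self, hp, E_wickSum_sq]
    simp only [Nat.choose_zero_right, Nat.choose_self, one_mul]
    ring
  rw [hsplit] at h3
  linarith

/-- If all proper contractions of a Wick polynomial are at most `κ`, then so are, up to constants,
the contractions of its derivatives. -/
theorem contr_wickSum_le (c : J → ℝ) (a : J → ι → ℝ) (q : ℕ) {κ : ℝ} (hκ : 0 ≤ κ)
    (h : ∀ r, 0 < r → r < q → contrSq c a q r ≤ κ) (n : ℕ) :
    ∀ (k l : ℕ) (S T : Type) [Fintype S] [Fintype T] (α : S → J → ℝ) (β : T → J → ℝ),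
      0 < k → 0 < l → 2 * q ≤ k + l + n →
      (∀ i j, ∑ s, α s i * α s j = (a i ⬝ᵥ a j) ^ k) →
      (∀ i j, ∑ s, β s i * β s j = (a i ⬝ᵥ a j) ^ l) →
      G.contr (fun s => (q.descFactorial k : ℝ) • wickSum (fun j => c j * α s j) a (q - k))
        (fun t => (q.descFactorial l : ℝ) • wickSum (fun j => c j * β t j) a (q - l)) ≤
      n * 4 ^ n * (q.factorial : ℝ) ^ 4 * κ := by
  have hpd : ∀ (k : ℕ) (S : Type) (α : S → J → ℝ) (i : ι) (s : S),
      pd i ((q.descFactorial k : ℝ) • wickSum (fun j => c j * α s j) a (q - k)) =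
      (q.descFactorial (k + 1) : ℝ) •
        wickSum (fun j => c j * (α s j * a j i)) a (q - (k + 1)) := by
    intro k S α i s
    rw [map_smul, pd_wickSum, smul_smul, Nat.descFactorial_succ, Nat.sub_sub]
    simp only [mul_assoc]
    congr 1
    push_cast; ring
  have hgram : ∀ (k : ℕ) (S : Type) [Fintype S] (α : S → J → ℝ),
      (∀ i j, ∑ s, α s i * α s j = (a i ⬝ᵥ a j) ^ k) →
      ∀ i j, ∑ z : ι × S, (α z.2 i * a i z.1) * (α z.2 j * a j z.1) = (a i ⬝ᵥ a j) ^ (k + 1) := by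
    intro k S _ α hα i j
    rw [pow_succ', ← hα, dotProduct, Finset.sum_mul_sum, Fintype.sum_prod_type]
    exact Finset.sum_congr rfl fun i _ => Finset.sum_congr rfl fun s _ => by ring
  have hdegen : ∀ (k l : ℕ) (S T : Type) [Fintype S] [Fintype T] (α : S → J → ℝ) (β : T → J → ℝ),
      (q ≤ k ∨ q ≤ l) →
      G.contr (fun s => (q.descFactorial k : ℝ) • wickSum (fun j => c j * α s j) a (q - k))
        (fun t => (q.descFactorial l : ℝ) • wickSum (fun j => c j * β t j) a (q - l)) = 0 := by
    intro k l S T _ _ α β hkl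
    rw [contr]
    refine Finset.sum_eq_zero fun s _ => Finset.sum_eq_zero fun t _ => ?_
    have : ∀ m, q ≤ m → q.descFactorial (m + 1) = 0 := fun m hm =>
      Nat.descFactorial_of_lt (by omega)
    simp only [hpd]
    rcases hkl with hk | hl
    · simp only [this _ hk, Nat.cast_zero, zero_smul, zero_mul]; simp
    · simp only [this _ hl, Nat.cast_zero, zero_smul, mul_zero]; simp
  -- Each use of `contr_le` differentiates one of the two families once more, so `n` bounds the
  -- number of remaining rounds: when `k + l ≥ 2q`, one of the families is constant and its
  -- contractions vanish.
  induction n with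
  | zero =>
    intro k l S T _ _ α β hk hl hkl hα hβ
    rw [hdegen k l S T α β (by omega)]
    simp
  | succ n ih =>
    intro k l S T _ _ α β hk hl hkl hα hβ
    by_cases hd : q ≤ k ∨ q ≤ l
    · rw [hdegen k l S T α β hd]; positivity
    push Not at hd
    refine (G.contr_le _ _).trans ?_
    have e1 := ih (k + 1) l (ι × S) T (fun z j => α z.2 j * a j z.1) β (by omega) hl (by omega)
      (hgram k S α hα) hβ
    have e2 := ih k (l + 1) S (ι × T) α (fun z j => β z.2 j * a j z.1) hk (by omega) (by omega)
      hα (hgram l T β hβ)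
    have e3 : ∑ s, ∑ t, G.E (∑ i,
        pd i ((q.descFactorial k : ℝ) • wickSum (fun j => c j * α s j) a (q - k)) *
        pd i ((q.descFactorial l : ℝ) • wickSum (fun j => c j * β t j) a (q - l))) ^ 2 ≤
        (q.factorial : ℝ) ^ 4 * κ := by
      -- Chaoses of different orders are orthogonal, so the mean vanishes unless `k = l`. It is then
      -- a contraction of order `q - k`, a proper one because `0 < k < q`.
      have hE : ∀ s t, G.E (∑ i,
          pd i ((q.descFactorial k : ℝ) • wickSum (fun j => c j * α s j) a (q - k)) *
          pd i ((q.descFactorial l : ℝ) • wickSum (fun j => c j * β t j) a (q - l))) =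
          if k = l then (q.factorial * q.descFactorial (k + 1) : ℝ) *
            ∑ j, ∑ m, c j * c m * (α s j * β t m * (a j ⬝ᵥ a m) ^ (q - k)) else 0 := by
        intro s t
        simp only [hpd]
        simp only [wickSum, Finset.smul_sum, Finset.sum_mul_sum, smul_smul,
          smul_mul_smul_comm, map_sum, map_smul, E_wick_mul_wick]
        have hiff : q - (k + 1) = q - (l + 1) ↔ k = l := by omega
        simp only [hiff]
        split_ifs with hkl'
        · subst hkl'
          rw [Finset.sum_comm, Finset.mul_sum]
          refine Finset.sum_congr rfl fun j _ => ?_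
          rw [Finset.sum_comm, Finset.mul_sum]
          refine Finset.sum_congr rfl fun m _ => ?_
          have e : q - k = q - (k + 1) + 1 := by omega
          have e' : (q.factorial : ℝ) = (q - (k + 1)).factorial * q.descFactorial (k + 1) := by
            rw [← Nat.cast_mul, Nat.factorial_mul_descFactorial (by omega)]
          rw [e, pow_succ, e']
          simp only [smul_eq_mul]
          rw [show c j * c m * (α s j * β t m * ((a j ⬝ᵥ a m) ^ (q - (k + 1)) * (a j ⬝ᵥ a m))) =
            (c j * c m * (α s j * β t m) * (a j ⬝ᵥ a m) ^ (q - (k + 1))) * (a j ⬝ᵥ a m) by ring]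
          rw [show (a j ⬝ᵥ a m) = ∑ i, a j i * a m i from rfl, Finset.mul_sum, Finset.mul_sum]
          exact Finset.sum_congr rfl fun i _ => by ring
        · simp
      simp only [hE]
      split_ifs with hkl'
      · subst hkl'
        simp only [mul_pow, ← Finset.mul_sum]
        rw [sum_sq_bilin_pow c a q (q - k) α β (by rwa [Nat.sub_sub_self hd.1.le])
          (by rwa [Nat.sub_sub_self hd.1.le])]
        have hle : (q.descFactorial (k + 1) : ℝ) ≤ q.factorial := by
          rw [← Nat.factorial_mul_descFactorial (show k + 1 ≤ q from hd.1)]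
          exact_mod_cast Nat.le_mul_of_pos_left _ (Nat.factorial_pos _)
        calc (q.factorial : ℝ) ^ 2 * (q.descFactorial (k + 1) : ℝ) ^ 2 * contrSq c a q (q - k)
            ≤ (q.factorial : ℝ) ^ 2 * (q.factorial : ℝ) ^ 2 * κ := by
              have := contrSq_nonneg c a q (q - k)
              have := h (q - k) (by omega) (by omega)
              gcongr
          _ = _ := by ring
      · simp; positivity
    simp only [hpd]
    simp only [hpd] at e3
    -- The means contribute once and the two deeper contractions twice each: `1 + 4 · n · 4ⁿ ≤ (n +
    -- 1) · 4ⁿ⁺¹`.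
    have hbig : (q.factorial : ℝ) ^ 4 * κ ≤ 4 * 4 ^ n * (q.factorial : ℝ) ^ 4 * κ := by
      have h4 : (1 : ℝ) ≤ 4 * 4 ^ n := by
        have : (1 : ℝ) ≤ 4 ^ n := one_le_pow₀ (by norm_num)
        linarith
      have : 0 ≤ (q.factorial : ℝ) ^ 4 * κ := by positivity
      nlinarith
    push_cast
    rw [pow_succ]
    linarith

/-- The fourth cumulant controls the fourth Schatten norm of the Hessian. -/
theorem contr_grad_le (c : J → ℝ) (a : J → ι → ℝ) {q : ℕ} (hq : 0 < q) :
    ∑ i, ∑ j, G.E ((∑ k, pd k (pd i (wickSum c a q)) * pd k (pd j (wickSum c a q))) ^ 2) ≤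
      (2 * q : ℕ) * 4 ^ (2 * q) * (q.factorial : ℝ) ^ 4 *
        (G.E (wickSum c a q ^ 4) - 3 * G.E (wickSum c a q ^ 2) ^ 2) := by
  have hS := G.sum_contrSq_le c a hq
  have hterm : ∀ r, 0 ≤ ((q.choose r * q.factorial : ℕ) : ℝ) ^ 2 * contrSq c a q r := fun r =>
    mul_nonneg (by positivity) (contrSq_nonneg c a q r)
  have hκ := (Finset.sum_nonneg fun r (_ : r ∈ Finset.Ioo 0 q) => hterm r).trans hS
  have h : ∀ r, 0 < r → r < q → contrSq c a q r ≤
      G.E (wickSum c a q ^ 4) - 3 * G.E (wickSum c a q ^ 2) ^ 2 := by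
    intro r h0 hr
    refine le_trans ?_ ((Finset.single_le_sum (fun i _ => hterm i)
      (Finset.mem_Ioo.2 ⟨h0, hr⟩)).trans hS)
    have : (1 : ℝ) ≤ ((q.choose r * q.factorial : ℕ) : ℝ) ^ 2 :=
      one_le_pow₀ (by exact_mod_cast Nat.mul_pos (Nat.choose_pos hr.le) (Nat.factorial_pos q))
    have := contrSq_nonneg c a q r
    nlinarith
  -- The gradient is the family of order `k = l = 1`, with the coordinates of the `aⱼ` themselves as
  -- `α` and `β`; depth `2q` satisfies `2q ≤ k + l + n`.
  have := G.contr_wickSum_le c a q hκ h (2 * q) 1 1 ι ι (fun i j => a j i) (fun i j => a j i)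
    one_pos one_pos (by omega) (fun i j => by simp [dotProduct]) (fun i j => by simp [dotProduct])
  simpa only [contr, Nat.descFactorial_one, ← pd_wickSum] using this

end GaussFun

end GaussPoly

/-! ### Temperate growth and Gaussian integration by parts. -/

namespace WienerChaos

section Temperate

variable {E F : Type*} [NormedAddCommGroup E] [NormedSpace ℝ E] [NormedAddCommGroup F]
  [NormedSpace ℝ F]

theorem hasTemperateGrowth_fderiv {g : E → F} (hg : g.HasTemperateGrowth) :
    (fderiv ℝ g).HasTemperateGrowth := by
  refine ⟨hg.1.fderiv_right (by simp), fun n => ?_⟩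
  obtain ⟨k, C, h⟩ := hg.2 (n + 1)
  refine ⟨k, C, fun x => ?_⟩
  rw [norm_iteratedFDeriv_fderiv]
  exact h x

theorem hasTemperateGrowth_fderiv_apply {g : E → F} (hg : g.HasTemperateGrowth) (v : E) :
    (fun x => fderiv ℝ g x v).HasTemperateGrowth :=
  (ContinuousLinearMap.apply ℝ F v).hasTemperateGrowth.comp (hasTemperateGrowth_fderiv hg)

variable {Ω : Type*} [MeasurableSpace Ω] {P : Measure Ω} [IsFiniteMeasure P]

/-- A function of temperate growth of a random vector with moments of all orders has moments of all
orders. -/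
theorem memLp_of_hasTemperateGrowth {Y : Ω → E} (hY : ∀ p : ℝ≥0∞, p ≠ ∞ → MemLp Y p P)
    {g : E → F} (hg : g.HasTemperateGrowth) {p : ℝ≥0∞} (hp : p ≠ ∞) :
    MemLp (fun ω => g (Y ω)) p P := by
  obtain ⟨k, C, h⟩ := hg.2 0
  simp only [norm_iteratedFDeriv_zero] at h
  have h1 : MemLp (fun ω => 1 + ‖Y ω‖) (p * (k + 1 : ℕ)) P :=
    (memLp_const (1 : ℝ)).add (hY _ (ENNReal.mul_ne_top hp (by simp))).norm
  have h2 := h1.norm_rpow_div ((k + 1 : ℕ) : ℝ≥0∞)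
  rw [ENNReal.mul_div_cancel_right (by simp) (by simp)] at h2
  refine (h2.const_mul C).mono' (hg.1.continuous.comp_aestronglyMeasurable
    (hY 1 (by simp)).aestronglyMeasurable) (Eventually.of_forall fun ω => ?_)
  have h0 : 0 ≤ C := by
    have := (norm_nonneg _).trans (h 0)
    simpa using this
  have h3 : (1 : ℝ) ≤ 1 + ‖Y ω‖ := by linarith [norm_nonneg (Y ω)]
  refine (h _).trans (mul_le_mul_of_nonneg_left ?_ h0)
  rw [ENNReal.toReal_natCast, Real.rpow_natCast, Real.norm_of_nonneg (by linarith)]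
  exact pow_le_pow_right₀ h3 (Nat.le_succ k)

end Temperate

/-- Gaussian integration by parts on the line. -/
theorem integral_deriv_gaussianReal {G : ℝ → ℝ} (hG : G.HasTemperateGrowth) :
    ∫ x, deriv G x ∂(gaussianReal 0 1) = ∫ x, G x * x ∂(gaussianReal 0 1) := by
  have hint : ∀ f : ℝ → ℝ, f.HasTemperateGrowth →
      Integrable (fun x => gaussianPDFReal 0 1 x * f x) := by
    intro f hf
    have h1 : MemLp f 1 (gaussianReal 0 1) :=
      memLp_of_hasTemperateGrowth (Y := id) (fun p hp => memLp_id_gaussianReal' p hp) hf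
        ENNReal.one_ne_top
    have h2 := memLp_one_iff_integrable.1 h1
    rw [gaussianReal_of_var_ne_zero _ one_ne_zero,
      integrable_withDensity_iff_integrable_smul' (measurable_gaussianPDF _ _)
      (ae_of_all _ fun _ => gaussianPDF_lt_top)] at h2
    simpa [toReal_gaussianPDF] using h2
  have hG' : (deriv G).HasTemperateGrowth := by
    have : deriv G = fun x => fderiv ℝ G x 1 := by ext; simp
    rw [this]; exact hasTemperateGrowth_fderiv_apply hG 1
  have hpdf : ∀ x, HasDerivAt (gaussianPDFReal 0 1) (-x * gaussianPDFReal 0 1 x) x := by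
    intro x
    have h : HasDerivAt (fun x : ℝ => (√(2 * Real.pi * ((1 : NNReal) : ℝ)))⁻¹ *
        Real.exp (-(x - 0) ^ 2 / (2 * ((1 : NNReal) : ℝ))))
        ((√(2 * Real.pi * ((1 : NNReal) : ℝ)))⁻¹ *
        (Real.exp (-(x - 0) ^ 2 / (2 * ((1 : NNReal) : ℝ))) *
          (-((2 : ℕ) * (x - 0) ^ (2 - 1) * 1) / (2 * ((1 : NNReal) : ℝ))))) x :=
      ((((((hasDerivAt_id x).sub_const 0).pow 2).neg).div_const _).exp).const_mul _
    have e : gaussianPDFReal 0 1 = fun x : ℝ => (√(2 * Real.pi * ((1 : NNReal) : ℝ)))⁻¹ *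
        Real.exp (-(x - 0) ^ 2 / (2 * ((1 : NNReal) : ℝ))) := rfl
    rw [e]
    convert h using 1
    simp
    ring
  rw [integral_gaussianReal_eq_integral_smul one_ne_zero,
    integral_gaussianReal_eq_integral_smul one_ne_zero]
  have hd : ∀ x, HasDerivAt G (deriv G x) x := fun x =>
    ((hG.1.differentiable (by simp)) x).hasDerivAt
  have := integral_mul_deriv_eq_deriv_mul_of_integrable (u := G) (u' := deriv G)
    (v := gaussianPDFReal 0 1) (v' := fun x => -x * gaussianPDFReal 0 1 x) (fun x _ => hd x)
    (fun x _ => hpdf x)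
    (by
      refine (hint (fun x => -(G x * x)) (by fun_prop)).congr (ae_of_all _ fun x => ?_)
      simp only [Pi.mul_apply]; ring)
    (by
      refine (hint _ hG').congr (ae_of_all _ fun x => ?_)
      simp only [Pi.mul_apply]; ring)
    (by
      refine (hint _ hG).congr (ae_of_all _ fun x => ?_)
      simp only [Pi.mul_apply]; ring)
  simp only [smul_eq_mul]
  rw [← neg_inj, ← integral_neg, ← integral_neg]
  calc _ = - ∫ x, deriv G x * gaussianPDFReal 0 1 x := by
        rw [← integral_neg]; exact integral_congr_ae (ae_of_all _ fun x => by ring)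
    _ = _ := by rw [← this]; exact integral_congr_ae (ae_of_all _ fun x => by ring)

namespace IsIsonormal

variable {H Ω : Type*} [NormedAddCommGroup H] [InnerProductSpace ℝ H] [MeasurableSpace Ω]
  {P : Measure Ω} {X : H → Ω → ℝ} (hX : IsIsonormal X P)

include hX

theorem memLp (h : H) {p : ℝ≥0∞} (hp : p ≠ ∞) : MemLp (X h) p P :=
  (hX.gaussian.hasGaussianLaw_eval h).memLp hp

theorem memLp_pi {κ : Type*} [Fintype κ] (φ : κ → H) {p : ℝ≥0∞} (hp : p ≠ ∞) :
    MemLp (fun ω k => X (φ k) ω) p P :=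
  memLp_pi_iff.2 fun k => hX.memLp (φ k) hp

theorem map_eq {h : H} (hh : ‖h‖ = 1) : P.map (X h) = gaussianReal 0 1 := by
  rw [(hX.gaussian.hasGaussianLaw_eval h).map_eq_gaussianReal, hX.centered,
    variance_eq_integral (hX.gaussian.aemeasurable h), hX.centered]
  have : ∫ ω, (X h ω - 0) ^ 2 ∂P = 1 := by
    simp only [sub_zero, sq]
    rw [hX.covariance, real_inner_self_eq_norm_sq, hh, one_pow]
  rw [this, Real.toNNReal_one]

theorem integrable_mul (g h : H) : Integrable (fun ω => X g ω * X h ω) P :=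
  (hX.memLp g (p := 2) (by simp)).integrable_mul (hX.memLp h (p := 2) (by simp))

/-- An isonormal process is almost surely linear. -/
theorem ae_eq_sum {κ : Type*} [Fintype κ] (φ : κ → H) (c : κ → ℝ) :
    X (∑ k, c k • φ k) =ᵐ[P] fun ω => ∑ k, c k * X (φ k) ω := by
  set h := ∑ k, c k • φ k with hh
  -- The squared `L²` distance expands into covariances, which cancel by the definition of `h`.
  have h0 : ∫ ω, (X h ω - ∑ k, c k * X (φ k) ω) ^ 2 ∂P = 0 := by
    have e : ∀ ω, (X h ω - ∑ k, c k * X (φ k) ω) ^ 2 = X h ω * X h ω -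
        2 * ∑ k, c k * (X h ω * X (φ k) ω) +
        ∑ k, ∑ l, c k * c l * (X (φ k) ω * X (φ l) ω) := by
      intro ω
      rw [sub_sq, sq (∑ k, c k * X (φ k) ω), Finset.sum_mul_sum, sq, mul_assoc 2, Finset.mul_sum]
      congr 1
      · congr 2; exact Finset.sum_congr rfl fun k _ => by ring
      · exact Finset.sum_congr rfl fun k _ => Finset.sum_congr rfl fun l _ => by ring
    simp_rw [e]
    have i1 := hX.integrable_mul h h
    have i2 : ∀ k, Integrable (fun ω => c k * (X h ω * X (φ k) ω)) P := fun k =>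
      (hX.integrable_mul h (φ k)).const_mul _
    have i3 : ∀ k l, Integrable (fun ω => c k * c l * (X (φ k) ω * X (φ l) ω)) P := fun k l =>
      (hX.integrable_mul (φ k) (φ l)).const_mul _
    have i4 : Integrable (fun ω => 2 * ∑ k, c k * (X h ω * X (φ k) ω)) P :=
      (integrable_finsetSum _ fun k _ => i2 k).const_mul 2
    have i5 : Integrable (fun ω => X h ω * X h ω - 2 * ∑ k, c k * (X h ω * X (φ k) ω)) P :=
      i1.sub i4
    rw [integral_add i5
      (integrable_finsetSum _ fun k _ => integrable_finsetSum _ fun l _ => i3 k l),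
      integral_sub i1 i4,
      integral_const_mul, integral_finsetSum _ fun k _ => i2 k,
      integral_finsetSum _ fun k _ => integrable_finsetSum _ fun l _ => i3 k l]
    simp_rw [integral_finsetSum _ fun l _ => i3 _ l, integral_const_mul, hX.covariance]
    have e1 : ∑ k, c k * ⟪h, φ k⟫ = ⟪h, h⟫ := by
      conv_rhs => rw [hh]
      rw [← hh, inner_sum]
      simp only [inner_smul_right]
    have e2 : ∑ k, ∑ l, c k * c l * ⟪φ k, φ l⟫ = ⟪h, h⟫ := by
      rw [hh]
      simp only [sum_inner, inner_sum, inner_smul_left, inner_smul_right, RCLike.conj_to_real]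
      refine Finset.sum_congr rfl fun k _ => ?_
      rw [Finset.mul_sum]
      exact Finset.sum_congr rfl fun l _ => by rw [real_inner_comm]; ring
    rw [e1, e2]; ring
  have hm : MemLp (fun ω => X h ω - ∑ k, c k * X (φ k) ω) 2 P :=
    (hX.memLp h (by simp)).sub (memLp_finsetSum _ fun k _ => (hX.memLp (φ k) (by simp)).const_mul _)
  rw [integral_eq_zero_iff_of_nonneg (fun ω => sq_nonneg _) hm.integrable_sq] at h0
  filter_upwards [h0] with ω hω
  exact sub_eq_zero.1 (pow_eq_zero_iff two_ne_zero |>.1 hω)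

theorem ae_eq_smul (c : ℝ) (h : H) : X (c • h) =ᵐ[P] fun ω => c * X h ω := by
  simpa using hX.ae_eq_sum (fun _ : Unit => h) fun _ => c

variable [IsProbabilityMeasure P]

theorem memLp_comp {κ F : Type*} [Fintype κ] [NormedAddCommGroup F] [NormedSpace ℝ F] (φ : κ → H)
    {g : (κ → ℝ) → F} (hg : g.HasTemperateGrowth) {p : ℝ≥0∞} (hp : p ≠ ∞) :
    MemLp (fun ω => g fun k => X (φ k) ω) p P :=
  memLp_of_hasTemperateGrowth (fun _ hp => hX.memLp_pi φ hp) hg hp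

theorem integrable_comp {κ F : Type*} [Fintype κ] [NormedAddCommGroup F] [NormedSpace ℝ F]
    (φ : κ → H) {g : (κ → ℝ) → F} (hg : g.HasTemperateGrowth) :
    Integrable (fun ω => g fun k => X (φ k) ω) P :=
  memLp_one_iff_integrable.1 (hX.memLp_comp φ hg ENNReal.one_ne_top)

/-- Split `X(φₖ) = Yₖ + ⟨φₖ, h⟩ X(h)`. The vector `Y` is jointly Gaussian with `X(h)` and
uncorrelated with it, hence independent of it. Fubini reduces the claim to the one-dimensional
formula in the variable `X(h)`, with `Y` frozen. -/
theorem integral_fderiv_of_norm_eq_one {κ : Type*} [Fintype κ] (φ : κ → H) {h : H} (hh : ‖h‖ = 1)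
    {g : (κ → ℝ) → ℝ} (hg : g.HasTemperateGrowth) :
    ∫ ω, fderiv ℝ g (fun k => X (φ k) ω) (fun k => ⟪φ k, h⟫) ∂P =
      ∫ ω, g (fun k => X (φ k) ω) * X h ω ∂P := by
  set a : κ → ℝ := fun k => ⟪φ k, h⟫ with ha
  set Y : κ → Ω → ℝ := fun k ω => X (φ k) ω - a k * X h ω with hY
  have hYm : ∀ k, AEMeasurable (Y k) P := fun k =>
    (hX.gaussian.aemeasurable _).sub ((hX.gaussian.aemeasurable _).const_mul _)
  have hZm : AEMeasurable (X h) P := hX.gaussian.aemeasurable h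
  have hYm' : AEMeasurable (fun ω k => Y k ω) P := aemeasurable_pi_lambda _ hYm
  have hjoint : IsGaussianProcess (Sum.elim Y fun _ : Unit => X h) P := by
    classical
    refine hX.gaussian.of_isGaussianProcess fun s => ?_
    rcases s with k | u
    · exact ⟨{φ k, h}, ContinuousLinearMap.proj ⟨φ k, by simp⟩ -
        a k • ContinuousLinearMap.proj ⟨h, by simp⟩, fun ω => by simp [hY]⟩
    · exact ⟨{h}, ContinuousLinearMap.proj ⟨h, by simp⟩, fun ω => by simp⟩
  have hind := hjoint.indepFun_of_covariance_eq_zero hYm (fun _ => hZm) fun k _ => by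
    have hYk : MemLp (Y k) 2 P :=
      (hX.memLp (φ k) (by simp)).sub ((hX.memLp h (by simp)).const_mul _)
    rw [covariance_eq_sub hYk (hX.memLp h (by simp)), hX.centered, mul_zero, sub_zero]
    have e : (Y k * X h) = fun ω => X (φ k) ω * X h ω - a k * (X h ω * X h ω) := by
      ext ω; simp only [hY, Pi.mul_apply]; ring
    rw [e, integral_sub (hX.integrable_mul _ _) ((hX.integrable_mul _ _).const_mul _),
      integral_const_mul, hX.covariance, hX.covariance, real_inner_self_eq_norm_sq, hh]
    simp [ha]
  have hind2 : IndepFun (fun ω k => Y k ω) (X h) P :=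
    hind.comp (φ := id) (ψ := fun z : Unit → ℝ => z ()) measurable_id (measurable_pi_apply ())
  have hprod := hind2.map_prod_eq_prod_map_map hYm' hZm
  rw [hX.map_eq hh] at hprod
  have hprob : IsProbabilityMeasure (P.map fun ω k => Y k ω) := Measure.isProbabilityMeasure_map hYm'
  have hpush : ∀ Φ : (κ → ℝ) × ℝ → ℝ, Continuous Φ →
      Integrable (fun ω => Φ (fun k => Y k ω, X h ω)) P →
      ∫ ω, Φ (fun k => Y k ω, X h ω) ∂P =
        ∫ y, ∫ z, Φ (y, z) ∂(gaussianReal 0 1) ∂(P.map fun ω k => Y k ω) := by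
    intro Φ hΦ hi
    have hpm : AEMeasurable (fun ω => ((fun k => Y k ω), X h ω)) P := hYm'.prodMk hZm
    rw [← integral_prod, ← hprod, integral_map hpm hΦ.aestronglyMeasurable]
    rw [← hprod, integrable_map_measure hΦ.aestronglyMeasurable hpm]
    exact hi
  have hsplit : ∀ ω, (fun k => X (φ k) ω) = (fun k => Y k ω) + X h ω • a := by
    intro ω; ext k; simp only [hY, Pi.add_apply, Pi.smul_apply, smul_eq_mul]; ring
  have hdg := hasTemperateGrowth_fderiv_apply hg a
  have hcont : Continuous fun y : (κ → ℝ) × ℝ => y.1 + y.2 • a := by fun_prop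
  have e1 := hpush (fun y => fderiv ℝ g (y.1 + y.2 • a) a) (hdg.1.continuous.comp hcont) (by
    simp only [← hsplit]; exact hX.integrable_comp φ hdg)
  have e2 := hpush (fun y => g (y.1 + y.2 • a) * y.2) ((hg.1.continuous.comp hcont).mul
    continuous_snd) (by
    simp only [← hsplit]
    exact (hX.memLp_comp φ hg (p := 2) (by simp)).integrable_mul (hX.memLp h (p := 2) (by simp)))
  simp only [← hsplit] at e1 e2
  rw [e1, e2]
  refine integral_congr_ae (ae_of_all _ fun y => ?_)
  have hG : (fun z : ℝ => g (y + z • a)).HasTemperateGrowth := by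
    have : (fun z : ℝ => y + z • a).HasTemperateGrowth := by fun_prop
    exact hg.comp this
  beta_reduce
  rw [← integral_deriv_gaussianReal hG]
  refine integral_congr_ae (ae_of_all _ fun z => ?_)
  have h1 : HasDerivAt (fun z : ℝ => y + z • a) a z := by
    simpa using ((hasDerivAt_id z).smul_const a).const_add y
  exact (((hg.1.differentiable (by simp)) _).hasFDerivAt.comp_hasDerivAt z h1).deriv.symm

/-- Gaussian integration by parts for functions of temperate growth. -/
theorem integral_fderiv {κ : Type*} [Fintype κ] (φ : κ → H) (h : H)
    {g : (κ → ℝ) → ℝ} (hg : g.HasTemperateGrowth) :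
    ∫ ω, fderiv ℝ g (fun k => X (φ k) ω) (fun k => ⟪φ k, h⟫) ∂P =
      ∫ ω, g (fun k => X (φ k) ω) * X h ω ∂P := by
  -- The zero vector cannot be normalized, but `X 0 = 0` almost surely makes both sides vanish.
  rcases eq_or_ne h 0 with rfl | h0
  · have h1 : X 0 =ᵐ[P] fun _ => 0 := by simpa using hX.ae_eq_smul 0 (0 : H)
    have h2 : (fun ω => g (fun k => X (φ k) ω) * X 0 ω) =ᵐ[P] fun _ => 0 := by
      filter_upwards [h1] with ω hω
      rw [hω, mul_zero]
    have h3 : (fun k => ⟪φ k, (0 : H)⟫) = (0 : κ → ℝ) := by ext; simp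
    rw [integral_congr_ae h2, h3]
    simp
  · have hn : ‖h‖ ≠ 0 := norm_ne_zero_iff.2 h0
    have h1 : ‖‖h‖⁻¹ • h‖ = 1 := by
      rw [norm_smul, norm_inv, norm_norm, inv_mul_cancel₀ hn]
    have h2 := hX.integral_fderiv_of_norm_eq_one φ h1 hg
    have h3 : (fun k => ⟪φ k, h⟫) = ‖h‖ • fun k => ⟪φ k, ‖h‖⁻¹ • h⟫ := by
      ext k
      rw [Pi.smul_apply, inner_smul_right, smul_eq_mul, mul_inv_cancel_left₀ hn]
    have h4 : (fun ω => g (fun k => X (φ k) ω) * X h ω) =ᵐ[P]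
        fun ω => ‖h‖ * (g (fun k => X (φ k) ω) * X (‖h‖⁻¹ • h) ω) := by
      filter_upwards [hX.ae_eq_smul ‖h‖⁻¹ h] with ω hω
      rw [hω]; field_simp
    rw [integral_congr_ae h4, integral_const_mul, ← h2, h3]
    simp only [map_smul, smul_eq_mul]
    rw [integral_const_mul]

end IsIsonormal

end WienerChaos

/-! ### The Hilbert tensor square: operator norms and contractions. -/

namespace WienerChaos

universe u v

variable {H : Type u} [NormedAddCommGroup H] [InnerProductSpace ℝ H]

theorem inner_tmulL (a b c d : H) : ⟪tmulL H H a b, tmulL H H c d⟫ = ⟪a, c⟫ * ⟪b, d⟫ := by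
  simp only [tmulL, ContinuousLinearMap.comp_apply, ContinuousLinearMap.compL_apply]
  exact (UniformSpace.Completion.inner_coe _ _).trans (TensorProduct.inner_tmul (𝕜 := ℝ) a c b d)

theorem norm_tmulL (a b : H) : ‖tmulL H H a b‖ = ‖a‖ * ‖b‖ := by
  have h := inner_tmulL a b a b
  rw [real_inner_self_eq_norm_sq, real_inner_self_eq_norm_sq, real_inner_self_eq_norm_sq,
    ← mul_pow] at h
  exact (pow_left_inj₀ (norm_nonneg _) (by positivity) two_ne_zero).1 h

theorem orthonormal_tmulL {ι κ : Type*} {e : ι → H} {e' : κ → H} (he : Orthonormal ℝ e)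
    (he' : Orthonormal ℝ e') : Orthonormal ℝ fun z : ι × κ => tmulL H H (e z.1) (e' z.2) := by
  classical
  rw [orthonormal_iff_ite] at *
  rintro ⟨i, j⟩ ⟨i', j'⟩
  rw [inner_tmulL, he, he']
  by_cases h1 : i = i' <;> by_cases h2 : j = j' <;> simp [h1, h2]

theorem norm_sq_sum_orthonormal {E κ : Type*} [NormedAddCommGroup E] [InnerProductSpace ℝ E]
    [Fintype κ] {e : κ → E} (he : Orthonormal ℝ e) (x : κ → ℝ) :
    ‖∑ i, x i • e i‖ ^ 2 = ∑ i, x i ^ 2 := by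
  rw [← real_inner_self_eq_norm_sq, he.inner_sum]
  simp [sq]

theorem norm_sq_sum_tmulL {κ : Type*} [Fintype κ] {e : κ → H}
    (he : Orthonormal ℝ e) (x : κ → κ → ℝ) :
    ‖∑ i, ∑ j, x i j • tmulL H H (e i) (e j)‖ ^ 2 = ∑ i, ∑ j, x i j ^ 2 := by
  have h := norm_sq_sum_orthonormal (orthonormal_tmulL he he) fun z => x z.1 z.2
  rwa [Fintype.sum_prod_type, Fintype.sum_prod_type] at h

variable [CompleteSpace H]

/-- `toOp` as a linear map. -/
def toOpL (H : Type u) [NormedAddCommGroup H] [InnerProductSpace ℝ H] [CompleteSpace H] :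
    HilbertTensor H H →ₗ[ℝ] H →L[ℝ] H where
  toFun := toOp
  map_add' u w := by
    ext e
    refine ext_inner_right ℝ fun x => ?_
    rw [add_apply, inner_add_left, inner_toOp, inner_toOp, inner_toOp,
      inner_add_left]
  map_smul' c u := by
    ext e
    refine ext_inner_right ℝ fun x => ?_
    rw [RingHom.id_apply, smul_apply, real_inner_smul_left, inner_toOp,
      inner_toOp, real_inner_smul_left]

theorem toOp_sub (u w : HilbertTensor H H) : toOp (u - w) = toOp u - toOp w :=
  map_sub (toOpL H) u w

theorem norm_toOp_le (u : HilbertTensor H H) : ‖toOp u‖ ≤ ‖u‖ := by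
  refine ContinuousLinearMap.opNorm_le_bound _ (norm_nonneg _) fun e => ?_
  rcases eq_or_ne (toOp u e) 0 with h | h
  · rw [h, norm_zero]; positivity
  · refine le_of_mul_le_mul_right ?_ (norm_pos_iff.2 h)
    rw [← sq, ← real_inner_self_eq_norm_sq, inner_toOp]
    refine (real_inner_le_norm _ _).trans (le_of_eq ?_)
    rw [norm_tmulL]; ring

theorem toOp_tmulL (a b e : H) : toOp (tmulL H H a b) e = ⟪b, e⟫ • a := by
  refine ext_inner_right ℝ fun x => ?_
  rw [inner_toOp, inner_tmulL, real_inner_smul_left, mul_comm]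

variable {ι : Type v} (b : HilbertBasis ι ℝ H)

/-- Parseval for each vector `toOp u (b i)`, then Bessel's inequality for the orthonormal family `b
j ⊗ b i`; completeness of that family is not needed. -/
theorem norm_toOp_le_finset_sum (u : HilbertTensor H H) (s : Finset ι) :
    ∑ i ∈ s, ‖toOp u (b i)‖ ^ 2 ≤ ‖u‖ ^ 2 := by
  have hb : Orthonormal ℝ fun z : ι × ι => tmulL H H (b z.1) (b z.2) :=
    orthonormal_tmulL b.orthonormal b.orthonormal
  have h1 : ∀ i, HasSum (fun j => ⟪u, tmulL H H (b j) (b i)⟫ ^ 2) (‖toOp u (b i)‖ ^ 2) := by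
    intro i
    have h := b.hasSum_inner_mul_inner (toOp u (b i)) (toOp u (b i))
    rw [real_inner_self_eq_norm_sq] at h
    refine h.congr_fun (fun j => ?_)
    rw [real_inner_comm (toOp u (b i)) (b j), ← sq, inner_toOp]
  have h2 := hasSum_sum fun i (_ : i ∈ s) => h1 i
  refine hasSum_le_of_sum_le h2 fun t => ?_
  have h3 := hb.sum_inner_products_le (x := u) (s := t ×ˢ s)
  refine le_trans (le_of_eq ?_) h3
  rw [Finset.sum_product]
  refine Finset.sum_congr rfl fun j _ => Finset.sum_congr rfl fun i _ => ?_
  rw [Real.norm_eq_abs, sq_abs, real_inner_comm]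

theorem summable_norm_toOp_sq (u : HilbertTensor H H) :
    Summable fun i => ‖toOp u (b i)‖ ^ 2 :=
  summable_of_sum_le (fun _ => sq_nonneg _) (norm_toOp_le_finset_sum b u)

theorem hasSum_contraction (u : HilbertTensor H H) :
    HasSum (fun i => tmulL H H (toOp u (b i)) (toOp u (b i))) (contraction b u u) := by
  refine Summable.hasSum (Summable.of_norm ?_)
  simp only [norm_tmulL, ← sq]
  exact summable_norm_toOp_sq b u

/-- With `T = toOp u`, the contraction `u ⊗₁ u` is the kernel of `T T*`: summing `⟨T bᵢ, x⟩ ⟨T bᵢ,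
y⟩` is Parseval for `T* x` and `T* y`. -/
theorem inner_contraction (u : HilbertTensor H H) (x y : H) :
    ⟪contraction b u u, tmulL H H x y⟫ =
      ⟪ContinuousLinearMap.adjoint (toOp u) x, ContinuousLinearMap.adjoint (toOp u) y⟫ := by
  have h1 := (hasSum_contraction b u).mapL ((innerSL ℝ).flip (tmulL H H x y))
  have h2 := b.hasSum_inner_mul_inner (ContinuousLinearMap.adjoint (toOp u) x)
    (ContinuousLinearMap.adjoint (toOp u) y)
  refine h1.unique (h2.congr_fun fun i => ?_)
  rw [ContinuousLinearMap.adjoint_inner_left, ContinuousLinearMap.adjoint_inner_right,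
    ContinuousLinearMap.flip_apply, innerSL_apply_apply, inner_tmulL, real_inner_comm]

/-- `‖T* x‖² = ⟨u ⊗₁ u, x ⊗ x⟩ ≤ ‖u ⊗₁ u‖ ‖x‖²`. -/
theorem norm_toOp_sq_le (u : HilbertTensor H H) : ‖toOp u‖ ^ 2 ≤ ‖contraction b u u‖ := by
  rw [← LinearIsometryEquiv.norm_map ContinuousLinearMap.adjoint (toOp u)]
  have h : ‖ContinuousLinearMap.adjoint (toOp u)‖ ≤ √‖contraction b u u‖ := by
    refine ContinuousLinearMap.opNorm_le_bound _ (Real.sqrt_nonneg _) fun x => ?_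
    refine abs_le_of_sq_le_sq' ?_ (by positivity) |>.2
    rw [mul_pow, Real.sq_sqrt (norm_nonneg _), ← real_inner_self_eq_norm_sq,
      ← inner_contraction b u x x]
    refine (real_inner_le_norm _ _).trans (le_of_eq ?_)
    rw [norm_tmulL]; ring
  calc _ ≤ √‖contraction b u u‖ ^ 2 := by gcongr
    _ = _ := Real.sq_sqrt (norm_nonneg _)

/-- `‖u ⊗₁ u‖² = ∑ ‖T* T bᵢ‖² ≤ ‖T‖² ∑ ‖T bᵢ‖² ≤ ‖T‖² ‖u‖²`. -/
theorem norm_contraction_le (u : HilbertTensor H H) :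
    ‖contraction b u u‖ ≤ ‖toOp u‖ * ‖u‖ := by
  refine abs_le_of_sq_le_sq' ?_ (by positivity) |>.2
  have h1 := (hasSum_contraction b u).mapL (innerSL ℝ (contraction b u u))
  rw [innerSL_apply_apply, real_inner_self_eq_norm_sq] at h1
  have h2 := ((summable_norm_toOp_sq b u).mul_left (‖toOp u‖ ^ 2)).hasSum
  refine (hasSum_le (fun i => ?_) h1 h2).trans ?_
  · rw [innerSL_apply_apply, inner_contraction, real_inner_self_eq_norm_sq, ← mul_pow]
    have := (ContinuousLinearMap.adjoint (toOp u)).le_opNorm (toOp u (b i))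
    rw [LinearIsometryEquiv.norm_map] at this
    gcongr
  · rw [tsum_mul_left, mul_pow]
    gcongr
    exact (summable_norm_toOp_sq b u).tsum_le_of_sum_le (norm_toOp_le_finset_sum b u)

section Coordinates

variable {κ : Type*} [Fintype κ] {e : κ → H} (he : Orthonormal ℝ e)

theorem toOp_sum_tmulL (e : κ → H) (x : κ → κ → ℝ) (v : H) :
    toOp (∑ i, ∑ j, x i j • tmulL H H (e i) (e j)) v = ∑ i, (∑ j, x i j * ⟪e j, v⟫) • e i := by
  change toOpL H _ v = _
  simp only [map_sum, map_smul]
  rw [sum_apply]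
  refine Finset.sum_congr rfl fun i _ => ?_
  rw [sum_apply, Finset.sum_smul]
  refine Finset.sum_congr rfl fun j _ => ?_
  rw [smul_apply, mul_smul]
  exact congrArg _ (toOp_tmulL _ _ _)

include he

/-- Applied to the Hessian and the gradient, this bounds the right side of `variance_gradient_le`.
-/
theorem sum_sq_mul_le_toOp (x : κ → κ → ℝ) (g : κ → ℝ) :
    ∑ i, (∑ j, x i j * g j) ^ 2 ≤
      ‖toOp (∑ i, ∑ j, x i j • tmulL H H (e i) (e j))‖ ^ 2 * ∑ j, g j ^ 2 := by
  classical
  have h := (toOp (∑ i, ∑ j, x i j • tmulL H H (e i) (e j))).le_opNorm (∑ k, g k • e k)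
  have h2 := pow_le_pow_left₀ (norm_nonneg _) h 2
  rw [mul_pow, norm_sq_sum_orthonormal he, toOp_sum_tmulL, norm_sq_sum_orthonormal he] at h2
  simpa only [he.inner_right_fintype] using h2

/-- Cauchy-Schwarz over pairs of indices: `‖A v‖² = ⟨AᵀA v, v⟩ ≤ ‖AᵀA‖_HS ‖v‖²`, and the right side
of the claim is `‖AᵀA‖²_HS`. -/
theorem norm_toOp_pow_four_le (x : κ → κ → ℝ) :
    ‖toOp (∑ i, ∑ j, x i j • tmulL H H (e i) (e j))‖ ^ 4 ≤
      ∑ j, ∑ k, (∑ i, x i j * x i k) ^ 2 := by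
  set K := ∑ j, ∑ k, (∑ i, x i j * x i k) ^ 2 with hK
  have hK0 : 0 ≤ K := by positivity
  have h : ‖toOp (∑ i, ∑ j, x i j • tmulL H H (e i) (e j))‖ ≤ √√K := by
    refine ContinuousLinearMap.opNorm_le_bound _ (Real.sqrt_nonneg _) fun v => ?_
    refine abs_le_of_sq_le_sq' ?_ (by positivity) |>.2
    rw [toOp_sum_tmulL, norm_sq_sum_orthonormal he, mul_pow, Real.sq_sqrt (Real.sqrt_nonneg _)]
    have e1 : ∑ i, (∑ j, x i j * ⟪e j, v⟫) ^ 2 =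
        ∑ z : κ × κ, (∑ i, x i z.1 * x i z.2) * (⟪e z.1, v⟫ * ⟪e z.2, v⟫) := by
      simp only [sq]
      simp_rw [Finset.sum_mul_sum, Finset.sum_mul, Fintype.sum_prod_type]
      rw [Finset.sum_comm]
      refine Finset.sum_congr rfl fun j _ => ?_
      rw [Finset.sum_comm]
      exact Finset.sum_congr rfl fun k _ => Finset.sum_congr rfl fun i _ => by ring
    have e2 : ∑ z : κ × κ, (⟪e z.1, v⟫ * ⟪e z.2, v⟫) ^ 2 = (∑ j, ⟪e j, v⟫ ^ 2) ^ 2 := by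
      rw [sq (∑ j, ⟪e j, v⟫ ^ 2), Finset.sum_mul_sum, Fintype.sum_prod_type]
      simp only [mul_pow]
    have e3 : ∑ j, ⟪e j, v⟫ ^ 2 ≤ ‖v‖ ^ 2 := by
      simpa using he.sum_inner_products_le (x := v) (s := Finset.univ)
    have hB : 0 ≤ ∑ j, ⟪e j, v⟫ ^ 2 := by positivity
    rw [e1]
    refine abs_le_of_sq_le_sq' ?_ (by positivity) |>.2
    refine (Finset.sum_mul_sq_le_sq_mul_sq _ _ _).trans ?_
    rw [e2, mul_pow, Real.sq_sqrt hK0, Fintype.sum_prod_type, ← hK]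
    exact mul_le_mul_of_nonneg_left (pow_le_pow_left₀ hB e3 2) hK0
  calc _ ≤ √√K ^ 4 := by gcongr
    _ = (√√K ^ 2) ^ 2 := by ring
    _ = K := by rw [Real.sq_sqrt (Real.sqrt_nonneg _), Real.sq_sqrt hK0]

end Coordinates

end WienerChaos

/-! ### Polynomials evaluated at an isonormal process. -/

namespace GaussPoly

open MvPolynomial (eval)

variable {ι : Type} [Fintype ι]

theorem hasTemperateGrowth_eval (p : MvPolynomial ι ℝ) :
    (fun x : ι → ℝ => eval x p).HasTemperateGrowth := by
  induction p using MvPolynomial.induction_on with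
  | C a => simp
  | add p q hp hq => simpa using hp.fun_add hq
  | mul_X p i hp =>
    have : (fun x : ι → ℝ => x i).HasTemperateGrowth :=
      (ContinuousLinearMap.proj (R := ℝ) (φ := fun _ : ι => ℝ) i).hasTemperateGrowth
    simpa using hp.fun_mul this

theorem hasFDerivAt_eval (p : MvPolynomial ι ℝ) (x : ι → ℝ) :
    HasFDerivAt (fun x : ι → ℝ => eval x p)
      (∑ i, eval x (pd i p) • ContinuousLinearMap.proj (R := ℝ) (φ := fun _ : ι => ℝ) i) x := by
  classical
  induction p using MvPolynomial.induction_on with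
  | C a => simpa using hasFDerivAt_const (𝕜 := ℝ) a x
  | add p q hp hq => simpa [add_smul, Finset.sum_add_distrib] using hp.fun_add hq
  | mul_X p i hp =>
    have h1 : HasFDerivAt (fun x : ι → ℝ => x i)
        (ContinuousLinearMap.proj (R := ℝ) (φ := fun _ : ι => ℝ) i) x :=
      (ContinuousLinearMap.proj (R := ℝ) (φ := fun _ : ι => ℝ) i).hasFDerivAt
    have h2 := hp.fun_mul h1
    simp only [map_mul, MvPolynomial.eval_X]
    have e : ∀ j, eval x (pd j (p * MvPolynomial.X i)) •
        ContinuousLinearMap.proj (R := ℝ) (φ := fun _ : ι => ℝ) j =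
        x i • eval x (pd j p) • ContinuousLinearMap.proj (R := ℝ) (φ := fun _ : ι => ℝ) j +
        if j = i then eval x p • ContinuousLinearMap.proj (R := ℝ) (φ := fun _ : ι => ℝ) j
        else 0 := by
      intro j
      rw [pd_mul, pd_X, map_add, map_mul, map_mul, MvPolynomial.eval_X, add_smul, smul_smul,
        mul_comm (x i)]
      split_ifs <;> simp
    rw [Finset.sum_congr rfl fun j _ => e j, Finset.sum_add_distrib, ← Finset.smul_sum,
      Finset.sum_ite_eq' Finset.univ i, if_pos (Finset.mem_univ i), add_comm]
    exact h2

theorem fderiv_eval_apply (p : MvPolynomial ι ℝ) (x v : ι → ℝ) :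
    fderiv ℝ (fun x : ι → ℝ => eval x p) x v = ∑ i, eval x (pd i p) * v i := by
  rw [(hasFDerivAt_eval p x).fderiv]
  simp

end GaussPoly

namespace WienerChaos

open GaussPoly
open MvPolynomial (eval)

namespace IsIsonormal

variable {H Ω : Type*} [NormedAddCommGroup H] [InnerProductSpace ℝ H] [MeasurableSpace Ω]
  {P : Measure Ω} [IsProbabilityMeasure P] {X : H → Ω → ℝ} (hX : IsIsonormal X P)
  {ι : Type} [Fintype ι] {e : ι → H} (he : Orthonormal ℝ e)

/-- The Gaussian functional of an orthonormal family. -/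
def gaussFun : GaussFun ι where
  E :=
    { toFun := fun p => ∫ ω, eval (fun i => X (e i) ω) p ∂P
      map_add' := fun p r => by
        simp only [map_add]
        exact integral_add (hX.integrable_comp e (hasTemperateGrowth_eval p))
          (hX.integrable_comp e (hasTemperateGrowth_eval r))
      map_smul' := fun c p => by
        simp only [MvPolynomial.smul_eval, integral_const_mul, RingHom.id_apply, smul_eq_mul] }
  one := by simp
  ibp i p := by
    classical
    have h := hX.integral_fderiv e (e i) (hasTemperateGrowth_eval p)
    simp only [fderiv_eval_apply, orthonormal_iff_ite.1 he, mul_ite, mul_one, mul_zero,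
      Finset.sum_ite_eq', Finset.mem_univ, if_true] at h
    simp only [LinearMap.coe_mk, AddHom.coe_mk, map_mul, MvPolynomial.eval_X, h]
    exact integral_congr_ae (ae_of_all _ fun ω => mul_comm _ _)
  nonneg p hp := integral_nonneg fun ω => hp _

theorem gaussFun_apply (p : MvPolynomial ι ℝ) :
    (hX.gaussFun he).E p = ∫ ω, eval (fun i => X (e i) ω) p ∂P := rfl

end IsIsonormal

end WienerChaos

/-! ### Wick sums and their derivatives in finite coordinates. -/

namespace WienerChaos

open GaussPoly
open MvPolynomial (eval)

universe u v

section Defs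

variable {H : Type u} {Ω : Type v}

/-- The random variable `H_n(X(h))`. -/
def herm (X : H → Ω → ℝ) (n : ℕ) (h : H) (ω : Ω) : ℝ :=
  Polynomial.aeval (X h ω) (Polynomial.hermite n)

/-- The random variable `∑ c_h H_q(X(h))`. -/
def wickVal (X : H → Ω → ℝ) (q : ℕ) : (H →₀ ℝ) →ₗ[ℝ] Ω → ℝ :=
  Finsupp.linearCombination ℝ fun h ω => herm X q h ω

theorem wickVal_apply (X : H → Ω → ℝ) (q : ℕ) (c : H →₀ ℝ) (ω : Ω) :
    wickVal X q c ω = ∑ h ∈ c.support, c h * herm X q h ω := by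
  simp [wickVal, Finsupp.linearCombination_apply, Finsupp.sum, Finset.sum_apply]

variable [NormedAddCommGroup H]

/-- Coefficient systems supported on the unit sphere. -/
def IsSpherical (c : H →₀ ℝ) : Prop := ∀ h ∈ c.support, ‖h‖ = 1

theorem IsSpherical.sub {c c' : H →₀ ℝ} (hc : IsSpherical c) (hc' : IsSpherical c') :
    IsSpherical (c - c') := by
  classical
  intro h hh
  rcases Finset.mem_union.1 (Finsupp.support_sub hh) with h1 | h1
  · exact hc h h1
  · exact hc' h h1

theorem IsSpherical.add {c c' : H →₀ ℝ} (hc : IsSpherical c) (hc' : IsSpherical c') :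
    IsSpherical (c + c') := by
  classical
  intro h hh
  rcases Finset.mem_union.1 (Finsupp.support_add hh) with h1 | h1
  · exact hc h h1
  · exact hc' h h1

theorem IsSpherical.smul {c : H →₀ ℝ} (hc : IsSpherical c) (r : ℝ) : IsSpherical (r • c) :=
  fun h hh => hc h (Finsupp.support_smul hh)

variable [InnerProductSpace ℝ H]

/-- The Malliavin derivative of `wickVal X q c`. -/
def wickDeriv₁ (X : H → Ω → ℝ) (q : ℕ) : (H →₀ ℝ) →ₗ[ℝ] Ω → H :=
  Finsupp.linearCombination ℝ fun h ω => (q * herm X (q - 1) h ω) • h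

/-- The second Malliavin derivative of `wickVal X q c`. -/
def wickDeriv₂ (X : H → Ω → ℝ) (q : ℕ) : (H →₀ ℝ) →ₗ[ℝ] Ω → HilbertTensor H H :=
  Finsupp.linearCombination ℝ fun h ω =>
    (q * ((q - 1 : ℕ) * herm X (q - 1 - 1) h ω)) • tmulL H H h h

variable (X : H → Ω → ℝ) (q : ℕ) (c : H →₀ ℝ) (ω : Ω)

theorem wickDeriv₁_apply : wickDeriv₁ X q c ω =
    ∑ h ∈ c.support, c h • (q * herm X (q - 1) h ω) • h := by
  simp [wickDeriv₁, Finsupp.linearCombination_apply, Finsupp.sum, Finset.sum_apply]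

theorem wickDeriv₂_apply : wickDeriv₂ X q c ω = ∑ h ∈ c.support,
    c h • (q * ((q - 1 : ℕ) * herm X (q - 1 - 1) h ω)) • tmulL H H h h := by
  simp [wickDeriv₂, Finsupp.linearCombination_apply, Finsupp.sum, Finset.sum_apply]

end Defs

variable {H : Type u} {Ω : Type v} [NormedAddCommGroup H] [InnerProductSpace ℝ H]
  [MeasurableSpace Ω] {P : Measure Ω} {X : H → Ω → ℝ}

/-- In an orthonormal basis of the span of its support, a Wick sum and its Malliavin derivatives
are polynomials. -/
theorem IsIsonormal.exists_coordinates (hX : IsIsonormal X P) (q : ℕ) {c : H →₀ ℝ}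
    (hc : IsSpherical c) :
    ∃ (d n : ℕ) (e : Fin d → H) (_ : Orthonormal ℝ e) (c' : Fin n → ℝ) (a : Fin n → Fin d → ℝ),
      ∀ᵐ ω ∂P, wickVal X q c ω = eval (fun i => X (e i) ω) (wickSum c' a q) ∧
        wickDeriv₁ X q c ω =
          ∑ i, eval (fun i => X (e i) ω) (pd i (wickSum c' a q)) • e i ∧
        wickDeriv₂ X q c ω = ∑ i, ∑ j,
          eval (fun i => X (e i) ω) (pd i (pd j (wickSum c' a q))) • tmulL H H (e i) (e j) := by
  classical
  set V := Submodule.span ℝ (c.support : Set H) with hV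
  have : FiniteDimensional ℝ V := FiniteDimensional.span_of_finite ℝ c.support.finite_toSet
  set bV := stdOrthonormalBasis ℝ V with hbV
  set d := Module.finrank ℝ V
  set e : Fin d → H := fun i => (bV i : H) with he
  have heo : Orthonormal ℝ e := bV.orthonormal.comp_linearIsometry V.subtypeₗᵢ
  set η : Fin c.support.card ≃ c.support := c.support.equivFin.symm
  set a : Fin c.support.card → Fin d → ℝ := fun k i => ⟪e i, (η k : H)⟫ with ha
  have hdec : ∀ k, (η k : H) = ∑ i, a k i • e i := by
    intro k
    have hk : (η k : H) ∈ V := Submodule.subset_span (η k).2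
    have := congrArg (Subtype.val) (bV.sum_repr' ⟨(η k : H), hk⟩)
    rw [Submodule.coe_sum] at this
    simpa [ha, he] using this.symm
  -- The identification of Hermite and Wick polynomials in `eval_wick` holds for unit vectors; this
  -- is where sphericity of `c` is used.
  have hunit : ∀ k, a k ⬝ᵥ a k = 1 := by
    intro k
    have h1 := norm_sq_sum_orthonormal heo (a k)
    rw [← hdec, hc _ (η k).2, one_pow] at h1
    rw [dotProduct, h1]
    exact Finset.sum_congr rfl fun i _ => (sq _).symm
  have hlin : ∀ k, ∀ᵐ ω ∂P, X (η k) ω = a k ⬝ᵥ fun i => X (e i) ω := by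
    intro k
    have := hX.ae_eq_sum e (a k)
    rw [← hdec] at this
    exact this
  refine ⟨d, _, e, heo, fun k => c (η k), a, ?_⟩
  filter_upwards [ae_all_iff.2 hlin] with ω hω
  have hherm : ∀ k m, herm X m (η k) ω = eval (fun i => X (e i) ω) (wick (a k) m) := by
    intro k m
    rw [herm, hω, eval_wick _ _ (hunit k)]
  -- Two versions because of universes: this one serves sums in `H` and in its tensor square,
  -- `hsum'` serves real sums.
  have hsum : ∀ {M : Type u} [AddCommMonoid M] (f : H → M),
      ∑ h ∈ c.support, f h = ∑ k, f (η k) := by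
    intro M _ f
    rw [← Finset.sum_coe_sort, ← Equiv.sum_comp η]
  have hsum' : ∀ (f : H → ℝ), ∑ h ∈ c.support, f h = ∑ k, f (η k) := by
    intro f
    rw [← Finset.sum_coe_sort, ← Equiv.sum_comp η]
  refine ⟨?_, ?_, ?_⟩
  · rw [wickVal_apply, hsum', wickSum, map_sum]
    exact Finset.sum_congr rfl fun k _ => by rw [hherm, MvPolynomial.smul_eval]
  · rw [wickDeriv₁_apply, hsum]
    have e1 : ∀ k, c (η k) • (q * herm X (q - 1) (η k) ω) • (η k : H) =
        ∑ i, (q * (c (η k) * a k i * eval (fun i => X (e i) ω) (wick (a k) (q - 1)))) • e i := by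
      intro k
      rw [hherm]
      generalize c (η k) = r
      conv_lhs => rw [hdec k]
      rw [Finset.smul_sum, Finset.smul_sum]
      refine Finset.sum_congr rfl fun i _ => ?_
      rw [smul_smul, smul_smul]
      congr 1; ring
    rw [Finset.sum_congr rfl fun k _ => e1 k, Finset.sum_comm]
    refine Finset.sum_congr rfl fun i _ => ?_
    rw [pd_wickSum, wickSum, MvPolynomial.smul_eval, map_sum, Finset.mul_sum, Finset.sum_smul]
    simp only [MvPolynomial.smul_eval]
  · rw [wickDeriv₂_apply, hsum]
    have e1 : ∀ k, c (η k) • (q * ((q - 1 : ℕ) * herm X (q - 1 - 1) (η k) ω)) •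
        tmulL H H (η k : H) (η k : H) =
        ∑ i, ∑ j, (q * ((q - 1 : ℕ) * (c (η k) * a k j * a k i *
          eval (fun i => X (e i) ω) (wick (a k) (q - 1 - 1))))) • tmulL H H (e i) (e j) := by
      intro k
      rw [hherm]
      generalize c (η k) = r
      conv_lhs => rw [hdec k]
      simp only [map_sum, map_smul, sum_apply, smul_apply, Finset.smul_sum, smul_smul]
      rw [Finset.sum_comm]
      refine Finset.sum_congr rfl fun i _ => Finset.sum_congr rfl fun j _ => ?_
      congr 1; ring
    rw [Finset.sum_congr rfl fun k _ => e1 k, Finset.sum_comm]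
    refine Finset.sum_congr rfl fun i _ => ?_
    rw [Finset.sum_comm]
    refine Finset.sum_congr rfl fun j _ => ?_
    rw [pd_wickSum, map_smul, pd_wickSum, wickSum, MvPolynomial.smul_eval,
      MvPolynomial.smul_eval, map_sum, Finset.mul_sum, Finset.mul_sum, Finset.sum_smul]
    simp only [MvPolynomial.smul_eval]

end WienerChaos

/-! ### Moment and operator norm estimates for Wick sums. -/

namespace WienerChaos

open GaussPoly
open MvPolynomial (eval)

universe u v

variable {H : Type u} {Ω : Type v} [NormedAddCommGroup H] [InnerProductSpace ℝ H]
  [MeasurableSpace Ω] {P : Measure Ω} [IsProbabilityMeasure P] {X : H → Ω → ℝ}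

namespace IsIsonormal

variable (hX : IsIsonormal X P) (q : ℕ) {c : H →₀ ℝ} (hc : IsSpherical c)

include hX hc

theorem memLp_wick {p : ℝ≥0∞} (hp : p ≠ ∞) :
    MemLp (wickVal X q c) p P ∧ MemLp (wickDeriv₁ X q c) p P ∧ MemLp (wickDeriv₂ X q c) p P := by
  obtain ⟨d, n, e, he, c', a, h⟩ := hX.exists_coordinates q hc
  have hev := fun r : MvPolynomial (Fin d) ℝ => hasTemperateGrowth_eval r
  refine ⟨(hX.memLp_comp e (hev (wickSum c' a q)) hp).ae_eq ?_,
    (hX.memLp_comp e (g := fun x => ∑ i, eval x (pd i (wickSum c' a q)) • e i) ?_ hp).ae_eq ?_,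
    (hX.memLp_comp e (g := fun x => ∑ i, ∑ j,
      eval x (pd i (pd j (wickSum c' a q))) • tmulL H H (e i) (e j)) ?_ hp).ae_eq ?_⟩
  · filter_upwards [h] with ω hω using hω.1.symm
  · exact Function.HasTemperateGrowth.sum fun i _ => (hev _).fun_smul (by fun_prop)
  · filter_upwards [h] with ω hω using hω.2.1.symm
  · exact Function.HasTemperateGrowth.sum fun i _ => Function.HasTemperateGrowth.sum fun j _ =>
      (hev _).fun_smul (by fun_prop)
  · filter_upwards [h] with ω hω using hω.2.2.symm

theorem integral_wickVal_pow_four_le :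
    ∫ ω, wickVal X q c ω ^ 4 ∂P ≤ hyperConst₄ q * (∫ ω, wickVal X q c ω ^ 2 ∂P) ^ 2 := by
  obtain ⟨d, n, e, he, c', a, h⟩ := hX.exists_coordinates q hc
  have := (hX.gaussFun he).hyper₄ (S := Unit) (g := fun _ => wickSum c' a q)
    fun _ => wickSum_mem_chaos c' a q
  simp only [Finset.univ_unique, Finset.sum_singleton, ← pow_mul, gaussFun_apply, map_pow] at this
  have e1 : ∀ m : ℕ, ∫ ω, wickVal X q c ω ^ m ∂P =
      ∫ ω, eval (fun i => X (e i) ω) (wickSum c' a q) ^ m ∂P := fun m =>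
    integral_congr_ae (h.mono fun ω hω => by simp only [hω.1])
  rw [e1, e1]
  exact this

theorem integral_wickVal_pow_eight_le :
    ∫ ω, wickVal X q c ω ^ 8 ∂P ≤ hyperConst₈ q * (∫ ω, wickVal X q c ω ^ 2 ∂P) ^ 4 := by
  obtain ⟨d, n, e, he, c', a, h⟩ := hX.exists_coordinates q hc
  have := (hX.gaussFun he).hyper₈ (S := Unit) (g := fun _ => wickSum c' a q)
    fun _ => wickSum_mem_chaos c' a q
  simp only [Finset.univ_unique, Finset.sum_singleton, ← pow_mul, gaussFun_apply, map_pow] at this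
  have e1 : ∀ m : ℕ, ∫ ω, wickVal X q c ω ^ m ∂P =
      ∫ ω, eval (fun i => X (e i) ω) (wickSum c' a q) ^ m ∂P := fun m =>
    integral_congr_ae (h.mono fun ω hω => by simp only [hω.1])
  rw [e1, e1]
  exact this

theorem integral_norm_wickDeriv₁_sq :
    ∫ ω, ‖wickDeriv₁ X q c ω‖ ^ 2 ∂P = q * ∫ ω, wickVal X q c ω ^ 2 ∂P := by
  obtain ⟨d, n, e, he, c', a, h⟩ := hX.exists_coordinates q hc
  have := (hX.gaussFun he).sum_pd_sq (wickSum_mem_chaos c' a q)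
  rw [← map_sum] at this
  simp only [gaussFun_apply] at this
  simp only [map_pow, map_sum] at this
  have e1 : ∫ ω, wickVal X q c ω ^ 2 ∂P =
      ∫ ω, eval (fun i => X (e i) ω) (wickSum c' a q) ^ 2 ∂P :=
    integral_congr_ae (h.mono fun ω hω => by simp only [hω.1])
  rw [e1, ← this]
  exact integral_congr_ae (h.mono fun ω hω => by
    simp only [hω.2.1, norm_sq_sum_orthonormal he])

/-- The gradient is a family of elements of the chaos of order `q - 1`, so this is `hyper₄` in its
vector-valued form; likewise for the Hessian, of order `q - 2`, in the next estimate. -/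
theorem integral_norm_wickDeriv₁_pow_four_le (hq : 2 ≤ q) :
    ∫ ω, ‖wickDeriv₁ X q c ω‖ ^ 4 ∂P ≤
      hyperConst₄ (q - 1) * (q * ∫ ω, wickVal X q c ω ^ 2 ∂P) ^ 2 := by
  obtain ⟨d, n, e, he, c', a, h⟩ := hX.exists_coordinates q hc
  obtain ⟨q, rfl⟩ := Nat.exists_eq_add_of_le' hq
  rw [← hX.integral_norm_wickDeriv₁_sq _ hc]
  have := (hX.gaussFun he).hyper₄ (S := Fin d) (g := fun i => pd i (wickSum c' a (q + 2)))
    fun i => pd_mem_chaos i (wickSum_mem_chaos c' a (q + 2))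
  simp only [gaussFun_apply] at this
  simp only [map_pow, map_sum] at this
  have e2 : ∫ ω, ‖wickDeriv₁ X (q + 2) c ω‖ ^ 2 ∂P =
      ∫ ω, ∑ i, eval (fun i => X (e i) ω) (pd i (wickSum c' a (q + 2))) ^ 2 ∂P :=
    integral_congr_ae (h.mono fun ω hω => by simp only [hω.2.1, norm_sq_sum_orthonormal he])
  rw [e2]
  convert this using 1
  · refine integral_congr_ae (h.mono fun ω hω => ?_)
    simp only [hω.2.1]
    rw [show (4 : ℕ) = 2 * 2 from rfl, pow_mul, norm_sq_sum_orthonormal he]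
  · rfl

theorem integral_norm_wickDeriv₂_pow_four_le (hq : 2 ≤ q) :
    ∫ ω, ‖wickDeriv₂ X q c ω‖ ^ 4 ∂P ≤
      hyperConst₄ (q - 2) * ((q - 1 : ℕ) * (q * ∫ ω, wickVal X q c ω ^ 2 ∂P)) ^ 2 := by
  obtain ⟨d, n, e, he, c', a, h⟩ := hX.exists_coordinates q hc
  obtain ⟨q, rfl⟩ := Nat.exists_eq_add_of_le' hq
  rw [← hX.integral_norm_wickDeriv₁_sq _ hc]
  have hp : ∀ i, pd i (wickSum c' a (q + 2)) ∈ chaos (Fin d) (q + 1) := fun i =>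
    pd_mem_chaos i (wickSum_mem_chaos c' a (q + 2))
  have h4 := (hX.gaussFun he).hyper₄ (S := Fin d × Fin d) (g := fun z => pd z.1 (pd z.2 (wickSum c' a (q + 2))))
    fun z => pd_mem_chaos z.1 (hp z.2)
  have h2 := (hX.gaussFun he).E_sum_pd_sq (g := fun i => pd i (wickSum c' a (q + 2))) hp
  rw [h2] at h4
  simp only [gaussFun_apply] at h4
  simp only [map_pow, map_sum] at h4
  have e2 : ∫ ω, ‖wickDeriv₁ X (q + 2) c ω‖ ^ 2 ∂P =
      ∫ ω, ∑ i, eval (fun i => X (e i) ω) (pd i (wickSum c' a (q + 2))) ^ 2 ∂P :=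
    integral_congr_ae (h.mono fun ω hω => by simp only [hω.2.1, norm_sq_sum_orthonormal he])
  rw [e2]
  convert h4 using 1
  · refine integral_congr_ae (h.mono fun ω hω => ?_)
    simp only [hω.2.2]
    rw [show (4 : ℕ) = 2 * 2 from rfl, pow_mul, norm_sq_sum_tmulL he, Fintype.sum_prod_type]
  · rfl

variable [CompleteSpace H]

theorem memLp_norm_toOp_wickDeriv₂ {p : ℝ≥0∞} (hp : p ≠ ∞) :
    MemLp (fun ω => toOp (wickDeriv₂ X q c ω)) p P := by
  have hcont : Continuous (toOp : HilbertTensor H H → H →L[ℝ] H) :=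
    ((toOpL H).mkContinuous 1 fun u => by rw [one_mul]; exact norm_toOp_le u).continuous
  have h := (hX.memLp_wick q hc hp).2.2
  exact h.mono (hcont.comp_aestronglyMeasurable h.1) (ae_of_all _ fun ω => norm_toOp_le _)

/-- The second order Poincaré inequality for Wick sums. -/
theorem integral_sq_norm_wickDeriv₁_sub_le :
    ∫ ω, (‖wickDeriv₁ X q c ω‖ ^ 2 - q * ∫ ω, wickVal X q c ω ^ 2 ∂P) ^ 2 ∂P ≤
      4 * ∫ ω, ‖toOp (wickDeriv₂ X q c ω)‖ ^ 2 * ‖wickDeriv₁ X q c ω‖ ^ 2 ∂P := by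
  have h1 : Integrable (fun ω => ‖wickDeriv₁ X q c ω‖ ^ 2) P :=
    (hX.memLp_wick q hc (p := 2) (by simp)).2.1.integrable_norm_pow (by simp)
  have h2 : Integrable (fun ω => (‖wickDeriv₁ X q c ω‖ ^ 2) ^ 2) P := by
    simp only [← pow_mul]
    exact (hX.memLp_wick q hc (p := 4) (by simp)).2.1.integrable_norm_pow (by simp)
  have hmul : Integrable (fun ω => ‖toOp (wickDeriv₂ X q c ω)‖ ^ 2 * ‖wickDeriv₁ X q c ω‖ ^ 2) P := by
    have h3 := (hX.memLp_norm_toOp_wickDeriv₂ q hc (p := 4) (by simp)).integrable_norm_pow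
      (by simp)
    have h4 := (hX.memLp_wick q hc (p := 4) (by simp)).2.1.integrable_norm_pow (by simp)
    refine (h3.add h4).mono' ?_ (ae_of_all _ fun ω => ?_)
    · exact ((hX.memLp_norm_toOp_wickDeriv₂ q hc (p := 4) (by simp)).1.norm.pow 2).mul
        ((hX.memLp_wick q hc (p := 4) (by simp)).2.1.1.norm.pow 2)
    · rw [Real.norm_of_nonneg (by positivity), Pi.add_apply]
      nlinarith [sq_nonneg (‖toOp (wickDeriv₂ X q c ω)‖ ^ 2 - ‖wickDeriv₁ X q c ω‖ ^ 2),
        sq_nonneg (‖toOp (wickDeriv₂ X q c ω)‖ ^ 2 + ‖wickDeriv₁ X q c ω‖ ^ 2)]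
  have hm := hX.integral_norm_wickDeriv₁_sq q hc
  rw [← hm]
  set m := ∫ ω, ‖wickDeriv₁ X q c ω‖ ^ 2 ∂P
  have e1 : ∫ ω, (‖wickDeriv₁ X q c ω‖ ^ 2 - m) ^ 2 ∂P =
      ∫ ω, (‖wickDeriv₁ X q c ω‖ ^ 2) ^ 2 ∂P - m ^ 2 := by
    have : ∀ ω, (‖wickDeriv₁ X q c ω‖ ^ 2 - m) ^ 2 =
        (‖wickDeriv₁ X q c ω‖ ^ 2) ^ 2 - (2 * m * ‖wickDeriv₁ X q c ω‖ ^ 2 - m ^ 2) := by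
      intro ω; ring
    simp_rw [this]
    have h3 : Integrable (fun ω => 2 * m * ‖wickDeriv₁ X q c ω‖ ^ 2) P := h1.const_mul _
    have h4 : Integrable (fun ω => 2 * m * ‖wickDeriv₁ X q c ω‖ ^ 2 - m ^ 2) P :=
      h3.sub (integrable_const _)
    rw [integral_sub h2 h4, integral_sub h3 (integrable_const _), integral_const_mul]
    simp
    ring
  rw [e1]
  obtain ⟨d, n, e, he, c', a, h⟩ := hX.exists_coordinates q hc
  have hv := (hX.gaussFun he).variance_gradient_le (wickSum c' a q)
  simp only [gaussFun_apply] at hv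
  simp only [map_pow, map_sum, map_mul] at hv
  have e2 : m = ∫ ω, ∑ i, eval (fun i => X (e i) ω) (pd i (wickSum c' a q)) ^ 2 ∂P :=
    integral_congr_ae (h.mono fun ω hω => by simp only [hω.2.1, norm_sq_sum_orthonormal he])
  have e3 : ∫ ω, (‖wickDeriv₁ X q c ω‖ ^ 2) ^ 2 ∂P =
      ∫ ω, (∑ i, eval (fun i => X (e i) ω) (pd i (wickSum c' a q)) ^ 2) ^ 2 ∂P :=
    integral_congr_ae (h.mono fun ω hω => by simp only [hω.2.1, norm_sq_sum_orthonormal he])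
  have e4 : ∫ ω, ∑ i, (∑ j, eval (fun i => X (e i) ω) (pd i (pd j (wickSum c' a q))) *
      eval (fun i => X (e i) ω) (pd j (wickSum c' a q))) ^ 2 ∂P ≤
      ∫ ω, ‖toOp (wickDeriv₂ X q c ω)‖ ^ 2 * ‖wickDeriv₁ X q c ω‖ ^ 2 ∂P := by
    refine integral_mono_of_nonneg (ae_of_all _ fun ω => by positivity) hmul ?_
    filter_upwards [h] with ω hω
    rw [hω.2.1, hω.2.2, norm_sq_sum_orthonormal he]
    exact sum_sq_mul_le_toOp he _ _
  rw [e2, e3]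
  linarith

/-- The fourth cumulant of a Wick sum controls the operator norm of its second derivative. -/
theorem integral_norm_toOp_wickDeriv₂_le (hq : 0 < q) :
    ∫ ω, ‖toOp (wickDeriv₂ X q c ω)‖ ^ 4 ∂P ≤
      (2 * q : ℕ) * 4 ^ (2 * q) * (q.factorial : ℝ) ^ 4 *
        (∫ ω, wickVal X q c ω ^ 4 ∂P - 3 * (∫ ω, wickVal X q c ω ^ 2 ∂P) ^ 2) := by
  obtain ⟨d, n, e, he, c', a, h⟩ := hX.exists_coordinates q hc
  have hle := (hX.gaussFun he).contr_grad_le c' a hq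
  have e1 : ∀ m : ℕ, ∫ ω, wickVal X q c ω ^ m ∂P = (hX.gaussFun he).E (wickSum c' a q ^ m) := by
    intro m
    simp only [gaussFun_apply, map_pow]
    exact integral_congr_ae (h.mono fun ω hω => by simp only [hω.1])
  rw [e1, e1]
  refine le_trans ?_ hle
  simp only [← map_sum]
  rw [gaussFun_apply]
  refine integral_mono_of_nonneg (ae_of_all _ fun ω => by positivity)
    (hX.integrable_comp e (hasTemperateGrowth_eval _)) ?_
  filter_upwards [h] with ω hω
  rw [hω.2.2]
  refine (norm_toOp_pow_four_le he _).trans (le_of_eq ?_)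
  simp only [map_sum, map_pow, map_mul]

end IsIsonormal

end WienerChaos

/-! ### Stein's identity and convergence in law. -/

namespace WienerChaos

open GaussPoly
open MvPolynomial (eval)

universe u v

theorem hasTemperateGrowth_sin : Real.sin.HasTemperateGrowth :=
  ⟨Real.contDiff_sin, fun n => ⟨0, 1, fun x => by
    rw [norm_iteratedFDeriv_eq_norm_iteratedDeriv]
    simpa using Real.abs_iteratedDeriv_sin_le_one n x⟩⟩

section Coordinates

variable {H : Type u} {Ω : Type v} [NormedAddCommGroup H] [InnerProductSpace ℝ H]
  [MeasurableSpace Ω] {P : Measure Ω} [IsProbabilityMeasure P] {X : H → Ω → ℝ}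

/-- The eigenvalue equation reads `q p = ∑ (xᵢ ∂ᵢp - ∂ᵢ²p)`. Multiplying by `f(p)` and integrating
`xᵢ · ∂ᵢp · f(p)` by parts, the second derivatives cancel and `f'(p) |∇p|²` remains. -/
theorem IsIsonormal.integral_eval_mul_comp (hX : IsIsonormal X P) {ι : Type} [Fintype ι]
    {e : ι → H} (he : Orthonormal ℝ e) {q : ℕ} {p : MvPolynomial ι ℝ} (hp : p ∈ chaos ι q)
    {f : ℝ → ℝ} (hf : f.HasTemperateGrowth) :
    q * ∫ ω, eval (fun i => X (e i) ω) p * f (eval (fun i => X (e i) ω) p) ∂P =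
      ∫ ω, deriv f (eval (fun i => X (e i) ω) p) *
        ∑ i, eval (fun i => X (e i) ω) (pd i p) ^ 2 ∂P := by
  classical
  set Y : Ω → ι → ℝ := fun ω i => X (e i) ω
  have hev := fun r : MvPolynomial ι ℝ => hasTemperateGrowth_eval r
  have hfp : (fun x : ι → ℝ => f (eval x p)).HasTemperateGrowth := hf.comp (hev p)
  have hf' : (deriv f).HasTemperateGrowth := by
    have : deriv f = fun x => fderiv ℝ f x 1 := by ext; simp
    rw [this]; exact hasTemperateGrowth_fderiv_apply hf 1
  have hfp' : (fun x : ι → ℝ => deriv f (eval x p)).HasTemperateGrowth := hf'.comp (hev p)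
  have hint : ∀ {g : (ι → ℝ) → ℝ}, g.HasTemperateGrowth → Integrable (fun ω => g (Y ω)) P :=
    fun hg => hX.integrable_comp e hg
  have hibp : ∀ i, ∫ ω, eval (Y ω) (pd i p) * f (eval (Y ω) p) * X (e i) ω ∂P =
      ∫ ω, eval (Y ω) (pd i (pd i p)) * f (eval (Y ω) p) ∂P +
      ∫ ω, deriv f (eval (Y ω) p) * eval (Y ω) (pd i p) ^ 2 ∂P := by
    intro i
    have hd : ∀ x, fderiv ℝ (fun x : ι → ℝ => eval x (pd i p) * f (eval x p)) x
        (fun k => ⟪e k, e i⟫) = eval x (pd i (pd i p)) * f (eval x p) +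
          deriv f (eval x p) * eval x (pd i p) ^ 2 := by
      intro x
      have h1 := hasFDerivAt_eval (pd i p) x
      have h2 : HasFDerivAt (fun x : ι → ℝ => f (eval x p)) _ x :=
        ((hf.1.differentiable (by simp)) (eval x p)).hasDerivAt.comp_hasFDerivAt x
          (hasFDerivAt_eval p x)
      rw [(h1.fun_mul h2).fderiv]
      simp [orthonormal_iff_ite.1 he]
      ring
    have := hX.integral_fderiv e (e i) ((hev (pd i p)).fun_mul hfp)
    simp only [hd] at this
    rw [← this, integral_add]
    · exact hint ((hev _).fun_mul hfp)
    · exact hint (hfp'.fun_mul ((hev _).fun_pow 2))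
  have hnum : ∀ ω, q * (eval (Y ω) p * f (eval (Y ω) p)) =
      ∑ i, (eval (Y ω) (pd i p) * f (eval (Y ω) p) * X (e i) ω -
        eval (Y ω) (pd i (pd i p)) * f (eval (Y ω) p)) := by
    intro ω
    have := congrArg (eval (Y ω)) (num_of_mem_chaos hp)
    rw [num_apply, map_sum, MvPolynomial.smul_eval] at this
    rw [← mul_assoc, ← this, Finset.sum_mul]
    refine Finset.sum_congr rfl fun i _ => ?_
    rw [cr_apply, map_sub, map_mul, MvPolynomial.eval_X]
    ring
  have i1 : ∀ i, Integrable (fun ω => eval (Y ω) (pd i p) * f (eval (Y ω) p) * X (e i) ω) P := by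
    intro i
    have hp : (fun x : ι → ℝ => x i).HasTemperateGrowth :=
      (ContinuousLinearMap.proj (R := ℝ) (φ := fun _ : ι => ℝ) i).hasTemperateGrowth
    exact hint (((hev (pd i p)).fun_mul hfp).fun_mul hp)
  have i2 : ∀ i, Integrable (fun ω => eval (Y ω) (pd i (pd i p)) * f (eval (Y ω) p)) P :=
    fun i => hint ((hev _).fun_mul hfp)
  have i3 : ∀ i, Integrable (fun ω => deriv f (eval (Y ω) p) * eval (Y ω) (pd i p) ^ 2) P :=
    fun i => hint (hfp'.fun_mul ((hev _).fun_pow 2))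
  change q * ∫ ω, eval (Y ω) p * f (eval (Y ω) p) ∂P =
    ∫ ω, deriv f (eval (Y ω) p) * ∑ i, eval (Y ω) (pd i p) ^ 2 ∂P
  rw [← integral_const_mul]
  simp_rw [hnum, Finset.mul_sum]
  have i12 : ∀ i, Integrable (fun ω => eval (Y ω) (pd i p) * f (eval (Y ω) p) * X (e i) ω -
      eval (Y ω) (pd i (pd i p)) * f (eval (Y ω) p)) P := fun i => (i1 i).sub (i2 i)
  rw [integral_finsetSum _ fun i _ => i12 i, integral_finsetSum _ fun i _ => i3 i]
  refine Finset.sum_congr rfl fun i _ => ?_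
  rw [integral_sub (i1 i) (i2 i), hibp]
  ring

/-- The phase `a` treats both parts of the characteristic function at once: `a = 0` gives the real
part and `a = -π/2` the imaginary part. -/
theorem IsIsonormal.integral_wickVal_mul_sin (hX : IsIsonormal X P) (q : ℕ) {c : H →₀ ℝ}
    (hc : IsSpherical c) (t a : ℝ) :
    q * ∫ ω, wickVal X q c ω * Real.sin (t * wickVal X q c ω + a) ∂P =
      t * ∫ ω, ‖wickDeriv₁ X q c ω‖ ^ 2 * Real.cos (t * wickVal X q c ω + a) ∂P := by
  obtain ⟨d, n, e, he, c', b, h⟩ := hX.exists_coordinates q hc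
  have hlin : (fun x : ℝ => t * x + a).HasTemperateGrowth := by fun_prop
  have := hX.integral_eval_mul_comp he (wickSum_mem_chaos c' b q) (hasTemperateGrowth_sin.comp hlin)
  have e1 : ∀ x, deriv (Real.sin ∘ fun x : ℝ => t * x + a) x = t * Real.cos (t * x + a) := by
    intro x
    have h1 : HasDerivAt (fun x : ℝ => t * x + a) t x := by
      simpa using ((hasDerivAt_id x).const_mul t).add_const a
    rw [((Real.hasDerivAt_sin _).comp x h1).deriv, mul_comm]
  simp only [e1, Function.comp_apply] at this
  rw [← integral_const_mul t]
  convert this using 1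
  · congr 1
    exact integral_congr_ae (h.mono fun ω hω => by simp only [hω.1])
  · exact integral_congr_ae (h.mono fun ω hω => by
      simp only [hω.1, hω.2.1, norm_sq_sum_orthonormal he]; ring)

end Coordinates

section Stein

variable {Ω : Type v} [MeasurableSpace Ω] {P : Measure Ω} [IsProbabilityMeasure P]

/-- A Stein type bound on the distance to the Gaussian characteristic function. -/
theorem abs_integral_cos_sub_le {F Γ : Ω → ℝ} (hF : Integrable F P) (hΓ : Integrable Γ P)
    (hS : ∀ t a : ℝ, ∫ ω, F ω * Real.sin (t * F ω + a) ∂P =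
      t * ∫ ω, Γ ω * Real.cos (t * F ω + a) ∂P) (t a : ℝ) :
    |Real.exp (t ^ 2 / 2) * ∫ ω, Real.cos (t * F ω + a) ∂P - Real.cos a| ≤
      t ^ 2 * Real.exp (t ^ 2 / 2) * ∫ ω, |Γ ω - 1| ∂P := by
  set ε := ∫ ω, |Γ ω - 1| ∂P with hε
  have hmcos : ∀ t : ℝ, AEStronglyMeasurable (fun ω => Real.cos (t * F ω + a)) P := fun t =>
    (by fun_prop : Continuous fun x : ℝ => Real.cos (t * x + a)).comp_aestronglyMeasurable hF.1
  have hmsin : ∀ t : ℝ, AEStronglyMeasurable (fun ω => Real.sin (t * F ω + a)) P := fun t =>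
    (by fun_prop : Continuous fun x : ℝ => Real.sin (t * x + a)).comp_aestronglyMeasurable hF.1
  have hcos : ∀ t : ℝ, Integrable (fun ω => Real.cos (t * F ω + a)) P := fun t =>
    (integrable_const (1 : ℝ)).mono' (hmcos t) (ae_of_all _ fun ω => Real.abs_cos_le_one _)
  set U : ℝ → ℝ := fun t => ∫ ω, Real.cos (t * F ω + a) ∂P with hU
  have hderiv : ∀ s, HasDerivAt U (-(∫ ω, F ω * Real.sin (s * F ω + a) ∂P)) s := by
    intro s
    have := (hasDerivAt_integral_of_dominated_loc_of_deriv_le (μ := P) (𝕜 := ℝ)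
      (F := fun t ω => Real.cos (t * F ω + a))
      (F' := fun t ω => -(F ω * Real.sin (t * F ω + a))) (x₀ := s) (s := Set.univ)
      (bound := fun ω => |F ω|) univ_mem (Eventually.of_forall fun t => hmcos t) (hcos s)
      ((hF.1.mul (hmsin s)).neg) (ae_of_all _ fun ω t _ => ?_) hF.abs
      (ae_of_all _ fun ω t _ => ?_)).2
    · rwa [integral_neg] at this
    · rw [norm_neg, norm_mul]
      exact mul_le_of_le_one_right (norm_nonneg _) (Real.abs_sin_le_one _)
    · have h1 : HasDerivAt (fun x : ℝ => x * F ω + a) (F ω) t := by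
        simpa using ((hasDerivAt_id t).mul_const (F ω)).add_const a
      convert! h1.cos using 1
      ring
  have hbound : ∀ s, |s * U s - ∫ ω, F ω * Real.sin (s * F ω + a) ∂P| ≤ |s| * ε := by
    intro s
    have i1 : Integrable (fun ω => Γ ω * Real.cos (s * F ω + a)) P :=
      hΓ.mono (hΓ.1.mul (hmcos s)) (ae_of_all _ fun ω => by
        rw [norm_mul]
        exact mul_le_of_le_one_right (norm_nonneg _) (Real.abs_cos_le_one _))
    rw [hS, hU, ← mul_sub, ← integral_sub (hcos s) i1, abs_mul]
    refine mul_le_mul_of_nonneg_left (abs_integral_le_integral_abs.trans ?_) (abs_nonneg _)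
    refine integral_mono ((hcos s).sub i1).abs (hΓ.sub (integrable_const 1)).abs fun ω => ?_
    dsimp only
    rw [show Real.cos (s * F ω + a) - Γ ω * Real.cos (s * F ω + a) =
      -((Γ ω - 1) * Real.cos (s * F ω + a)) by ring, abs_neg, abs_mul]
    exact mul_le_of_le_one_right (abs_nonneg _) (Real.abs_cos_le_one _)
  -- An integrating factor: for `Γ = 1` the hypothesis `hS` would say `U' = -s U`, and `exp(s²/2)
  -- U(s)` would be constant. In general its derivative is controlled by `hbound`, and the mean
  -- value inequality between `0` and `t` concludes.
  have hV : ∀ s, HasDerivAt (fun s => Real.exp (s ^ 2 / 2) * U s)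
      (Real.exp (s ^ 2 / 2) * (s * U s - ∫ ω, F ω * Real.sin (s * F ω + a) ∂P)) s := by
    intro s
    have h1 : HasDerivAt (fun s : ℝ => s ^ 2 / 2) s s := by
      exact ((hasDerivAt_pow 2 s).div_const 2).congr_deriv (by simp)
    convert! h1.exp.mul (hderiv s) using 1
    ring
  have hε0 : 0 ≤ ε := integral_nonneg fun ω => abs_nonneg _
  have key := (convex_uIcc 0 t).norm_image_sub_le_of_norm_hasDerivWithin_le
    (f := fun s => Real.exp (s ^ 2 / 2) * U s) (C := Real.exp (t ^ 2 / 2) * (|t| * ε))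
    (x := 0) (y := t)
    (fun s _ => (hV s).hasDerivWithinAt) (fun s hs => ?_) Set.left_mem_uIcc Set.right_mem_uIcc
  · have hU0 : U 0 = Real.cos a := by simp [hU]
    rw [hU0] at key
    simp only [ne_eq, OfNat.ofNat_ne_zero, not_false_eq_true, zero_pow, zero_div, Real.exp_zero,
      one_mul, sub_zero, Real.norm_eq_abs] at key
    refine key.trans (le_of_eq ?_)
    rw [← sq_abs t]; ring
  · have hst : |s| ≤ |t| := by
      rcases Set.mem_uIcc.1 hs with h | h
      · exact abs_le_abs_of_nonneg h.1 h.2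
      · exact abs_le_abs_of_nonpos h.2 h.1
    rw [norm_mul, Real.norm_of_nonneg (Real.exp_pos _).le]
    have : s ^ 2 ≤ t ^ 2 := sq_le_sq.2 hst
    refine mul_le_mul (Real.exp_le_exp.2 (by linarith)) ((hbound s).trans ?_) (norm_nonneg _)
      (Real.exp_pos _).le
    gcongr

theorem tendstoInDistribution_of_stein {F Γ : ℕ → Ω → ℝ} (hF : ∀ k, Integrable (F k) P)
    (hΓ : ∀ k, Integrable (Γ k) P)
    (hS : ∀ (k : ℕ) (t a : ℝ), ∫ ω, F k ω * Real.sin (t * F k ω + a) ∂P =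
      t * ∫ ω, Γ k ω * Real.cos (t * F k ω + a) ∂P)
    (hlim : Tendsto (fun k => ∫ ω, |Γ k ω - 1| ∂P) atTop (𝓝 0)) :
    TendstoInDistribution F atTop (id : ℝ → ℝ) (fun _ => P) (gaussianReal 0 1) where
  forall_aemeasurable k := (hF k).aemeasurable
  tendsto := by
    refine ProbabilityMeasure.tendsto_iff_tendsto_charFun.2 fun t => ?_
    have hcos : ∀ a : ℝ, Tendsto (fun k => ∫ ω, Real.cos (t * F k ω + a) ∂P) atTop
        (𝓝 (Real.exp (-(t ^ 2 / 2)) * Real.cos a)) := by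
      intro a
      have h1 : Tendsto (fun k => Real.exp (t ^ 2 / 2) * ∫ ω, Real.cos (t * F k ω + a) ∂P) atTop
          (𝓝 (Real.cos a)) := by
        rw [tendsto_iff_norm_sub_tendsto_zero]
        have h2 := hlim.const_mul (t ^ 2 * Real.exp (t ^ 2 / 2))
        rw [mul_zero] at h2
        exact squeeze_zero (fun k => norm_nonneg _)
          (fun k => abs_integral_cos_sub_le (hF k) (hΓ k) (hS k) t a) h2
      refine (h1.const_mul (Real.exp (-(t ^ 2 / 2)))).congr fun k => ?_
      rw [← mul_assoc, ← Real.exp_add]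
      simp
    have hchar : ∀ k, charFun (P.map (F k)) t =
        ((∫ ω, Real.cos (t * F k ω + 0) ∂P : ℝ) : ℂ) +
        ((∫ ω, Real.cos (t * F k ω + -(Real.pi / 2)) ∂P : ℝ) : ℂ) * Complex.I := by
      intro k
      have hc : Continuous fun x : ℝ => Complex.exp (t * x * Complex.I) := by fun_prop
      rw [charFun_apply_real, integral_map (hF k).1.aemeasurable hc.aestronglyMeasurable]
      have hi : Integrable (fun ω => Complex.exp (t * F k ω * Complex.I)) P :=
        (integrable_const (1 : ℝ)).mono' (hc.comp_aestronglyMeasurable (hF k).1)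
          (ae_of_all _ fun ω => by
            rw [← Complex.ofReal_mul, Complex.norm_exp_ofReal_mul_I])
      rw [← integral_re_add_im hi]
      have e1 : ∀ ω, RCLike.re (Complex.exp (t * F k ω * Complex.I)) =
          Real.cos (t * F k ω + 0) := fun ω => by
        rw [← Complex.ofReal_mul, add_zero]; exact Complex.exp_ofReal_mul_I_re _
      have e2 : ∀ ω, RCLike.im (Complex.exp (t * F k ω * Complex.I)) =
          Real.cos (t * F k ω + -(Real.pi / 2)) := fun ω => by
        rw [← Complex.ofReal_mul, ← sub_eq_add_neg, Real.cos_sub_pi_div_two]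
        exact Complex.exp_ofReal_mul_I_im _
      simp only [e1, e2]
      rfl
    have hg : charFun (gaussianReal 0 1) t =
        ((Real.exp (-(t ^ 2 / 2)) * Real.cos 0 : ℝ) : ℂ) +
        ((Real.exp (-(t ^ 2 / 2)) * Real.cos (-(Real.pi / 2)) : ℝ) : ℂ) * Complex.I := by
      rw [charFun_gaussianReal]
      simp
    simp only [ProbabilityMeasure.coe_mk, hchar, Measure.map_id, hg]
    exact ((Complex.continuous_ofReal.tendsto _).comp (hcos 0)).add
      (((Complex.continuous_ofReal.tendsto _).comp (hcos _)).mul_const _)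

end Stein

end WienerChaos

/-! ### The fourth moment theorem for Wick sums. -/

namespace WienerChaos

universe u v

section Moments

variable {Ω : Type v} [MeasurableSpace Ω] {P : Measure Ω}

theorem sq_integral_mul_le {f g : Ω → ℝ} (hf : MemLp f 2 P) (hg : MemLp g 2 P) :
    (∫ ω, f ω * g ω ∂P) ^ 2 ≤ (∫ ω, f ω ^ 2 ∂P) * ∫ ω, g ω ^ 2 ∂P := by
  have hfg : Integrable (fun ω => f ω * g ω) P := hf.integrable_mul hg
  have h : ∀ t : ℝ, 0 ≤ (∫ ω, f ω ^ 2 ∂P) * (t * t) + (2 * ∫ ω, f ω * g ω ∂P) * t +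
      ∫ ω, g ω ^ 2 ∂P := by
    intro t
    have e : ∫ ω, (t * f ω + g ω) ^ 2 ∂P = (∫ ω, f ω ^ 2 ∂P) * (t * t) +
        (2 * ∫ ω, f ω * g ω ∂P) * t + ∫ ω, g ω ^ 2 ∂P := by
      have i1 : Integrable (fun ω => t ^ 2 * f ω ^ 2) P := hf.integrable_sq.const_mul _
      have i2 : Integrable (fun ω => 2 * t * (f ω * g ω)) P := hfg.const_mul _
      have i3 : Integrable (fun ω => t ^ 2 * f ω ^ 2 + 2 * t * (f ω * g ω)) P := i1.add i2
      have : ∀ ω, (t * f ω + g ω) ^ 2 = t ^ 2 * f ω ^ 2 + 2 * t * (f ω * g ω) + g ω ^ 2 :=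
        fun ω => by ring
      simp_rw [this]
      rw [integral_add i3 hg.integrable_sq, integral_add i1 i2, integral_const_mul,
        integral_const_mul]
      ring
    rw [← e]
    exact integral_nonneg fun ω => sq_nonneg _
  have := discrim_le_zero h
  rw [discrim] at this
  nlinarith

theorem integral_sq_gaussianReal : ∫ x, x ^ 2 ∂(gaussianReal 0 1) = 1 := by
  have h : (fun x : ℝ => x).HasTemperateGrowth := by fun_prop
  have := integral_deriv_gaussianReal h
  simp only [deriv_id'', integral_const, probReal_univ, smul_eq_mul, mul_one] at this
  simp only [sq]
  exact this.symm

theorem integral_pow_four_gaussianReal : ∫ x, x ^ 4 ∂(gaussianReal 0 1) = 3 := by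
  have h : (fun x : ℝ => x ^ 3).HasTemperateGrowth := by fun_prop
  have := integral_deriv_gaussianReal h
  simp only [deriv_pow_field] at this
  rw [integral_const_mul] at this
  norm_num [integral_sq_gaussianReal] at this
  rw [this]
  exact integral_congr_ae (ae_of_all _ fun x => by ring)

/-- Weak convergence applies to the bounded continuous function `min(x⁴, M)`; the excess is at most
`x⁸ / M`, and `M` is chosen so that its mean is at most `ε / 2`. An upper bound suffices, since the
fourth cumulant is nonnegative. -/
theorem eventually_integral_pow_four_lt [IsProbabilityMeasure P] {F : ℕ → Ω → ℝ} {C : ℝ}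
    (h8 : ∀ k, MemLp (F k) 8 P)
    (hC : ∀ k, ∫ ω, F k ω ^ 8 ∂P ≤ C)
    (hF : TendstoInDistribution F atTop (id : ℝ → ℝ) (fun _ => P) (gaussianReal 0 1))
    {ε : ℝ} (hε : 0 < ε) : ∀ᶠ k in atTop, ∫ ω, F k ω ^ 4 ∂P < 3 + ε := by
  set M : ℝ := 2 * (|C| + 1) / ε with hM
  have hM0 : 0 < M := by positivity
  have hb : ∀ x : ℝ, ‖min (x ^ 4) M‖ ≤ M := fun x => by
    rw [Real.norm_of_nonneg (le_min (by positivity) hM0.le)]; exact min_le_right _ _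
  have hcont : Continuous fun x : ℝ => min (x ^ 4) M := by fun_prop
  set f : BoundedContinuousFunction ℝ ℝ :=
    BoundedContinuousFunction.ofNormedAddCommGroup _ hcont M hb
  have h1 := (ProbabilityMeasure.tendsto_iff_forall_integral_tendsto.1 hF.tendsto) f
  have hi4 : Integrable (fun x : ℝ => x ^ 4) (gaussianReal 0 1) := by
    have := (memLp_id_gaussianReal' (μ := 0) (v := 1) 4 (by simp)).integrable_norm_pow (by simp)
    refine this.congr (ae_of_all _ fun x => ?_)
    simp only [id, Real.norm_eq_abs]
    exact (even_two_mul 2).pow_abs x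
  have h2 : ∫ x, f x ∂(gaussianReal 0 1) ≤ 3 := by
    rw [← integral_pow_four_gaussianReal]
    exact integral_mono ((integrable_const M).mono' hcont.aestronglyMeasurable
      (ae_of_all _ hb)) hi4 fun x => min_le_left _ _
  have e0 : ∀ k, ∫ x, f x ∂(P.map (F k)) = ∫ ω, min (F k ω ^ 4) M ∂P := fun k =>
    integral_map (h8 k).1.aemeasurable hcont.aestronglyMeasurable
  simp only [ProbabilityMeasure.coe_mk, e0, Measure.map_id] at h1
  filter_upwards [h1.eventually (gt_mem_nhds (lt_of_le_of_lt h2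
    (show (3 : ℝ) < 3 + ε / 2 by linarith)))] with k hk
  have i8 : Integrable (fun ω => F k ω ^ 8) P := by
    refine ((h8 k).integrable_norm_pow (by simp)).congr (ae_of_all _ fun x => ?_)
    simp only [Real.norm_eq_abs]
    exact (even_two_mul 4).pow_abs _
  have imin : Integrable (fun ω => min (F k ω ^ 4) M) P :=
    (integrable_const M).mono' (hcont.comp_aestronglyMeasurable (h8 k).1)
      (ae_of_all _ fun ω => hb _)
  have hpt : ∀ ω, F k ω ^ 4 ≤ min (F k ω ^ 4) M + F k ω ^ 8 / M := by
    intro ω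
    have h80 : 0 ≤ F k ω ^ 8 / M := by positivity
    rcases le_total (F k ω ^ 4) M with h | h
    · rw [min_eq_left h]; linarith
    · have : F k ω ^ 4 ≤ F k ω ^ 8 / M := by
        rw [le_div_iff₀ hM0, show F k ω ^ 8 = F k ω ^ 4 * F k ω ^ 4 by ring]
        exact mul_le_mul_of_nonneg_left h (by positivity)
      have : 0 ≤ min (F k ω ^ 4) M := le_min (by positivity) hM0.le
      linarith
  calc ∫ ω, F k ω ^ 4 ∂P ≤ ∫ ω, (min (F k ω ^ 4) M + F k ω ^ 8 / M) ∂P :=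
        integral_mono_of_nonneg (ae_of_all _ fun ω => by positivity)
          (imin.add (i8.div_const M)) (ae_of_all _ hpt)
    _ = ∫ ω, min (F k ω ^ 4) M ∂P + (∫ ω, F k ω ^ 8 ∂P) / M := by
        rw [integral_add imin (i8.div_const M), integral_div]
    _ < 3 + ε / 2 + ε / 2 := by
        refine add_lt_add_of_lt_of_le hk ?_
        rw [div_le_iff₀ hM0, hM]
        have : ε / 2 * (2 * (|C| + 1) / ε) = |C| + 1 := by field_simp
        rw [this]
        linarith [hC k, le_abs_self C]
    _ = 3 + ε := by ring

end Moments

namespace IsIsonormal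

variable {H : Type u} {Ω : Type v} [NormedAddCommGroup H] [InnerProductSpace ℝ H]
  [CompleteSpace H] [MeasurableSpace Ω] {P : Measure Ω} [IsProbabilityMeasure P]
  {X : H → Ω → ℝ} (hX : IsIsonormal X P) {q : ℕ} {c : ℕ → H →₀ ℝ} (hc : ∀ k, IsSpherical (c k))
  (hvar : Tendsto (fun k => ∫ ω, wickVal X q (c k) ω ^ 2 ∂P) atTop (𝓝 1))

include hX hc hvar

/-- Fourth moment theorem, necessity of the vanishing of the second derivative. -/
theorem tendsto_integral_norm_toOp (hq : 0 < q)
    (hlaw : TendstoInDistribution (fun k => wickVal X q (c k)) atTop (id : ℝ → ℝ) (fun _ => P)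
      (gaussianReal 0 1)) :
    Tendsto (fun k => ∫ ω, ‖toOp (wickDeriv₂ X q (c k) ω)‖ ^ 4 ∂P) atTop (𝓝 0) := by
  obtain ⟨B, hB⟩ := hvar.bddAbove_range
  have hB' : ∀ k, ∫ ω, wickVal X q (c k) ω ^ 2 ∂P ≤ B := fun k => hB ⟨k, rfl⟩
  have h8 : ∀ k, ∫ ω, wickVal X q (c k) ω ^ 8 ∂P ≤ GaussPoly.hyperConst₈ q * B ^ 4 := fun k =>
    (hX.integral_wickVal_pow_eight_le q (hc k)).trans (mul_le_mul_of_nonneg_left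
      (pow_le_pow_left₀ (integral_nonneg fun ω => sq_nonneg _) (hB' k) 4)
      (GaussPoly.hyperConst₈_nonneg q))
  set K : ℝ := (2 * q : ℕ) * 4 ^ (2 * q) * (q.factorial : ℝ) ^ 4 with hK
  have hK0 : 0 < K := by positivity
  refine squeeze_zero' (Eventually.of_forall fun k => integral_nonneg fun ω => by positivity)
    (Eventually.of_forall fun k => hX.integral_norm_toOp_wickDeriv₂_le q (hc k) hq) ?_
  -- The cumulant is nonnegative because a positive multiple of it dominates a nonnegative integral.
  have hlow : ∀ k, 0 ≤ ∫ ω, wickVal X q (c k) ω ^ 4 ∂P -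
      3 * (∫ ω, wickVal X q (c k) ω ^ 2 ∂P) ^ 2 := fun k =>
    nonneg_of_mul_nonneg_right ((integral_nonneg fun ω => by positivity).trans
      (hX.integral_norm_toOp_wickDeriv₂_le q (hc k) hq)) hK0
  have hlim : Tendsto (fun k => ∫ ω, wickVal X q (c k) ω ^ 4 ∂P -
      3 * (∫ ω, wickVal X q (c k) ω ^ 2 ∂P) ^ 2) atTop (𝓝 0) := by
    refine tendsto_order.2 ⟨fun a ha => Eventually.of_forall fun k => ha.trans_le (hlow k),
      fun ε hε => ?_⟩
    have h2 : Tendsto (fun k => 3 * (∫ ω, wickVal X q (c k) ω ^ 2 ∂P) ^ 2) atTop (𝓝 3) := by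
      simpa using (hvar.pow 2).const_mul 3
    filter_upwards [eventually_integral_pow_four_lt
      (fun k => (hX.memLp_wick q (hc k) (by simp)).1) h8 hlaw (half_pos hε),
      h2.eventually (lt_mem_nhds (show 3 - ε / 2 < 3 by linarith))] with k h3 h4
    linarith
  rw [← mul_zero K]
  exact hlim.const_mul K

/-- Fourth moment theorem, sufficiency of the vanishing of the second derivative. -/
theorem tendstoInDistribution_wickVal (hq : 2 ≤ q)
    (hop : Tendsto (fun k => ∫ ω, ‖toOp (wickDeriv₂ X q (c k) ω)‖ ^ 4 ∂P) atTop (𝓝 0)) :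
    TendstoInDistribution (fun k => wickVal X q (c k)) atTop (id : ℝ → ℝ) (fun _ => P)
      (gaussianReal 0 1) := by
  have hq0 : (0 : ℝ) < q := by positivity
  have hΓ4 := fun k => (hX.memLp_wick q (hc k) (p := 4) (by simp)).2.1
  have hop4 := fun k => hX.memLp_norm_toOp_wickDeriv₂ q (hc k) (p := 4) (by simp)
  have sq_memLp : ∀ {E : Type u} [NormedAddCommGroup E] {f : Ω → E}, MemLp f 4 P →
      MemLp (fun ω => ‖f ω‖ ^ 2) 2 P := by
    intro E _ f hf
    refine (memLp_two_iff_integrable_sq (f := fun ω => ‖f ω‖ ^ 2) (hf.1.norm.pow 2)).2 ?_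
    simp only [← pow_mul]
    exact hf.integrable_norm_pow (by simp)
  have hΓ2 := fun k => sq_memLp (hΓ4 k)
  have hΓ1 := fun k => (hΓ2 k).integrable (by simp)
  refine tendstoInDistribution_of_stein
    (Γ := fun k ω => (q : ℝ)⁻¹ * ‖wickDeriv₁ X q (c k) ω‖ ^ 2)
    (fun k => (hX.memLp_wick q (hc k) (p := 2) (by simp)).1.integrable (by simp))
    (fun k => (hΓ1 k).const_mul _) (fun k t a => ?_) ?_
  · have := hX.integral_wickVal_mul_sin q (hc k) t a
    simp_rw [mul_assoc]
    rw [integral_const_mul, mul_left_comm, ← this, inv_mul_cancel_left₀ hq0.ne']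
  · set m := fun k => ∫ ω, wickVal X q (c k) ω ^ 2 ∂P with hm
    -- The second order Poincaré inequality and Cauchy-Schwarz bound the variance of `‖DF‖²` by `4
    -- √(E‖D²F‖_op⁴ · E‖DF‖⁴)`, whose last factor stays bounded by hypercontractivity.
    have hA : Tendsto (fun k => ∫ ω, (‖wickDeriv₁ X q (c k) ω‖ ^ 2 - q * m k) ^ 2 ∂P) atTop
        (𝓝 0) := by
      have h0 : Tendsto (fun k => 4 * √((∫ ω, ‖toOp (wickDeriv₂ X q (c k) ω)‖ ^ 4 ∂P) *
          (GaussPoly.hyperConst₄ (q - 1) * (q * m k) ^ 2))) atTop (𝓝 0) := by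
        have := (hop.mul (((hvar.const_mul (q : ℝ)).pow 2).const_mul
          (GaussPoly.hyperConst₄ (q - 1)))).sqrt.const_mul 4
        simpa using this
      refine squeeze_zero (fun k => integral_nonneg fun ω => sq_nonneg _) (fun k => ?_) h0
      refine (hX.integral_sq_norm_wickDeriv₁_sub_le q (hc k)).trans
        (mul_le_mul_of_nonneg_left (Real.le_sqrt_of_sq_le ?_) (by norm_num))
      have h1 : MemLp (fun ω => ‖toOp (wickDeriv₂ X q (c k) ω)‖ ^ 2) 2 P := sq_memLp (hop4 k)
      refine (sq_integral_mul_le h1 (hΓ2 k)).trans ?_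
      simp only [← pow_mul]
      exact mul_le_mul_of_nonneg_left (hX.integral_norm_wickDeriv₁_pow_four_le q (hc k) hq)
        (integral_nonneg fun ω => by positivity)
    have hB : Tendsto (fun k => (q : ℝ)⁻¹ * √(∫ ω, (‖wickDeriv₁ X q (c k) ω‖ ^ 2 - q * m k) ^ 2 ∂P)
        + |m k - 1|) atTop (𝓝 0) := by
      have := (hA.sqrt.const_mul (q : ℝ)⁻¹).add (hvar.sub_const 1).abs
      simpa using this
    refine squeeze_zero (fun k => integral_nonneg fun ω => abs_nonneg _) (fun k => ?_) hB
    have h1 : MemLp (fun ω => |‖wickDeriv₁ X q (c k) ω‖ ^ 2 - q * m k|) 2 P :=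
      ((hΓ2 k).sub (memLp_const _)).norm
    have h2 : ∫ ω, |‖wickDeriv₁ X q (c k) ω‖ ^ 2 - q * m k| ∂P ≤
        √(∫ ω, (‖wickDeriv₁ X q (c k) ω‖ ^ 2 - q * m k) ^ 2 ∂P) := by
      refine Real.le_sqrt_of_sq_le ?_
      simpa using sq_integral_mul_le h1 (memLp_const (1 : ℝ))
    have i1 : Integrable (fun ω => |‖wickDeriv₁ X q (c k) ω‖ ^ 2 - q * m k|) P :=
      h1.integrable (by simp)
    calc ∫ ω, |(q : ℝ)⁻¹ * ‖wickDeriv₁ X q (c k) ω‖ ^ 2 - 1| ∂P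
        ≤ ∫ ω, ((q : ℝ)⁻¹ * |‖wickDeriv₁ X q (c k) ω‖ ^ 2 - q * m k| + |m k - 1|) ∂P := by
          refine integral_mono_of_nonneg (ae_of_all _ fun ω => abs_nonneg _)
            ((i1.const_mul _).add (integrable_const _)) (ae_of_all _ fun ω => ?_)
          dsimp only
          rw [← abs_of_pos (inv_pos.2 hq0), ← abs_mul, abs_of_pos (inv_pos.2 hq0)]
          refine le_trans (le_of_eq ?_) (abs_add_le _ _)
          congr 1
          field_simp
          ring
      _ = (q : ℝ)⁻¹ * ∫ ω, |‖wickDeriv₁ X q (c k) ω‖ ^ 2 - q * m k| ∂P + |m k - 1| := by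
          rw [integral_add (i1.const_mul _) (integrable_const _), integral_const_mul]
          simp
      _ ≤ _ := by gcongr

end IsIsonormal

end WienerChaos

/-! ### Cutoffs and Malliavin differentiability of Wick sums. -/

namespace WienerChaos

universe u v

section Pderiv

variable {n : ℕ}

theorem hasTemperateGrowth_pderiv {g : (Fin n → ℝ) → ℝ} (hg : g.HasTemperateGrowth) (i : Fin n) :
    (pderiv i g).HasTemperateGrowth :=
  hasTemperateGrowth_fderiv_apply hg _

theorem pderiv_fun_mul {f g : (Fin n → ℝ) → ℝ} (hf : Differentiable ℝ f) (hg : Differentiable ℝ g)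
    (i : Fin n) : pderiv i (fun x => f x * g x) = fun x => f x * pderiv i g x + pderiv i f x * g x := by
  ext x
  simp only [pderiv, ((hf x).hasFDerivAt.fun_mul (hg x).hasFDerivAt).fderiv, add_apply,
    smul_apply, smul_eq_mul]
  ring

theorem pderiv_fun_add {f g : (Fin n → ℝ) → ℝ} (hf : Differentiable ℝ f) (hg : Differentiable ℝ g)
    (i : Fin n) : pderiv i (fun x => f x + g x) = fun x => pderiv i f x + pderiv i g x := by
  ext x
  simp only [pderiv, ((hf x).hasFDerivAt.fun_add (hg x).hasFDerivAt).fderiv, add_apply]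

theorem pderiv_const_mul {f : (Fin n → ℝ) → ℝ} (hf : Differentiable ℝ f) (r : ℝ)
    (i : Fin n) : pderiv i (fun x => r * f x) = fun x => r * pderiv i f x := by
  ext x
  simp only [pderiv, ((hf x).hasFDerivAt.const_mul r).fderiv, smul_apply, smul_eq_mul]

theorem pderiv_comp_const_smul {f : (Fin n → ℝ) → ℝ} (hf : Differentiable ℝ f) (r : ℝ)
    (i : Fin n) : pderiv i (fun x => f (r • x)) = fun x => r * pderiv i f (r • x) := by
  ext x
  have h1 : HasFDerivAt (fun x : Fin n → ℝ => r • x) (r • ContinuousLinearMap.id ℝ _) x :=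
    (hasFDerivAt_id x).const_smul r
  have h2 := (hf (r • x)).hasFDerivAt.comp x h1
  simp only [pderiv]
  rw [show (fun x => f (r • x)) = f ∘ fun x => r • x from rfl, h2.fderiv]
  simp

theorem differentiable_pderiv {f : (Fin n → ℝ) → ℝ} (hf : ContDiff ℝ ((⊤ : ℕ∞) : WithTop ℕ∞) f)
    (i : Fin n) : ContDiff ℝ ((⊤ : ℕ∞) : WithTop ℕ∞) (pderiv i f) :=
  (hf.fderiv_right (m := ((⊤ : ℕ∞) : WithTop ℕ∞)) (by simp)).clm_apply contDiff_const

theorem hasCompactSupport_pderiv {f : (Fin n → ℝ) → ℝ} (hf : HasCompactSupport f) (i : Fin n) :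
    HasCompactSupport (pderiv i f) :=
  hf.fderiv_apply (𝕜 := ℝ) _

theorem pderiv_congr {f g : (Fin n → ℝ) → ℝ} {x : Fin n → ℝ} (h : f =ᶠ[𝓝 x] g) (i : Fin n) :
    pderiv i f =ᶠ[𝓝 x] pderiv i g :=
  (h.fderiv (𝕜 := ℝ)).mono fun y hy => by simp only [pderiv, hy]

/-- Smooth cutoff functions with uniformly bounded derivatives. -/
theorem exists_cutoff (n : ℕ) : ∃ (χ : ℕ → (Fin n → ℝ) → ℝ) (C : ℝ), 1 ≤ C ∧
    (∀ m, ContDiff ℝ ((⊤ : ℕ∞) : WithTop ℕ∞) (χ m)) ∧ (∀ m, HasCompactSupport (χ m)) ∧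
    (∀ x, ∀ᶠ m in atTop, χ m =ᶠ[𝓝 x] fun _ => 1) ∧ (∀ m x, |χ m x| ≤ C) ∧
    (∀ m i x, |pderiv i (χ m) x| ≤ C) ∧ ∀ m i j x, |pderiv i (pderiv j (χ m)) x| ≤ C := by
  let f : ContDiffBump (0 : Fin n → ℝ) := ⟨1, 2, one_pos, one_lt_two⟩
  have hf : ContDiff ℝ ((⊤ : ℕ∞) : WithTop ℕ∞) (f : (Fin n → ℝ) → ℝ) := f.contDiff
  have hd : Differentiable ℝ (f : (Fin n → ℝ) → ℝ) := hf.differentiable (by simp)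
  have hdd := fun j => (differentiable_pderiv hf j).differentiable (by simp)
  have hb : ∀ {h : (Fin n → ℝ) → ℝ}, Continuous h → HasCompactSupport h → ∃ C, ∀ x, |h x| ≤ C := by
    intro h hc hs
    exact hs.exists_bound_of_continuous hc
  choose C₁ hC₁ using fun i => hb (differentiable_pderiv hf i).continuous
    (hasCompactSupport_pderiv f.hasCompactSupport i)
  choose C₂ hC₂ using fun z : Fin n × Fin n => hb
    (differentiable_pderiv (differentiable_pderiv hf z.2) z.1).continuous
    (hasCompactSupport_pderiv (hasCompactSupport_pderiv f.hasCompactSupport z.2) z.1)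
  -- Dilations of a single bump function: each derivative brings a factor `r m ≤ 1`, so the bounds
  -- are uniform in `m`, while near any fixed point the dilated bump is eventually `1`.
  set r : ℕ → ℝ := fun m => ((m : ℝ) + 1)⁻¹ with hr
  have hr0 : ∀ m, 0 < r m := fun m => by positivity
  have hr1 : ∀ m, r m ≤ 1 := fun m => inv_le_one_of_one_le₀ (by simp)
  have e1 : ∀ m i, pderiv i (fun x => f (r m • x)) = fun x => r m * pderiv i f (r m • x) :=
    fun m i => pderiv_comp_const_smul hd _ i
  have e2 : ∀ m i j, pderiv i (pderiv j (fun x => f (r m • x))) =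
      fun x => r m * (r m * pderiv i (pderiv j f) (r m • x)) := by
    intro m i j
    have h : Differentiable ℝ fun x => pderiv j f (r m • x) :=
      (hdd j).comp (by fun_prop : Differentiable ℝ fun x => r m • x)
    rw [e1, pderiv_const_mul h, pderiv_comp_const_smul (hdd j)]
  have hC₁0 : ∀ i, 0 ≤ C₁ i := fun i => (abs_nonneg _).trans (hC₁ i 0)
  have hC₂0 : ∀ i, 0 ≤ C₂ i := fun i => (abs_nonneg _).trans (hC₂ i 0)
  have hle : ∀ m (y B : ℝ), |y| ≤ B → |r m * y| ≤ B := fun m y B h => by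
    rw [abs_mul, abs_of_pos (hr0 m)]
    exact (mul_le_of_le_one_left (abs_nonneg _) (hr1 m)).trans h
  have hs1 : ∀ i, C₁ i ≤ ∑ i, C₁ i := fun i =>
    Finset.single_le_sum (fun j _ => hC₁0 j) (Finset.mem_univ i)
  have hs2 : ∀ i, C₂ i ≤ ∑ i, C₂ i := fun i =>
    Finset.single_le_sum (fun j _ => hC₂0 j) (Finset.mem_univ i)
  have hS1 : 0 ≤ ∑ i, C₁ i := Finset.sum_nonneg fun i _ => hC₁0 i
  have hS2 : 0 ≤ ∑ i, C₂ i := Finset.sum_nonneg fun i _ => hC₂0 i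
  refine ⟨fun m x => f (r m • x), 1 + ∑ i, C₁ i + ∑ z, C₂ z, by linarith, fun m => ?_, fun m => ?_,
    fun x => ?_, fun m x => ?_, fun m i x => ?_, fun m i j x => ?_⟩
  · exact hf.comp (contDiff_const_smul _)
  · exact f.hasCompactSupport.comp_homeomorph (Homeomorph.smulOfNeZero (r m) (hr0 m).ne')
  · obtain ⟨N, hN⟩ := exists_nat_gt ‖x‖
    filter_upwards [eventually_ge_atTop N] with m hm
    have : ∀ᶠ y in 𝓝 x, ‖y‖ < N := continuous_norm.continuousAt.eventually (gt_mem_nhds hN)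
    filter_upwards [this] with y hy
    refine f.one_of_mem_closedBall ?_
    rw [mem_closedBall_zero_iff, norm_smul, Real.norm_of_nonneg (hr0 m).le, hr]
    refine inv_mul_le_one_of_le₀ ?_ (by positivity)
    have : (N : ℝ) ≤ m := by exact_mod_cast hm
    linarith
  · rw [abs_of_nonneg f.nonneg]
    have := f.le_one (x := r m • x)
    linarith
  · rw [e1]
    exact (hle m _ _ (hC₁ i _)).trans (by linarith [hs1 i])
  · rw [e2]
    exact (hle m _ _ (hle m _ _ (hC₂ (i, j) _))).trans (by linarith [hs2 (i, j)])

end Pderiv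

section DCT

variable {Ω : Type v} [MeasurableSpace Ω] {P : Measure Ω} {E : Type u} [NormedAddCommGroup E]

theorem tendsto_eLpNorm_of_dominated {f : ℕ → Ω → E} {B : Ω → ℝ} {p : ℝ≥0∞} (hp0 : p ≠ 0)
    (hp : p ≠ ∞) (hf : ∀ m, AEStronglyMeasurable (f m) P) (hB : MemLp B p P)
    (hle : ∀ m ω, ‖f m ω‖ ≤ B ω) (hlim : ∀ ω, Tendsto (fun m => f m ω) atTop (𝓝 0)) :
    Tendsto (fun m => eLpNorm (f m) p P) atTop (𝓝 0) := by
  have hpos := ENNReal.toReal_pos hp0 hp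
  have h1 : Tendsto (fun m => ∫⁻ ω, ‖f m ω‖ₑ ^ p.toReal ∂P) atTop (𝓝 (∫⁻ _, 0 ∂P)) := by
    refine tendsto_lintegral_of_dominated_convergence' (fun ω => ‖B ω‖ₑ ^ p.toReal)
      (fun m => (hf m).enorm.pow_const _) (fun m => ae_of_all _ fun ω => ?_) ?_
      (ae_of_all _ fun ω => ?_)
    · refine ENNReal.rpow_le_rpow ?_ hpos.le
      exact enorm_le_iff_norm_le.2 ((hle m ω).trans (Real.le_norm_self _))
    · exact (lintegral_rpow_enorm_lt_top_of_eLpNorm_lt_top hp0 hp hB.2).ne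
    · have := ((hlim ω).enorm).ennrpow_const p.toReal
      simpa [hpos] using this
  rw [lintegral_zero] at h1
  have h2 := h1.ennrpow_const (1 / p.toReal)
  rw [ENNReal.zero_rpow_of_pos (by positivity)] at h2
  exact h2.congr fun m => (eLpNorm_eq_lintegral_rpow_enorm_toReal hp0 hp).symm

end DCT

end WienerChaos

namespace WienerChaos

open GaussPoly
open MvPolynomial (eval)

universe u v

variable {H : Type u} {Ω : Type v} [NormedAddCommGroup H] [InnerProductSpace ℝ H]
  [MeasurableSpace Ω] {P : Measure Ω} {X : H → Ω → ℝ} {p : ℝ≥0∞}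

theorem IsMalliavinTwice.congr {F F' : Ω → ℝ} {D₁ D₁' : Ω → H} {D₂ D₂' : Ω → HilbertTensor H H}
    (h : IsMalliavinTwice X P p F D₁ D₂) (hF : F =ᵐ[P] F') (h₁ : D₁ =ᵐ[P] D₁')
    (h₂ : D₂ =ᵐ[P] D₂') : IsMalliavinTwice X P p F' D₁' D₂' := by
  obtain ⟨m0, m1, m2, S, t0, t1, t2⟩ := h
  refine ⟨m0.ae_eq hF, m1.ae_eq h₁, m2.ae_eq h₂, S, t0.congr fun m => ?_, t1.congr fun m => ?_,
    t2.congr fun m => ?_⟩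
  · exact eLpNorm_congr_ae (hF.mono fun ω hω => by simp only [hω])
  · exact eLpNorm_congr_ae (h₁.mono fun ω hω => by simp only [hω])
  · exact eLpNorm_congr_ae (h₂.mono fun ω hω => by simp only [hω])

variable [IsProbabilityMeasure P]

/-- Smooth functions of temperate growth of finitely many Gaussian variables are twice Malliavin
differentiable. -/
theorem IsIsonormal.isMalliavinTwice_comp (hX : IsIsonormal X P) {n : ℕ} (hn : 0 < n)
    (φ : Fin n → H) {g : (Fin n → ℝ) → ℝ} (hg : g.HasTemperateGrowth) (hp0 : p ≠ 0) (hp : p ≠ ∞) :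
    IsMalliavinTwice X P p (fun ω => g fun k => X (φ k) ω)
      (fun ω => ∑ i, pderiv i g (fun k => X (φ k) ω) • φ i)
      (fun ω => ∑ i, ∑ j, pderiv i (pderiv j g) (fun k => X (φ k) ω) • tmulL H H (φ i) (φ j)) := by
  set Y : Ω → Fin n → ℝ := fun ω k => X (φ k) ω with hY
  have hYm : AEStronglyMeasurable Y P := (hX.memLp_pi φ (p := 1) (by simp)).1
  have hg1 := fun i => hasTemperateGrowth_pderiv hg i
  have hg2 := fun i j => hasTemperateGrowth_pderiv (hg1 j) i
  have hd : Differentiable ℝ g := hg.1.differentiable (by simp)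
  have hd1 := fun i => (hg1 i).1.differentiable (by simp)
  have mem0 : MemLp (fun ω => g (Y ω)) p P := hX.memLp_comp φ hg hp
  have mem1 : MemLp (fun ω => ∑ i, pderiv i g (Y ω) • φ i) p P :=
    hX.memLp_comp φ (g := fun x => ∑ i, pderiv i g x • φ i)
      (Function.HasTemperateGrowth.sum fun i _ => (hg1 i).fun_smul (by fun_prop)) hp
  have mem2 : MemLp (fun ω => ∑ i, ∑ j, pderiv i (pderiv j g) (Y ω) • tmulL H H (φ i) (φ j)) p P :=
    hX.memLp_comp φ (g := fun x => ∑ i, ∑ j, pderiv i (pderiv j g) x • tmulL H H (φ i) (φ j))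
      (Function.HasTemperateGrowth.sum fun i _ => Function.HasTemperateGrowth.sum fun j _ =>
        (hg2 i j).fun_smul (by fun_prop)) hp
  obtain ⟨χ, C, hC, hχs, hχc, hχ1, hb0, hb1, hb2⟩ := exists_cutoff n
  have hχd := fun m => (hχs m).differentiable (by simp)
  have hχd1 := fun m i => (differentiable_pderiv (hχs m) i).differentiable (by simp)
  have hs : ∀ m, ContDiff ℝ ((⊤ : ℕ∞) : WithTop ℕ∞) fun x => χ m x * g x := fun m =>
    (hχs m).mul hg.1
  -- One dominating function for `g` and its derivatives up to order two. By the product rule the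
  -- cut-off function and its derivatives are at most `C b`, `2 C b` and `4 C b`.
  set b : (Fin n → ℝ) → ℝ := fun x => |g x| + ∑ i, |pderiv i g x| +
    ∑ i, ∑ j, |pderiv i (pderiv j g) x| with hbdef
  have hbm : MemLp (fun ω => b (Y ω)) p P := by
    refine ((hX.memLp_comp φ hg hp).norm.add (memLp_finsetSum _ fun i _ =>
      (hX.memLp_comp φ (hg1 i) hp).norm)).add (memLp_finsetSum _ fun i _ =>
        memLp_finsetSum _ fun j _ => (hX.memLp_comp φ (hg2 i j) hp).norm)
  have hn1 : ∀ x, 0 ≤ ∑ i, |pderiv i g x| := fun x => by positivity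
  have hn2 : ∀ x, 0 ≤ ∑ i, ∑ j, |pderiv i (pderiv j g) x| := fun x => by positivity
  have hle0 : ∀ x, |g x| ≤ b x := fun x => by
    simp only [hbdef]; linarith [hn1 x, hn2 x]
  have hle1 : ∀ i x, |pderiv i g x| ≤ b x := fun i x => by
    have := Finset.single_le_sum (f := fun i => |pderiv i g x|) (fun j _ => abs_nonneg _)
      (Finset.mem_univ i)
    simp only [hbdef]; linarith [hn2 x, abs_nonneg (g x)]
  have hle2 : ∀ i j x, |pderiv i (pderiv j g) x| ≤ b x := fun i j x => by
    have h1 := Finset.single_le_sum (f := fun i => ∑ j, |pderiv i (pderiv j g) x|)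
      (fun j _ => by positivity) (Finset.mem_univ i)
    have h2 := Finset.single_le_sum (f := fun j => |pderiv i (pderiv j g) x|)
      (fun j _ => abs_nonneg _) (Finset.mem_univ j)
    simp only [hbdef]; linarith [hn1 x, abs_nonneg (g x)]
  have hb0' : ∀ x, 0 ≤ b x := fun x => (abs_nonneg _).trans (hle0 x)
  have hmul : ∀ {r s y : ℝ}, |r| ≤ C → |s| ≤ y → |r * s| ≤ C * y := fun h1 h2 => by
    rw [abs_mul]
    exact mul_le_mul h1 h2 (abs_nonneg _) (by linarith)
  have e1 : ∀ m i, pderiv i (fun x => χ m x * g x) =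
      fun x => χ m x * pderiv i g x + pderiv i (χ m) x * g x := fun m i =>
    pderiv_fun_mul (hχd m) hd i
  have e2 : ∀ m i j, pderiv i (pderiv j (fun x => χ m x * g x)) = fun x =>
      (χ m x * pderiv i (pderiv j g) x + pderiv i (χ m) x * pderiv j g x) +
      (pderiv j (χ m) x * pderiv i g x + pderiv i (pderiv j (χ m)) x * g x) := by
    intro m i j
    rw [e1, pderiv_fun_add ((hχd m).fun_mul (hd1 j)) ((hχd1 m j).fun_mul hd),
      pderiv_fun_mul (hχd m) (hd1 j), pderiv_fun_mul (hχd1 m j) hd]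
  have B1 : ∀ m i x, |pderiv i (fun x => χ m x * g x) x| ≤ 2 * C * b x := by
    intro m i x
    rw [e1]
    refine (abs_add_le _ _).trans ?_
    linarith [hmul (hb0 m x) (hle1 i x), hmul (hb1 m i x) (hle0 x)]
  have B2 : ∀ m i j x, |pderiv i (pderiv j (fun x => χ m x * g x)) x| ≤ 4 * C * b x := by
    intro m i j x
    rw [e2]
    refine (abs_add_le _ _).trans ((add_le_add (abs_add_le _ _) (abs_add_le _ _)).trans ?_)
    linarith [hmul (hb0 m x) (hle2 i j x), hmul (hb1 m i x) (hle1 j x),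
      hmul (hb1 m j x) (hle1 i x), hmul (hb2 m i j x) (hle0 x)]
  have hev : ∀ x, ∀ᶠ m in atTop, (fun x => χ m x * g x) =ᶠ[𝓝 x] g := fun x => by
    filter_upwards [hχ1 x] with m hm
    filter_upwards [hm] with y hy
    rw [hy, one_mul]
  have hCb : ∀ x, b x ≤ C * b x := fun x => le_mul_of_one_le_left (hb0' x) hC
  let S : ℕ → Cylinder H := fun m => ⟨n, hn, φ, fun x => χ m x * g x, hs m, (hχc m).mul_right⟩
  have hS0 : ∀ m, AEStronglyMeasurable ((S m).val X) P := fun m =>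
    (hs m).continuous.comp_aestronglyMeasurable hYm
  have hS1 : ∀ m, AEStronglyMeasurable ((S m).deriv₁ X) P := fun m =>
    (continuous_finsetSum _ fun i _ => ((differentiable_pderiv (hs m) i).continuous.smul
      continuous_const) : Continuous fun x => ∑ i, pderiv i (fun x => χ m x * g x) x • φ i)
      |>.comp_aestronglyMeasurable hYm
  have hS2 : ∀ m, AEStronglyMeasurable ((S m).deriv₂ X) P := fun m =>
    (continuous_finsetSum _ fun i _ => continuous_finsetSum _ fun j _ =>
      ((differentiable_pderiv (differentiable_pderiv (hs m) j) i).continuous.smul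
      continuous_const) : Continuous fun x => ∑ i, ∑ j, pderiv i (pderiv j
        (fun x => χ m x * g x)) x • tmulL H H (φ i) (φ j)) |>.comp_aestronglyMeasurable hYm
  refine ⟨mem0, mem1, mem2, S, ?_, ?_, ?_⟩
  · refine tendsto_eLpNorm_of_dominated (B := fun ω => 2 * C * b (Y ω)) hp0 hp
      (fun m => (hS0 m).sub mem0.1) (hbm.const_mul _) (fun m ω => ?_) fun ω => ?_
    · refine (norm_sub_le _ _).trans ?_
      change |χ m (Y ω) * g (Y ω)| + |g (Y ω)| ≤ _
      linarith [hmul (hb0 m (Y ω)) (hle0 (Y ω)), hle0 (Y ω), hCb (Y ω)]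
    · refine tendsto_const_nhds.congr' ?_
      filter_upwards [hev (Y ω)] with m hm
      exact (sub_eq_zero.2 hm.eq_of_nhds).symm
  · refine tendsto_eLpNorm_of_dominated (B := fun ω => ∑ i, 3 * C * ‖φ i‖ * b (Y ω)) hp0 hp
      (fun m => (hS1 m).sub mem1.1) (memLp_finsetSum _ fun i _ => hbm.const_mul _)
      (fun m ω => ?_) fun ω => ?_
    · change ‖∑ i, pderiv i (fun x => χ m x * g x) (Y ω) • φ i - ∑ i, pderiv i g (Y ω) • φ i‖ ≤ _
      rw [← Finset.sum_sub_distrib]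
      refine (norm_sum_le _ _).trans (Finset.sum_le_sum fun i _ => ?_)
      rw [← sub_smul, norm_smul, mul_right_comm]
      refine mul_le_mul_of_nonneg_right ((abs_sub _ _).trans ?_) (norm_nonneg _)
      linarith [B1 m i (Y ω), hle1 i (Y ω), hCb (Y ω)]
    · refine tendsto_const_nhds.congr' ?_
      filter_upwards [hev (Y ω)] with m hm
      refine (sub_eq_zero.2 (Finset.sum_congr rfl fun i _ => ?_)).symm
      exact congrArg (· • φ i) (pderiv_congr hm i).eq_of_nhds
  · refine tendsto_eLpNorm_of_dominated
      (B := fun ω => ∑ i, ∑ j, 5 * C * ‖tmulL H H (φ i) (φ j)‖ * b (Y ω)) hp0 hp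
      (fun m => (hS2 m).sub mem2.1)
      (memLp_finsetSum _ fun i _ => memLp_finsetSum _ fun j _ => hbm.const_mul _)
      (fun m ω => ?_) fun ω => ?_
    · change ‖∑ i, ∑ j, pderiv i (pderiv j (fun x => χ m x * g x)) (Y ω) • tmulL H H (φ i) (φ j) -
        ∑ i, ∑ j, pderiv i (pderiv j g) (Y ω) • tmulL H H (φ i) (φ j)‖ ≤ _
      rw [← Finset.sum_sub_distrib]
      refine (norm_sum_le _ _).trans (Finset.sum_le_sum fun i _ => ?_)
      rw [← Finset.sum_sub_distrib]
      refine (norm_sum_le _ _).trans (Finset.sum_le_sum fun j _ => ?_)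
      rw [← sub_smul, norm_smul, mul_right_comm]
      refine mul_le_mul_of_nonneg_right ((abs_sub _ _).trans ?_) (norm_nonneg _)
      linarith [B2 m i j (Y ω), hle2 i j (Y ω), hCb (Y ω)]
    · refine tendsto_const_nhds.congr' ?_
      filter_upwards [hev (Y ω)] with m hm
      refine (sub_eq_zero.2 (Finset.sum_congr rfl fun i _ => Finset.sum_congr rfl fun j _ =>
        ?_)).symm
      exact congrArg (· • tmulL H H (φ i) (φ j)) (pderiv_congr (pderiv_congr hm j) i).eq_of_nhds

theorem pderiv_eval {n : ℕ} (r : MvPolynomial (Fin n) ℝ) (i : Fin n) :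
    pderiv i (fun x => eval x r) = fun x => eval x (pd i r) := by
  ext x
  rw [pderiv, fderiv_eval_apply]
  simp [Pi.single_apply]

theorem IsIsonormal.isMalliavinTwice_wick (hX : IsIsonormal X P) (q : ℕ) {c : H →₀ ℝ}
    (hc : IsSpherical c) (hp0 : p ≠ 0) (hp : p ≠ ∞) :
    IsMalliavinTwice X P p (wickVal X q c) (wickDeriv₁ X q c) (wickDeriv₂ X q c) := by
  obtain ⟨d, n, e, he, c', a, h⟩ := hX.exists_coordinates q hc
  -- A cylinder must have at least one variable. When `d = 0` the Wick sum is almost surely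
  -- constant, and a constant function of the single variable `X 0` represents it.
  rcases Nat.eq_zero_or_pos d with rfl | hd
  · have h0 := hX.isMalliavinTwice_comp one_pos (fun _ => (0 : H))
      (g := fun _ => eval 0 (wickSum c' a q)) (by fun_prop) hp0 hp
    refine h0.congr (h.mono fun ω hω => ?_) (h.mono fun ω hω => ?_) (h.mono fun ω hω => ?_)
    · rw [hω.1]
      exact congrArg (fun x => eval x (wickSum c' a q)) (Subsingleton.elim _ _)
    · simp [hω.2.1]
    · simp [hω.2.2]
  · have h0 := hX.isMalliavinTwice_comp hd e (hasTemperateGrowth_eval (wickSum c' a q)) hp0 hp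
    simp only [pderiv_eval] at h0
    exact h0.congr (h.mono fun ω hω => hω.1.symm) (h.mono fun ω hω => hω.2.1.symm)
      (h.mono fun ω hω => hω.2.2.symm)

namespace Cylinder

variable (S : Cylinder H)

omit [NormedAddCommGroup H] [InnerProductSpace ℝ H] in
theorem hasTemperateGrowth : S.g.HasTemperateGrowth := by
  refine ⟨S.smooth, fun n => ?_⟩
  obtain ⟨C, hC⟩ := (S.compact.iteratedFDeriv (𝕜 := ℝ) n).exists_bound_of_continuous
    (S.smooth.continuous_iteratedFDeriv (m := n) (by exact_mod_cast le_top))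
  exact ⟨0, C, fun x => by simpa using hC x⟩

variable (hX : IsIsonormal X P)

include hX

theorem aestronglyMeasurable_val : AEStronglyMeasurable (S.val X) P :=
  (hX.memLp_comp S.φ S.hasTemperateGrowth (p := 1) (by simp)).1

theorem aestronglyMeasurable_deriv₁ : AEStronglyMeasurable (S.deriv₁ X) P :=
  (hX.memLp_comp S.φ (g := fun x => ∑ i, pderiv i S.g x • S.φ i) (p := 1)
    (Function.HasTemperateGrowth.sum fun i _ =>
      (hasTemperateGrowth_pderiv S.hasTemperateGrowth i).fun_smul (by fun_prop)) (by simp)).1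

theorem memLp_deriv₂ (hp : p ≠ ∞) : MemLp (S.deriv₂ X) p P :=
  hX.memLp_comp S.φ (g := fun x => ∑ i, ∑ j,
      pderiv i (pderiv j S.g) x • tmulL H H (S.φ i) (S.φ j))
    (Function.HasTemperateGrowth.sum fun i _ => Function.HasTemperateGrowth.sum fun j _ =>
      (hasTemperateGrowth_pderiv (hasTemperateGrowth_pderiv S.hasTemperateGrowth j) i).fun_smul
        (by fun_prop)) hp

end Cylinder

omit [IsProbabilityMeasure P] in
theorem tendsto_eLpNorm_sub_of_le_inv {E : Type*} [NormedAddCommGroup E] (hp1 : 1 ≤ p)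
    {A B : ℕ → Ω → E} {L : Ω → E} (hA : ∀ m, AEStronglyMeasurable (A m) P)
    (hB : ∀ m, AEStronglyMeasurable (B m) P) (hL : AEStronglyMeasurable L P)
    (h1 : ∀ m : ℕ, eLpNorm (fun ω => A m ω - B m ω) p P ≤ ((m : ℝ≥0∞) + 1)⁻¹)
    (h2 : Tendsto (fun m => eLpNorm (fun ω => B m ω - L ω) p P) atTop (𝓝 0)) :
    Tendsto (fun m => eLpNorm (fun ω => A m ω - L ω) p P) atTop (𝓝 0) := by
  have hinv : Tendsto (fun m : ℕ => ((m : ℝ≥0∞) + 1)⁻¹) atTop (𝓝 0) := by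
    have := (tendsto_add_atTop_iff_nat 1).2 ENNReal.tendsto_inv_nat_nhds_zero
    simpa using this
  have h3 := hinv.add h2
  rw [add_zero] at h3
  refine tendsto_of_tendsto_of_tendsto_of_le_of_le tendsto_const_nhds h3 (fun _ => zero_le)
    fun m => ?_
  have e : (fun ω => A m ω - L ω) = (fun ω => A m ω - B m ω) + fun ω => B m ω - L ω := by
    ext ω; simp
  simp only [e]
  exact (eLpNorm_add_le ((hA m).sub (hB m)) ((hB m).sub hL) hp1).trans (add_le_add (h1 m) le_rfl)

/-- The second order Malliavin derivative is a closed operator. -/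
theorem IsMalliavinTwice.of_tendsto (hX : IsIsonormal X P) (hp1 : 1 ≤ p) {F : ℕ → Ω → ℝ}
    {D₁ : ℕ → Ω → H} {D₂ : ℕ → Ω → HilbertTensor H H}
    (h : ∀ m, IsMalliavinTwice X P p (F m) (D₁ m) (D₂ m))
    {F' : Ω → ℝ} {D₁' : Ω → H} {D₂' : Ω → HilbertTensor H H} (hF' : MemLp F' p P)
    (hD₁' : MemLp D₁' p P) (hD₂' : MemLp D₂' p P)
    (t0 : Tendsto (fun m => eLpNorm (fun ω => F m ω - F' ω) p P) atTop (𝓝 0))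
    (t1 : Tendsto (fun m => eLpNorm (fun ω => D₁ m ω - D₁' ω) p P) atTop (𝓝 0))
    (t2 : Tendsto (fun m => eLpNorm (fun ω => D₂ m ω - D₂' ω) p P) atTop (𝓝 0)) :
    IsMalliavinTwice X P p F' D₁' D₂' := by
  -- A diagonal choice: for each `m`, one cylinder that is within `1/(m+1)` in all three norms.
  have hS : ∀ m : ℕ, ∃ S : Cylinder H,
      eLpNorm (fun ω => S.val X ω - F m ω) p P ≤ ((m : ℝ≥0∞) + 1)⁻¹ ∧
      eLpNorm (fun ω => S.deriv₁ X ω - D₁ m ω) p P ≤ ((m : ℝ≥0∞) + 1)⁻¹ ∧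
      eLpNorm (fun ω => S.deriv₂ X ω - D₂ m ω) p P ≤ ((m : ℝ≥0∞) + 1)⁻¹ := by
    intro m
    obtain ⟨_, _, _, S, s0, s1, s2⟩ := h m
    have hpos : (0 : ℝ≥0∞) < ((m : ℝ≥0∞) + 1)⁻¹ :=
      ENNReal.inv_pos.2 (by finiteness)
    obtain ⟨k, hk⟩ := ((s0.eventually (ge_mem_nhds hpos)).and
      ((s1.eventually (ge_mem_nhds hpos)).and (s2.eventually (ge_mem_nhds hpos)))).exists
    exact ⟨S k, hk⟩
  choose S hS0 hS1 hS2 using hS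
  exact ⟨hF', hD₁', hD₂', S,
    tendsto_eLpNorm_sub_of_le_inv hp1 (fun m => (S m).aestronglyMeasurable_val hX)
      (fun m => (h m).1.1) hF'.1 hS0 t0,
    tendsto_eLpNorm_sub_of_le_inv hp1 (fun m => (S m).aestronglyMeasurable_deriv₁ hX)
      (fun m => (h m).2.1.1) hD₁'.1 hS1 t1,
    tendsto_eLpNorm_sub_of_le_inv hp1 (fun m => ((S m).memLp_deriv₂ hX (p := 1) (by simp)).1)
      (fun m => (h m).2.2.1.1) hD₂'.1 hS2 t2⟩

end WienerChaos

/-! ### Weak formulation and uniqueness of the second Malliavin derivative. -/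

namespace WienerChaos

universe u v

theorem integrable_inner_of_memLp {Ω : Type v} [MeasurableSpace Ω] {P : Measure Ω} {E : Type*}
    [NormedAddCommGroup E] [InnerProductSpace ℝ E] {f g : Ω → E} (hf : MemLp f 2 P)
    (hg : MemLp g 2 P) : Integrable (fun ω => ⟪f ω, g ω⟫) P := by
  refine (L2.integrable_inner (𝕜 := ℝ) (hf.toLp f) (hg.toLp g)).congr ?_
  filter_upwards [hf.coeFn_toLp, hg.coeFn_toLp] with ω h1 h2
  rw [h1, h2]

theorem tendsto_integral_inner {Ω : Type v} [MeasurableSpace Ω] {P : Measure Ω} {E : Type*}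
    [NormedAddCommGroup E] [InnerProductSpace ℝ E] {A : ℕ → Ω → E} {A' B : Ω → E}
    (hA : ∀ m, MemLp (A m) 2 P) (hA' : MemLp A' 2 P) (hB : MemLp B 2 P)
    (h : Tendsto (fun m => eLpNorm (fun ω => A m ω - A' ω) 2 P) atTop (𝓝 0)) :
    Tendsto (fun m => ∫ ω, ⟪B ω, A m ω⟫ ∂P) atTop (𝓝 (∫ ω, ⟪B ω, A' ω⟫ ∂P)) := by
  have e : ∀ {f : Ω → E} (hf : MemLp f 2 P),
      ⟪hB.toLp B, hf.toLp f⟫ = ∫ ω, ⟪B ω, f ω⟫ ∂P := by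
    intro f hf
    rw [L2.inner_def]
    refine integral_congr_ae ?_
    filter_upwards [hB.coeFn_toLp, hf.coeFn_toLp] with ω h1 h2
    rw [h1, h2]
  have h1 : Tendsto (fun m => (hA m).toLp (A m)) atTop (𝓝 (hA'.toLp A')) :=
    (Lp.tendsto_Lp_iff_tendsto_eLpNorm'' _ hA _ hA').2 h
  have h2 := (tendsto_const_nhds (x := hB.toLp B)).inner (𝕜 := ℝ) h1
  simp only [e] at h2
  exact h2

/-- Derivative in the direction `u`. -/
def dirDeriv {κ : Type*} [Fintype κ] (u : κ → ℝ) (f : (κ → ℝ) → ℝ) (x : κ → ℝ) : ℝ :=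
  fderiv ℝ f x u

theorem dirDeriv_eq_sum {n : ℕ} (u : Fin n → ℝ) (f : (Fin n → ℝ) → ℝ) :
    dirDeriv u f = fun x => ∑ i, u i * pderiv i f x := by
  ext x
  rw [dirDeriv]
  conv_lhs => rw [pi_eq_sum_univ' u]
  simp [pderiv, map_sum]

theorem dirDeriv_dirDeriv {n : ℕ} (u v : Fin n → ℝ) {f : (Fin n → ℝ) → ℝ}
    (hf : f.HasTemperateGrowth) (x : Fin n → ℝ) :
    dirDeriv u (dirDeriv v f) x = ∑ i, ∑ j, pderiv i (pderiv j f) x * (u i * v j) := by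
  have hd := fun j => ((hasTemperateGrowth_pderiv hf j).1.differentiable (by simp) x).hasFDerivAt
  rw [dirDeriv_eq_sum, dirDeriv_eq_sum]
  refine Finset.sum_congr rfl fun i _ => ?_
  have : HasFDerivAt (fun x => ∑ j, v j * pderiv j f x) (∑ j, v j • fderiv ℝ (pderiv j f) x) x :=
    HasFDerivAt.fun_sum fun j _ => (hd j).const_mul (v j)
  rw [pderiv, this.fderiv, sum_apply, Finset.mul_sum]
  refine Finset.sum_congr rfl fun j _ => ?_
  rw [smul_apply, smul_eq_mul, pderiv]
  ring

theorem hasTemperateGrowth_dirDeriv {κ : Type*} [Fintype κ] (u : κ → ℝ) {f : (κ → ℝ) → ℝ}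
    (hf : f.HasTemperateGrowth) : (dirDeriv u f).HasTemperateGrowth :=
  hasTemperateGrowth_fderiv_apply hf u

variable {H : Type u} {Ω : Type v} [NormedAddCommGroup H] [InnerProductSpace ℝ H]
  [MeasurableSpace Ω] {P : Measure Ω} {X : H → Ω → ℝ} [IsProbabilityMeasure P]

namespace IsIsonormal

variable (hX : IsIsonormal X P)

include hX

/-- Integration by parts for a product. -/
theorem integral_mul_dirDeriv {κ l : Type*} [Fintype κ] [Fintype l] (φ : κ → H) (ψ : l → H) (h : H)
    {a : (κ → ℝ) → ℝ} (ha : a.HasTemperateGrowth) {b : (l → ℝ) → ℝ} (hb : b.HasTemperateGrowth) :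
    ∫ ω, b (fun k => X (ψ k) ω) * dirDeriv (fun k => ⟪φ k, h⟫) a (fun k => X (φ k) ω) ∂P =
      ∫ ω, (b (fun k => X (ψ k) ω) * X h ω -
        dirDeriv (fun k => ⟪ψ k, h⟫) b (fun k => X (ψ k) ω)) * a (fun k => X (φ k) ω) ∂P := by
  -- The two Gaussian vectors are merged into one indexed by `κ ⊕ l`, so that the product is a
  -- single function to integrate by parts.
  let L : (κ ⊕ l → ℝ) →L[ℝ] κ → ℝ := ContinuousLinearMap.pi fun k =>
    ContinuousLinearMap.proj (R := ℝ) (φ := fun _ : κ ⊕ l => ℝ) (Sum.inl k)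
  let R : (κ ⊕ l → ℝ) →L[ℝ] l → ℝ := ContinuousLinearMap.pi fun k =>
    ContinuousLinearMap.proj (R := ℝ) (φ := fun _ : κ ⊕ l => ℝ) (Sum.inr k)
  have hg : (fun x => b (R x) * a (L x)).HasTemperateGrowth :=
    (hb.comp R.hasTemperateGrowth).fun_mul (ha.comp L.hasTemperateGrowth)
  have key := hX.integral_fderiv (Sum.elim φ ψ) h hg
  have hder : ∀ x w, fderiv ℝ (fun x => b (R x) * a (L x)) x w =
      b (R x) * fderiv ℝ a (L x) (L w) + fderiv ℝ b (R x) (R w) * a (L x) := by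
    intro x w
    have h1 : HasFDerivAt (fun x => b (R x)) ((fderiv ℝ b (R x)).comp R) x :=
      ((hb.1.differentiable (by simp)) (R x)).hasFDerivAt.comp x R.hasFDerivAt
    have h2 : HasFDerivAt (fun x => a (L x)) ((fderiv ℝ a (L x)).comp L) x :=
      ((ha.1.differentiable (by simp)) (L x)).hasFDerivAt.comp x L.hasFDerivAt
    rw [(h1.fun_mul h2).fderiv]
    simp only [add_apply, smul_apply, ContinuousLinearMap.comp_apply, smul_eq_mul]
    ring
  simp only [hder] at key
  change ∫ ω, (b (fun k => X (ψ k) ω) * dirDeriv (fun k => ⟪φ k, h⟫) a (fun k => X (φ k) ω) +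
    dirDeriv (fun k => ⟪ψ k, h⟫) b (fun k => X (ψ k) ω) * a (fun k => X (φ k) ω)) ∂P =
    ∫ ω, b (fun k => X (ψ k) ω) * a (fun k => X (φ k) ω) * X h ω ∂P at key
  have m1 := hX.memLp_comp φ ha (p := 2) (by simp)
  have m2 := hX.memLp_comp φ (hasTemperateGrowth_dirDeriv (fun k => ⟪φ k, h⟫) ha) (p := 2) (by simp)
  have m3 := hX.memLp_comp ψ hb (p := 2) (by simp)
  have m4 := hX.memLp_comp ψ (hasTemperateGrowth_dirDeriv (fun k => ⟪ψ k, h⟫) hb) (p := 2) (by simp)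
  have m5 := hX.integrable_comp (fun k : (κ ⊕ l) ⊕ Unit => Sum.elim (Sum.elim φ ψ) (fun _ => h) k)
    (g := fun x => b (R fun k => x (Sum.inl k)) * a (L fun k => x (Sum.inl k)) *
      x (Sum.inr ())) (by
      let Q : ((κ ⊕ l) ⊕ Unit → ℝ) →L[ℝ] κ ⊕ l → ℝ := ContinuousLinearMap.pi fun k =>
        ContinuousLinearMap.proj (R := ℝ) (φ := fun _ : (κ ⊕ l) ⊕ Unit => ℝ) (Sum.inl k)
      exact (hg.comp Q.hasTemperateGrowth).fun_mul (ContinuousLinearMap.proj (R := ℝ)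
        (φ := fun _ : (κ ⊕ l) ⊕ Unit => ℝ) (Sum.inr ())).hasTemperateGrowth)
  change Integrable (fun ω => b (fun k => X (ψ k) ω) * a (fun k => X (φ k) ω) * X h ω) P at m5
  have i1 : Integrable (fun ω => b (fun k => X (ψ k) ω) *
    dirDeriv (fun k => ⟪φ k, h⟫) a (fun k => X (φ k) ω)) P := m3.integrable_mul m2
  have i2 : Integrable (fun ω => dirDeriv (fun k => ⟪ψ k, h⟫) b (fun k => X (ψ k) ω) *
    a (fun k => X (φ k) ω)) P := m4.integrable_mul m1
  rw [integral_add i1 i2] at key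
  rw [eq_sub_of_add_eq key, ← integral_sub m5 i2]
  exact integral_congr_ae (ae_of_all _ fun ω => by ring)

/-- The second derivative of a cylindrical random variable has a weak formulation. -/
theorem exists_integral_mul_inner_deriv₂ {l : Type*} [Fintype l] (ψ : l → H) (h k : H)
    {b : (l → ℝ) → ℝ} (hb : b.HasTemperateGrowth) :
    ∃ W : Ω → ℝ, MemLp W 2 P ∧ ∀ S : Cylinder H,
      ∫ ω, b (fun k => X (ψ k) ω) * ⟪tmulL H H h k, S.deriv₂ X ω⟫ ∂P =
        ∫ ω, W ω * S.val X ω ∂P := by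
  -- `X h` and `X k` are adjoined to the variables of `b`. Each integration by parts multiplies the
  -- weight by one of them and subtracts a directional derivative, so the weights `b₁`, `b₂` remain
  -- functions of the same finite vector.
  let χ : l ⊕ Bool → H := Sum.elim ψ fun t => if t then h else k
  let pr : l ⊕ Bool → (l ⊕ Bool → ℝ) →L[ℝ] ℝ := fun t =>
    ContinuousLinearMap.proj (R := ℝ) (φ := fun _ : l ⊕ Bool => ℝ) t
  let L : (l ⊕ Bool → ℝ) →L[ℝ] l → ℝ := ContinuousLinearMap.pi fun t => pr (Sum.inl t)
  let b₀ : (l ⊕ Bool → ℝ) → ℝ := fun x => b (L x)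
  let b₁ : (l ⊕ Bool → ℝ) → ℝ := fun x => b₀ x * pr (Sum.inr true) x -
    dirDeriv (fun t => ⟪χ t, h⟫) b₀ x
  let b₂ : (l ⊕ Bool → ℝ) → ℝ := fun x => b₁ x * pr (Sum.inr false) x -
    dirDeriv (fun t => ⟪χ t, k⟫) b₁ x
  have hb₀ : b₀.HasTemperateGrowth := hb.comp L.hasTemperateGrowth
  have hb₁ : b₁.HasTemperateGrowth :=
    (hb₀.fun_mul (pr _).hasTemperateGrowth).fun_sub (hasTemperateGrowth_dirDeriv _ hb₀)
  have hb₂ : b₂.HasTemperateGrowth :=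
    (hb₁.fun_mul (pr _).hasTemperateGrowth).fun_sub (hasTemperateGrowth_dirDeriv _ hb₁)
  refine ⟨fun ω => b₂ fun t => X (χ t) ω, hX.memLp_comp χ hb₂ (by simp), fun S => ?_⟩
  have hS := S.hasTemperateGrowth
  have e : ∀ ω, ⟪tmulL H H h k, S.deriv₂ X ω⟫ = dirDeriv (fun t => ⟪S.φ t, h⟫)
      (dirDeriv (fun t => ⟪S.φ t, k⟫) S.g) fun t => X (S.φ t) ω := by
    intro ω
    rw [dirDeriv_dirDeriv _ _ hS, Cylinder.deriv₂, inner_sum]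
    simp only [inner_sum, inner_smul_right, inner_tmulL, real_inner_comm]
  simp only [e]
  have h1 := hX.integral_mul_dirDeriv S.φ χ h
    (hasTemperateGrowth_dirDeriv (fun t => ⟪S.φ t, k⟫) hS) hb₀
  have h2 := hX.integral_mul_dirDeriv S.φ χ k hS hb₁
  exact h1.trans h2

end IsIsonormal

/-- The second Malliavin derivative is well defined. -/
theorem IsMalliavinTwice.ae_eq (hX : IsIsonormal X P) {F : Ω → ℝ} {D₁ D₁' : Ω → H}
    {D₂ D₂' : Ω → HilbertTensor H H} (h : IsMalliavinTwice X P 2 F D₁ D₂)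
    (h' : IsMalliavinTwice X P 2 F D₁' D₂') : D₂ =ᵐ[P] D₂' := by
  obtain ⟨-, -, m2, S, s0, -, s2⟩ := h
  obtain ⟨mF, -, m2', S', s0', -, s2'⟩ := h'
  have hSm := fun m => (S m).memLp_deriv₂ hX (p := 2) (by simp)
  have hSm' := fun m => (S' m).memLp_deriv₂ hX (p := 2) (by simp)
  have hval := fun S : Cylinder H => hX.memLp_comp S.φ S.hasTemperateGrowth (p := 2) (by simp)
  -- The weight `W` does not depend on the cylinder, so two approximating sequences with the same
  -- limit `F` give the same pairing against a test variable.
  have htest : ∀ {n : ℕ} (ψ : Fin n → H) (x y : H) {b : (Fin n → ℝ) → ℝ},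
      b.HasTemperateGrowth →
      ∫ ω, ⟪b (fun k => X (ψ k) ω) • tmulL H H x y, D₂ ω⟫ ∂P =
        ∫ ω, ⟪b (fun k => X (ψ k) ω) • tmulL H H x y, D₂' ω⟫ ∂P := by
    intro n ψ x y b hb
    obtain ⟨W, hW, hWS⟩ := hX.exists_integral_mul_inner_deriv₂ ψ x y hb
    have hB : MemLp (fun ω => b (fun k => X (ψ k) ω) • tmulL H H x y) 2 P :=
      (hX.memLp_comp ψ (g := fun z => b z • tmulL H H x y) (hb.fun_smul (by fun_prop)) (by simp))
    have t := tendsto_integral_inner hSm m2 hB s2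
    have t' := tendsto_integral_inner hSm' m2' hB s2'
    have w := tendsto_integral_inner (fun m => hval (S m)) mF hW s0
    have w' := tendsto_integral_inner (fun m => hval (S' m)) mF hW s0'
    have e : ∀ T : Cylinder H, ∫ ω, ⟪b (fun k => X (ψ k) ω) • tmulL H H x y, T.deriv₂ X ω⟫ ∂P =
        ∫ ω, ⟪W ω, T.val X ω⟫ ∂P := by
      intro T
      simp only [real_inner_smul_left]
      rw [hWS]
      exact integral_congr_ae (ae_of_all _ fun ω => by simp [mul_comm])
    simp only [e] at t t'
    rw [tendsto_nhds_unique t w, tendsto_nhds_unique t' w']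
  have hζ : MemLp (fun ω => D₂ ω - D₂' ω) 2 P := m2.sub m2'
  -- Second derivatives of cylinders are themselves sums of test variables. The difference `D₂ -
  -- D₂'` is thus orthogonal to all of them and is also a limit of their differences, hence is
  -- orthogonal to itself; no density of test variables is needed.
  have hcyl : ∀ T : Cylinder H, ∫ ω, ⟪D₂ ω - D₂' ω, T.deriv₂ X ω⟫ ∂P = 0 := by
    intro T
    have hterm : ∀ i j, MemLp (fun ω => pderiv i (pderiv j T.g) (fun k => X (T.φ k) ω) •
        tmulL H H (T.φ i) (T.φ j)) 2 P := fun i j =>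
      (hX.memLp_comp T.φ (g := fun z => pderiv i (pderiv j T.g) z • tmulL H H (T.φ i) (T.φ j))
        ((hasTemperateGrowth_pderiv (hasTemperateGrowth_pderiv T.hasTemperateGrowth j) i).fun_smul
          (by fun_prop)) (by simp))
    have hi : ∀ i j, Integrable (fun ω => ⟪D₂ ω - D₂' ω,
        pderiv i (pderiv j T.g) (fun k => X (T.φ k) ω) • tmulL H H (T.φ i) (T.φ j)⟫) P :=
      fun i j => integrable_inner_of_memLp hζ (hterm i j)
    simp only [Cylinder.deriv₂, inner_sum]
    rw [integral_finsetSum _ fun i _ => integrable_finsetSum _ fun j _ => hi i j]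
    refine Finset.sum_eq_zero fun i _ => ?_
    rw [integral_finsetSum _ fun j _ => hi i j]
    refine Finset.sum_eq_zero fun j _ => ?_
    have := htest T.φ (T.φ i) (T.φ j)
      (hasTemperateGrowth_pderiv (hasTemperateGrowth_pderiv T.hasTemperateGrowth j) i)
    simp only [real_inner_comm _ (D₂ _ - D₂' _), inner_sub_right]
    rw [integral_sub (integrable_inner_of_memLp (hterm i j) m2) (integrable_inner_of_memLp (hterm i j) m2'), this,
      sub_self]
  have e1 : ∀ m, ∫ ω, ⟪D₂ ω - D₂' ω, (S m).deriv₂ X ω⟫ ∂P = 0 := fun m => hcyl _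
  have e2 : ∀ m, ∫ ω, ⟪D₂ ω - D₂' ω, (S' m).deriv₂ X ω⟫ ∂P = 0 := fun m => hcyl _
  have l1 := tendsto_integral_inner hSm m2 hζ s2
  have l2 := tendsto_integral_inner hSm' m2' hζ s2'
  simp only [e1] at l1
  simp only [e2] at l2
  have h0 : ∫ ω, ‖D₂ ω - D₂' ω‖ ^ 2 ∂P = 0 := by
    have : ∀ ω, ‖D₂ ω - D₂' ω‖ ^ 2 = ⟪D₂ ω - D₂' ω, D₂ ω⟫ - ⟪D₂ ω - D₂' ω, D₂' ω⟫ := fun ω => by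
      rw [← inner_sub_right, real_inner_self_eq_norm_sq]
    simp only [this]
    rw [integral_sub (integrable_inner_of_memLp hζ m2) (integrable_inner_of_memLp hζ m2'),
      ← tendsto_nhds_unique tendsto_const_nhds l1, ← tendsto_nhds_unique tendsto_const_nhds l2,
      sub_self]
  rw [integral_eq_zero_iff_of_nonneg (fun ω => sq_nonneg _)
    (hζ.integrable_norm_pow (by simp))] at h0
  filter_upwards [h0] with ω hω
  exact sub_eq_zero.1 (norm_eq_zero.1 (pow_eq_zero_iff two_ne_zero |>.1 hω))

end WienerChaos

/-! ### From Wick sums to multiple integrals by hypercontractivity. -/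

namespace WienerChaos

universe u v

section

variable {Ω : Type v} [MeasurableSpace Ω] {P : Measure Ω} {E : Type*} [NormedAddCommGroup E]

theorem toReal_eLpNorm_pow {n : ℕ} (hn : n ≠ 0) {f : Ω → E} (hf : MemLp f n P) :
    (eLpNorm f n P).toReal ^ n = ∫ ω, ‖f ω‖ ^ n ∂P := by
  have h0 : 0 ≤ ∫ ω, ‖f ω‖ ^ n ∂P := integral_nonneg fun ω => by positivity
  rw [hf.eLpNorm_eq_integral_rpow_norm (by exact_mod_cast hn) (by simp)]
  simp only [ENNReal.toReal_natCast, Real.rpow_natCast]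
  rw [ENNReal.toReal_ofReal (by positivity), Real.rpow_inv_natCast_pow h0 hn]

theorem eLpNorm_le_of_integral_pow_four_le {f : Ω → E} {g : Ω → ℝ} (hf : MemLp f 4 P)
    (hg : MemLp g 2 P) {K : ℝ}
    (h : ∫ ω, ‖f ω‖ ^ 4 ∂P ≤ K * (∫ ω, g ω ^ 2 ∂P) ^ 2) :
    eLpNorm f 4 P ≤ ENNReal.ofReal (max K 1) * eLpNorm g 2 P := by
  have hf4 := toReal_eLpNorm_pow (n := 4) (by simp) hf
  have hg2 := toReal_eLpNorm_pow (n := 2) (by simp) hg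
  simp only [Real.norm_eq_abs, sq_abs] at hg2
  push_cast at hf4 hg2
  rw [← hf4, ← hg2] at h
  set x := (eLpNorm f 4 P).toReal with hx
  set y := (eLpNorm g 2 P).toReal with hy
  have hy0 : 0 ≤ y := ENNReal.toReal_nonneg
  have hM : (1 : ℝ) ≤ max K 1 := le_max_right _ _
  -- `max K 1` stands in for the fourth root of `K`.
  have h1 : K ≤ (max K 1) ^ 4 := (le_max_left K 1).trans (le_self_pow₀ hM (by norm_num))
  have h2 : x ≤ max K 1 * y := by
    refine le_of_pow_le_pow_left₀ (n := 4) (by norm_num) (by positivity) (h.trans ?_)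
    rw [mul_pow, ← pow_mul]
    gcongr
  rw [← ENNReal.ofReal_toReal hf.2.ne, ← ENNReal.ofReal_toReal hg.2.ne,
    ← ENNReal.ofReal_mul (by positivity)]
  exact ENNReal.ofReal_le_ofReal h2

end

variable {H : Type u} {Ω : Type v} [NormedAddCommGroup H] [InnerProductSpace ℝ H]
  [MeasurableSpace Ω] {P : Measure Ω} {X : H → Ω → ℝ}

/-- The second components of the span of the generators are Wick sums with unit vectors. A sequence
in the span converging to a point of its closure converges in particular in the second component,
which is all that is used. -/
theorem IsMultipleIntegral.exists_wickVal [CompleteSpace H] {q : ℕ} {f : symPow H q} {F : Lp ℝ 2 P}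
    (h : IsMultipleIntegral X P q f F) :
    ∃ c : ℕ → H →₀ ℝ, (∀ m, IsSpherical (c m)) ∧
      Tendsto (fun m => eLpNorm (fun ω => wickVal X q (c m) ω - F ω) 2 P) atTop (𝓝 0) := by
  obtain ⟨s, hs, hlim⟩ := mem_closure_iff_seq_limit.1 h
  have hspan : ∀ p ∈ Submodule.span ℝ {p : HilbertPow H q × Lp ℝ 2 P | ∃ h : H, ‖h‖ = 1 ∧
      p.1 = purePow h q ∧ p.2 =ᵐ[P] fun ω => Polynomial.aeval (X h ω) (Polynomial.hermite q)},
      ∃ c : H →₀ ℝ, IsSpherical c ∧ p.2 =ᵐ[P] wickVal X q c := by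
    intro p hp
    induction hp using Submodule.span_induction with
    | mem p hp =>
      obtain ⟨h, hh, -, h2⟩ := hp
      refine ⟨Finsupp.single h 1, fun x hx => ?_, h2.trans (ae_of_all _ fun ω => ?_)⟩
      · rw [Finset.mem_singleton.1 (Finsupp.support_single_subset hx), hh]
      · simp [wickVal, herm]
    | zero => exact ⟨0, fun x hx => by simp at hx, by
        simpa using Lp.coeFn_zero ℝ 2 P⟩
    | add p p' _ _ hp hp' =>
      obtain ⟨c, hc, h1⟩ := hp
      obtain ⟨c', hc', h2⟩ := hp'
      refine ⟨c + c', hc.add hc', (Lp.coeFn_add p.2 p'.2).trans ?_⟩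
      rw [map_add]
      exact h1.add h2
    | smul r p _ hp =>
      obtain ⟨c, hc, h1⟩ := hp
      refine ⟨r • c, hc.smul r, (Lp.coeFn_smul r p.2).trans ?_⟩
      rw [map_smul]
      exact h1.const_smul r
  choose c hc hcs using fun m => hspan (s m) (hs m)
  refine ⟨c, hc, ?_⟩
  have h2 : Tendsto (fun m => (s m).2) atTop (𝓝 F) := (continuous_snd.tendsto _).comp hlim
  refine (Lp.tendsto_Lp_iff_tendsto_eLpNorm' _ _).1 h2 |>.congr fun m => ?_
  exact eLpNorm_congr_ae ((hcs m).mono fun ω hω => by simp only [Pi.sub_apply, hω])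

variable [IsProbabilityMeasure P]

theorem IsMalliavinTwice.mono (hX : IsIsonormal X P) {p r : ℝ≥0∞} (hpr : r ≤ p) {F : Ω → ℝ}
    {D₁ : Ω → H} {D₂ : Ω → HilbertTensor H H} (h : IsMalliavinTwice X P p F D₁ D₂) :
    IsMalliavinTwice X P r F D₁ D₂ := by
  obtain ⟨m0, m1, m2, S, s0, s1, s2⟩ := h
  have key : ∀ {E : Type u} [NormedAddCommGroup E] {A : ℕ → Ω → E},
      (∀ m, AEStronglyMeasurable (A m) P) → Tendsto (fun m => eLpNorm (A m) p P) atTop (𝓝 0) →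
      Tendsto (fun m => eLpNorm (A m) r P) atTop (𝓝 0) := fun hA h =>
    tendsto_of_tendsto_of_tendsto_of_le_of_le tendsto_const_nhds h (fun _ => zero_le)
      fun m => eLpNorm_le_eLpNorm_of_exponent_le hpr (hA m)
  refine ⟨m0.mono_exponent hpr, m1.mono_exponent hpr, m2.mono_exponent hpr, S, ?_, ?_, ?_⟩
  · exact tendsto_of_tendsto_of_tendsto_of_le_of_le tendsto_const_nhds s0 (fun _ => zero_le)
      fun m => eLpNorm_le_eLpNorm_of_exponent_le hpr
        (((S m).aestronglyMeasurable_val hX).sub m0.1)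
  · exact key (fun m => ((S m).aestronglyMeasurable_deriv₁ hX).sub m1.1) s1
  · exact key (fun m => ((S m).memLp_deriv₂ hX (p := 1) (by simp)).1.sub m2.1) s2

omit [InnerProductSpace ℝ H] [IsProbabilityMeasure P] in
/-- Hypercontractivity turns convergence in `L²` of Wick sums into convergence in `L⁴` of their
linear images. -/
theorem exists_tendsto_eLpNorm_four {E : Type*} [NormedAddCommGroup E] [NormedSpace ℝ E]
    [CompleteSpace E] (T : (H →₀ ℝ) →ₗ[ℝ] Ω → E) {q : ℕ} {κ : ℝ}
    (hv : ∀ c, IsSpherical c → MemLp (wickVal X q c) 2 P)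
    (hT : ∀ c, IsSpherical c → MemLp (T c) 4 P)
    (hκ : ∀ c, IsSpherical c → eLpNorm (T c) 4 P ≤ ENNReal.ofReal κ * eLpNorm (wickVal X q c) 2 P)
    {c : ℕ → H →₀ ℝ} (hc : ∀ m, IsSpherical (c m)) {F : Ω → ℝ} (hF : MemLp F 2 P)
    (hlim : Tendsto (fun m => eLpNorm (fun ω => wickVal X q (c m) ω - F ω) 2 P) atTop (𝓝 0)) :
    ∃ L : Ω → E, MemLp L 4 P ∧
      Tendsto (fun m => eLpNorm (fun ω => T (c m) ω - L ω) 4 P) atTop (𝓝 0) := by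
  have : Fact ((1 : ℝ≥0∞) ≤ 4) := ⟨by norm_num⟩
  have hV : CauchySeq fun m => (hv _ (hc m)).toLp (wickVal X q (c m)) :=
    ((Lp.tendsto_Lp_iff_tendsto_eLpNorm'' _ (fun m => hv _ (hc m)) _ hF).2 hlim).cauchySeq
  have hA : CauchySeq fun m => (hT _ (hc m)).toLp (T (c m)) := by
    rw [EMetric.cauchySeq_iff] at hV ⊢
    intro ε hε
    obtain ⟨N, hN⟩ := hV (ε / (ENNReal.ofReal κ + 1)) (ENNReal.div_pos hε.ne' (by finiteness))
    refine ⟨N, fun m hm n hn => ?_⟩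
    have h1 := hN m hm n hn
    rw [Lp.edist_toLp_toLp, ← map_sub] at h1 ⊢
    calc eLpNorm (T (c m - c n)) 4 P ≤ ENNReal.ofReal κ * eLpNorm (wickVal X q (c m - c n)) 2 P :=
          hκ _ ((hc m).sub (hc n))
      _ ≤ (ENNReal.ofReal κ + 1) * eLpNorm (wickVal X q (c m - c n)) 2 P := by
          gcongr; exact le_self_add
      _ < ε := by
          rw [mul_comm]
          exact (ENNReal.lt_div_iff_mul_lt (Or.inl (by positivity)) (Or.inl (by finiteness))).1 h1
  obtain ⟨L, hL⟩ := cauchySeq_tendsto_of_complete hA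
  refine ⟨L, Lp.memLp L, (Lp.tendsto_Lp_iff_tendsto_eLpNorm' _ _).1 hL |>.congr fun m => ?_⟩
  exact eLpNorm_congr_ae ((hT _ (hc m)).coeFn_toLp.mono fun ω hω => by
    simp only [Pi.sub_apply, hω])

omit [IsProbabilityMeasure P] in
theorem ae_eq_of_tendsto_eLpNorm {p : ℝ≥0∞} (hp : 1 ≤ p) {A : ℕ → Ω → ℝ} {L L' : Ω → ℝ}
    (hA : ∀ m, MemLp (A m) p P) (hL : MemLp L p P) (hL' : MemLp L' p P)
    (h : Tendsto (fun m => eLpNorm (fun ω => A m ω - L ω) p P) atTop (𝓝 0))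
    (h' : Tendsto (fun m => eLpNorm (fun ω => A m ω - L' ω) p P) atTop (𝓝 0)) : L =ᵐ[P] L' := by
  have : Fact (1 ≤ p) := ⟨hp⟩
  exact (MemLp.toLp_eq_toLp_iff hL hL').1 (tendsto_nhds_unique
    ((Lp.tendsto_Lp_iff_tendsto_eLpNorm'' _ hA _ hL).2 h)
    ((Lp.tendsto_Lp_iff_tendsto_eLpNorm'' _ hA _ hL').2 h'))

namespace IsIsonormal

variable (hX : IsIsonormal X P) {q : ℕ} (hq : 2 ≤ q)

include hX

theorem eLpNorm_wickVal_le {c : H →₀ ℝ} (hc : IsSpherical c) : eLpNorm (wickVal X q c) 4 P ≤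
    ENNReal.ofReal (max (GaussPoly.hyperConst₄ q) 1) * eLpNorm (wickVal X q c) 2 P := by
  refine eLpNorm_le_of_integral_pow_four_le (hX.memLp_wick q hc (by simp)).1
    (hX.memLp_wick q hc (by simp)).1 ?_
  have e : ∀ x : ℝ, |x| ^ 4 = x ^ 4 := fun x => (even_two_mul 2).pow_abs x
  simp only [Real.norm_eq_abs, e]
  exact hX.integral_wickVal_pow_four_le q hc

include hq

theorem eLpNorm_wickDeriv₁_le {c : H →₀ ℝ} (hc : IsSpherical c) : eLpNorm (wickDeriv₁ X q c) 4 P ≤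
    ENNReal.ofReal (max (GaussPoly.hyperConst₄ (q - 1) * q ^ 2) 1) *
      eLpNorm (wickVal X q c) 2 P := by
  refine eLpNorm_le_of_integral_pow_four_le (hX.memLp_wick q hc (by simp)).2.1
    (hX.memLp_wick q hc (by simp)).1 ?_
  refine (hX.integral_norm_wickDeriv₁_pow_four_le q hc hq).trans (le_of_eq (by ring))

theorem eLpNorm_wickDeriv₂_le {c : H →₀ ℝ} (hc : IsSpherical c) : eLpNorm (wickDeriv₂ X q c) 4 P ≤
    ENNReal.ofReal (max (GaussPoly.hyperConst₄ (q - 2) * ((q - 1 : ℕ) * q) ^ 2) 1) *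
      eLpNorm (wickVal X q c) 2 P := by
  refine eLpNorm_le_of_integral_pow_four_le (hX.memLp_wick q hc (by simp)).2.2
    (hX.memLp_wick q hc (by simp)).1 ?_
  refine (hX.integral_norm_wickDeriv₂_pow_four_le q hc hq).trans (le_of_eq (by ring))

/-- Multiple integrals are twice Malliavin differentiable, and approximated by Wick sums. -/
theorem exists_isMalliavinTwice [CompleteSpace H] {f : symPow H q} {F : Lp ℝ 2 P}
    (hF : IsMultipleIntegral X P q f F) :
    ∃ (D₁ : Ω → H) (D₂ : Ω → HilbertTensor H H), IsMalliavinTwice X P 4 F D₁ D₂ ∧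
      ∃ c : ℕ → H →₀ ℝ, (∀ m, IsSpherical (c m)) ∧
        Tendsto (fun m => eLpNorm (fun ω => wickVal X q (c m) ω - F ω) 2 P) atTop (𝓝 0) ∧
        Tendsto (fun m => eLpNorm (fun ω => wickDeriv₂ X q (c m) ω - D₂ ω) 4 P) atTop (𝓝 0) := by
  obtain ⟨c, hc, hlim⟩ := hF.exists_wickVal
  have hm := fun c hc => hX.memLp_wick q (c := c) hc (p := 4) (by simp)
  have hv := fun c hc => (hX.memLp_wick q (c := c) hc (p := 2) (by simp)).1
  obtain ⟨F', hF', t0⟩ := exists_tendsto_eLpNorm_four (wickVal X q) hv (fun c hc => (hm c hc).1)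
    (fun c hc => hX.eLpNorm_wickVal_le hc) hc (Lp.memLp F) hlim
  obtain ⟨D₁, hD₁, t1⟩ := exists_tendsto_eLpNorm_four (wickDeriv₁ X q) hv
    (fun c hc => (hm c hc).2.1) (fun c hc => hX.eLpNorm_wickDeriv₁_le hq hc) hc (Lp.memLp F) hlim
  obtain ⟨D₂, hD₂, t2⟩ := exists_tendsto_eLpNorm_four (wickDeriv₂ X q) hv
    (fun c hc => (hm c hc).2.2) (fun c hc => hX.eLpNorm_wickDeriv₂_le hq hc) hc (Lp.memLp F) hlim
  -- The `L⁴` limit is also an `L²` limit of the same sequence, hence equals `F` almost surely.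
  have hFF : F' =ᵐ[P] F := by
    refine ae_eq_of_tendsto_eLpNorm (p := 2) (by norm_num) (fun m => hv _ (hc m))
      (hF'.mono_exponent (by norm_num)) (Lp.memLp F) ?_ hlim
    exact tendsto_of_tendsto_of_tendsto_of_le_of_le tendsto_const_nhds t0 (fun _ => zero_le)
      fun m => eLpNorm_le_eLpNorm_of_exponent_le (by norm_num) ((hm _ (hc m)).1.1.sub hF'.1)
  have hM := IsMalliavinTwice.of_tendsto hX (p := 4) (by norm_num)
    (fun m => hX.isMalliavinTwice_wick q (hc m) (by simp) (by simp)) hF' hD₁ hD₂ t0 t1 t2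
  exact ⟨D₁, D₂, hM.congr hFF (ae_eq_refl _) (ae_eq_refl _), c, hc, hlim, t2⟩

end IsIsonormal

end WienerChaos

/-! ### Comparison of the modes of convergence. -/

namespace WienerChaos

universe u v

variable {H : Type u} {Ω : Type v} [NormedAddCommGroup H] [InnerProductSpace ℝ H]
  [CompleteSpace H] [MeasurableSpace Ω] {P : Measure Ω}

theorem continuous_toOp : Continuous (toOp : HilbertTensor H H → H →L[ℝ] H) :=
  ((toOpL H).mkContinuous 1 fun u => by rw [one_mul]; exact norm_toOp_le u).continuous

/-- The operator norm is at most the Hilbert-Schmidt norm, so condition (iii) is insensitive to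
perturbations of `D²F` that vanish in `L⁴`. -/
theorem tendsto_eLpNorm_toOp_of_sub {A B : ℕ → Ω → HilbertTensor H H}
    (hA : ∀ k, AEStronglyMeasurable (A k) P) (hB : ∀ k, AEStronglyMeasurable (B k) P)
    (hAB : Tendsto (fun k => eLpNorm (fun ω => A k ω - B k ω) 4 P) atTop (𝓝 0))
    (h : Tendsto (fun k => eLpNorm (fun ω => ‖toOp (B k ω)‖) 4 P) atTop (𝓝 0)) :
    Tendsto (fun k => eLpNorm (fun ω => ‖toOp (A k ω)‖) 4 P) atTop (𝓝 0) := by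
  have h1 := hAB.add h
  rw [add_zero] at h1
  refine tendsto_of_tendsto_of_tendsto_of_le_of_le tendsto_const_nhds h1 (fun _ => zero_le)
    fun k => ?_
  have h2 : eLpNorm (fun ω => ‖toOp (A k ω)‖) 4 P ≤
      eLpNorm ((fun ω => ‖A k ω - B k ω‖) + fun ω => ‖toOp (B k ω)‖) 4 P := by
    refine eLpNorm_mono fun ω => ?_
    rw [Pi.add_apply, Real.norm_of_nonneg (norm_nonneg _), Real.norm_of_nonneg (by positivity)]
    have : toOp (A k ω) = toOp (A k ω - B k ω) + toOp (B k ω) := by rw [toOp_sub]; simp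
    rw [this]
    exact (norm_add_le _ _).trans (add_le_add_left (norm_toOp_le _) _)
  refine h2.trans ((eLpNorm_add_le ((hA k).sub (hB k)).norm
    (continuous_toOp.comp_aestronglyMeasurable (hB k)).norm (by norm_num)).trans (le_of_eq ?_))
  congr 1
  exact eLpNorm_norm _

/-- Integrates `‖T‖² ≤ ‖u ⊗₁ u‖ ≤ ‖T‖ ‖u‖`. The first inequality compares a squared `L⁴` norm with
an `L²` norm; the second needs Hölder with `1/4 + 1/4 = 1/2` and the uniform `L⁴` bound. -/
theorem tendsto_eLpNorm_contraction_iff {ι : Type*} (b : HilbertBasis ι ℝ H)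
    {D : ℕ → Ω → HilbertTensor H H} (hD : ∀ k, AEStronglyMeasurable (D k) P) {B : ℝ≥0∞}
    (hB : B ≠ ∞) (hle : ∀ k, eLpNorm (D k) 4 P ≤ B) :
    Tendsto (fun k => eLpNorm (fun ω => ‖contraction b (D k ω) (D k ω)‖) 2 P) atTop (𝓝 0) ↔
      Tendsto (fun k => eLpNorm (fun ω => ‖toOp (D k ω)‖) 4 P) atTop (𝓝 0) := by
  constructor
  · intro h
    have h1 : ∀ k, eLpNorm (fun ω => ‖toOp (D k ω)‖) 4 P ^ (2 : ℝ) ≤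
        eLpNorm (fun ω => ‖contraction b (D k ω) (D k ω)‖) 2 P := by
      intro k
      have e := eLpNorm_norm_rpow (μ := P) (p := 2) (fun ω => ‖toOp (D k ω)‖) (q := 2) two_pos
      rw [show (2 : ℝ≥0∞) * ENNReal.ofReal 2 = 4 by norm_num] at e
      rw [← e]
      refine eLpNorm_mono fun ω => ?_
      simp only [norm_norm]
      rw [Real.rpow_two, Real.norm_of_nonneg (by positivity)]
      exact norm_toOp_sq_le b _
    have h2 : Tendsto (fun k => eLpNorm (fun ω => ‖toOp (D k ω)‖) 4 P ^ (2 : ℝ)) atTop (𝓝 0) :=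
      tendsto_of_tendsto_of_tendsto_of_le_of_le tendsto_const_nhds h (fun _ => zero_le) h1
    have h3 := h2.ennrpow_const (1 / 2)
    rw [ENNReal.zero_rpow_of_pos (by norm_num)] at h3
    refine h3.congr fun k => ?_
    rw [← ENNReal.rpow_mul]
    norm_num
  · intro h
    have : ENNReal.HolderTriple 4 4 2 := ⟨by
      rw [show (4 : ℝ≥0∞) = 2 * 2 by norm_num, ENNReal.mul_inv (by simp) (by simp), ← two_mul,
        ← mul_assoc, ENNReal.mul_inv_cancel (by simp) (by simp), one_mul]⟩
    have h1 : ∀ k, eLpNorm (fun ω => ‖contraction b (D k ω) (D k ω)‖) 2 P ≤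
        eLpNorm (fun ω => ‖toOp (D k ω)‖) 4 P * B := by
      intro k
      have hm : AEStronglyMeasurable (fun ω => ‖toOp (D k ω)‖) P :=
        (continuous_toOp.comp_aestronglyMeasurable (hD k)).norm
      calc eLpNorm (fun ω => ‖contraction b (D k ω) (D k ω)‖) 2 P
          ≤ eLpNorm ((fun ω => ‖toOp (D k ω)‖) • D k) 2 P := by
            refine eLpNorm_mono fun ω => ?_
            rw [Pi.smul_apply', norm_smul, norm_norm, norm_norm]
            exact norm_contraction_le b _
        _ ≤ eLpNorm (fun ω => ‖toOp (D k ω)‖) 4 P * eLpNorm (D k) 4 P :=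
            eLpNorm_smul_le_mul_eLpNorm (hD k) hm
        _ ≤ _ := by gcongr; exact hle k
    have h2 := ENNReal.Tendsto.mul_const h (Or.inr hB)
    rw [zero_mul] at h2
    exact tendsto_of_tendsto_of_tendsto_of_le_of_le tendsto_const_nhds h2 (fun _ => zero_le) h1

theorem tendsto_eLpNorm_toOp_iff {D : ℕ → Ω → HilbertTensor H H}
    (hD : ∀ k, MemLp (fun ω => toOp (D k ω)) 4 P) :
    Tendsto (fun k => eLpNorm (fun ω => ‖toOp (D k ω)‖) 4 P) atTop (𝓝 0) ↔
      Tendsto (fun k => ∫ ω, ‖toOp (D k ω)‖ ^ 4 ∂P) atTop (𝓝 0) := by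
  have e : ∀ k, (eLpNorm (fun ω => ‖toOp (D k ω)‖) 4 P).toReal ^ 4 =
      ∫ ω, ‖toOp (D k ω)‖ ^ 4 ∂P := by
    intro k
    rw [eLpNorm_norm]
    exact toReal_eLpNorm_pow (n := 4) (by simp) (hD k)
  have hfin : ∀ k, eLpNorm (fun ω => ‖toOp (D k ω)‖) 4 P ≠ ∞ := fun k => (hD k).norm.2.ne
  rw [← ENNReal.tendsto_toReal_iff hfin (by simp)]
  simp only [← e, ENNReal.toReal_zero]
  constructor
  · intro h
    simpa using h.pow 4
  · intro h
    have := h.rpow_const (p := (4 : ℝ)⁻¹) (Or.inr (by positivity))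
    rw [Real.zero_rpow (by norm_num)] at this
    refine this.congr fun k => ?_
    exact_mod_cast Real.pow_rpow_inv_natCast (n := 4) ENNReal.toReal_nonneg (by norm_num)

theorem tendstoInDistribution_of_tendsto_eLpNorm_sub [IsProbabilityMeasure P] {F G : ℕ → Ω → ℝ}
    (hF : ∀ k, AEStronglyMeasurable (F k) P) (hG : ∀ k, AEStronglyMeasurable (G k) P)
    (h : Tendsto (fun k => eLpNorm (fun ω => G k ω - F k ω) 2 P) atTop (𝓝 0))
    {ν : Measure ℝ} [IsProbabilityMeasure ν]
    (hlaw : TendstoInDistribution F atTop (id : ℝ → ℝ) (fun _ => P) ν) :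
    TendstoInDistribution G atTop (id : ℝ → ℝ) (fun _ => P) ν := by
  refine tendstoInDistribution_of_tendstoInMeasure_sub G id hlaw ?_ fun k => (hG k).aemeasurable
  refine tendstoInMeasure_of_tendsto_eLpNorm (p := 2) (by simp) (fun k => (hG k).sub (hF k))
    aestronglyMeasurable_const ?_
  simp only [sub_zero]
  exact h

end WienerChaos

/-! ### Transfer to multiple integrals and conclusion. -/

namespace WienerChaos

universe u v

theorem tendsto_eLpNorm_sub_symm {Ω E : Type*} [MeasurableSpace Ω] [NormedAddCommGroup E]
    {P : Measure Ω} {A B : ℕ → Ω → E} {p : ℝ≥0∞}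
    (h : Tendsto (fun k => eLpNorm (fun ω => A k ω - B k ω) p P) atTop (𝓝 0)) :
    Tendsto (fun k => eLpNorm (fun ω => B k ω - A k ω) p P) atTop (𝓝 0) :=
  h.congr fun k => eLpNorm_sub_comm (A k) (B k) p P

theorem tendsto_integral_sq_of_tendsto_eLpNorm_sub {Ω : Type v} [MeasurableSpace Ω]
    {P : Measure Ω} {F G : ℕ → Ω → ℝ} (hF : ∀ k, MemLp (F k) 2 P) (hG : ∀ k, MemLp (G k) 2 P)
    (h : Tendsto (fun k => eLpNorm (fun ω => G k ω - F k ω) 2 P) atTop (𝓝 0))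
    (hlim : Tendsto (fun k => ∫ ω, F k ω ^ 2 ∂P) atTop (𝓝 1)) :
    Tendsto (fun k => ∫ ω, G k ω ^ 2 ∂P) atTop (𝓝 1) := by
  have norm_sq : ∀ {g : Ω → ℝ} (hg : MemLp g 2 P), ‖hg.toLp g‖ ^ 2 = ∫ ω, g ω ^ 2 ∂P := fun hg => by
    rw [Lp.norm_toLp]
    simpa using toReal_eLpNorm_pow (n := 2) (by simp) hg
  have h1 : Tendsto (fun k => ‖(hF k).toLp (F k)‖) atTop (𝓝 1) := by
    have := hlim.sqrt
    rw [Real.sqrt_one] at this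
    refine this.congr fun k => ?_
    rw [← norm_sq (hF k), Real.sqrt_sq (norm_nonneg _)]
  have h2 : Tendsto (fun k => ‖(hG k).toLp (G k)‖) atTop (𝓝 1) := by
    have h3 : Tendsto (fun k => ‖(hG k).toLp (G k)‖ - ‖(hF k).toLp (F k)‖) atTop (𝓝 0) := by
      have h4 := (ENNReal.tendsto_toReal (by simp)).comp h
      refine squeeze_zero_norm (fun k => (abs_norm_sub_norm_le _ _).trans (le_of_eq ?_)) h4
      rw [← MemLp.toLp_sub, Lp.norm_toLp]
      rfl
    simpa using h3.add h1
  have h5 := h2.pow 2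
  rw [one_pow] at h5
  exact h5.congr fun k => norm_sq (hG k)

variable {H : Type u} {Ω : Type v} [NormedAddCommGroup H] [InnerProductSpace ℝ H]
  [CompleteSpace H] [MeasurableSpace Ω] {P : Measure Ω} [IsProbabilityMeasure P] {X : H → Ω → ℝ}

namespace IsIsonormal

variable (hX : IsIsonormal X P) {q : ℕ} (hq : 2 ≤ q)

include hX hq

/-- Wick sums approximate, in `L⁴`, the second derivative built in `exists_isMalliavinTwice`. The
given `D` is only assumed to be a derivative in `𝔻^{2,2}`; uniqueness there identifies the two
almost surely. -/
theorem exists_wick_approx {f : symPow H q} {F : Lp ℝ 2 P} (hF : IsMultipleIntegral X P q f F)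
    {D : Ω → HilbertTensor H H} (hD : IsSecondMalliavinDeriv X P F D) {ε : ℝ≥0∞} (hε : 0 < ε) :
    ∃ c : H →₀ ℝ, IsSpherical c ∧ eLpNorm (fun ω => wickVal X q c ω - F ω) 2 P ≤ ε ∧
      eLpNorm (fun ω => wickDeriv₂ X q c ω - D ω) 4 P ≤ ε := by
  obtain ⟨D₁, D₂, hM, c, hc, t0, t2⟩ := hX.exists_isMalliavinTwice hq hF
  obtain ⟨D₁', h'⟩ := hD
  have hae := (hM.mono hX (by norm_num)).ae_eq hX h'
  obtain ⟨m, h0, h2⟩ :=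
    ((t0.eventually (ge_mem_nhds hε)).and (t2.eventually (ge_mem_nhds hε))).exists
  refine ⟨c m, hc m, h0, le_trans (le_of_eq (eLpNorm_congr_ae ?_)) h2⟩
  filter_upwards [hae] with ω hω
  rw [hω]

omit [CompleteSpace H] in
-- Supplies the uniform bound that `tendsto_eLpNorm_contraction_iff` requires: hypercontractivity
-- bounds the derivatives of the Wick sums by their second moments, which converge, and the error is
-- at most `1`.
theorem exists_bound_eLpNorm {c : ℕ → H →₀ ℝ} (hc : ∀ k, IsSpherical (c k))
    (hvar : Tendsto (fun k => ∫ ω, wickVal X q (c k) ω ^ 2 ∂P) atTop (𝓝 1))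
    {D : ℕ → Ω → HilbertTensor H H} (hD : ∀ k, AEStronglyMeasurable (D k) P)
    (h1 : ∀ k, eLpNorm (fun ω => wickDeriv₂ X q (c k) ω - D k ω) 4 P ≤ 1) :
    ∃ B : ℝ≥0∞, B ≠ ∞ ∧ ∀ k, eLpNorm (D k) 4 P ≤ B := by
  obtain ⟨R, hR⟩ := hvar.bddAbove_range
  set K := ENNReal.ofReal (max (GaussPoly.hyperConst₄ (q - 2) * ((q - 1 : ℕ) * q) ^ 2) 1) with hK
  have hV := fun k => (hX.memLp_wick q (hc k) (p := 2) (by simp)).1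
  have hW := fun k => (hX.memLp_wick q (hc k) (p := 4) (by simp)).2.2
  have hR' : ∀ k, eLpNorm (wickVal X q (c k)) 2 P ≤ ENNReal.ofReal (max R 1) := fun k => by
    have h := toReal_eLpNorm_pow (n := 2) (by simp) (hV k)
    simp only [Real.norm_eq_abs, sq_abs] at h
    push_cast at h
    rw [← ENNReal.ofReal_toReal (hV k).2.ne]
    refine ENNReal.ofReal_le_ofReal (le_of_pow_le_pow_left₀ two_ne_zero (by positivity) ?_)
    rw [h]
    exact (hR ⟨k, rfl⟩).trans ((le_max_left R 1).trans
      (le_self_pow₀ (le_max_right _ _) two_ne_zero))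
  refine ⟨1 + K * ENNReal.ofReal (max R 1), by finiteness, fun k => ?_⟩
  have e : D k = wickDeriv₂ X q (c k) - fun ω => wickDeriv₂ X q (c k) ω - D k ω := by
    ext1 ω
    rw [Pi.sub_apply, sub_sub_cancel]
  rw [e, add_comm]
  refine (eLpNorm_sub_le (hW k).1 ((hW k).1.sub (hD k)) (by norm_num)).trans
    (add_le_add ((hX.eLpNorm_wickDeriv₂_le hq (hc k)).trans ?_) (h1 k))
  exact mul_le_mul_right (hR' k) _

/-- The equivalences of the fourth moment theorem, for random variables approximated by Wick
sums. -/
theorem tfae_of_wick_approx {ι : Type*} (b : HilbertBasis ι ℝ H) {F : ℕ → Ω → ℝ}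
    (hF : ∀ k, MemLp (F k) 2 P) {D : ℕ → Ω → HilbertTensor H H}
    (hD : ∀ k, AEStronglyMeasurable (D k) P) {c : ℕ → H →₀ ℝ} (hc : ∀ k, IsSpherical (c k))
    (hF2 : Tendsto (fun k => ∫ ω, F k ω ^ 2 ∂P) atTop (𝓝 1))
    (h1 : ∀ k, eLpNorm (fun ω => wickDeriv₂ X q (c k) ω - D k ω) 4 P ≤ 1)
    (tF : Tendsto (fun k => eLpNorm (fun ω => wickVal X q (c k) ω - F k ω) 2 P) atTop (𝓝 0))
    (tD : Tendsto (fun k => eLpNorm (fun ω => wickDeriv₂ X q (c k) ω - D k ω) 4 P) atTop (𝓝 0)) :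
    List.TFAE [
      TendstoInDistribution F atTop (id : ℝ → ℝ) (fun _ => P) (gaussianReal 0 1),
      Tendsto (fun k => eLpNorm (fun ω => ‖contraction b (D k ω) (D k ω)‖) 2 P) atTop (𝓝 0),
      Tendsto (fun k => eLpNorm (fun ω => ‖toOp (D k ω)‖) 4 P) atTop (𝓝 0)] := by
  have hV := fun k => (hX.memLp_wick q (hc k) (p := 2) (by simp)).1
  have hW := fun k => (hX.memLp_wick q (hc k) (p := 4) (by simp)).2.2.1
  have hvar := tendsto_integral_sq_of_tendsto_eLpNorm_sub hF hV tF hF2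
  obtain ⟨B, hB, hle⟩ := hX.exists_bound_eLpNorm hq hc hvar hD h1
  have hop4 := tendsto_eLpNorm_toOp_iff fun k =>
    hX.memLp_norm_toOp_wickDeriv₂ q (hc k) (p := 4) (by simp)
  have tF' := tendsto_eLpNorm_sub_symm tF
  have tD' := tendsto_eLpNorm_sub_symm tD
  have h23 := tendsto_eLpNorm_contraction_iff b hD hB hle
  tfae_have 2 ↔ 3 := h23
  tfae_have 1 → 3 := fun h =>
    tendsto_eLpNorm_toOp_of_sub hD hW tD' (hop4.2
      (hX.tendsto_integral_norm_toOp hc hvar (by omega)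
        (tendstoInDistribution_of_tendsto_eLpNorm_sub (fun k => (hF k).1) (fun k => (hV k).1) tF
          h)))
  tfae_have 3 → 1 := fun h =>
    tendstoInDistribution_of_tendsto_eLpNorm_sub (fun k => (hV k).1) (fun k => (hF k).1)
      tF' (hX.tendstoInDistribution_wickVal hc hvar hq
        (hop4.1 (tendsto_eLpNorm_toOp_of_sub hW hD tD h)))
  tfae_finish

end IsIsonormal

end WienerChaos

end

open WienerChaos in
theorem theorem5p2 {H Ω ι : Type*} [NormedAddCommGroup H] [InnerProductSpace ℝ H]
    [CompleteSpace H] [TopologicalSpace.SeparableSpace H] (b : HilbertBasis ι ℝ H)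
    [MeasurableSpace Ω] (P : Measure Ω) [IsProbabilityMeasure P]
    (X : H → Ω → ℝ) (hX : IsIsonormal X P)
    (q : ℕ) (hq : 2 ≤ q) (f : ℕ → symPow H q) (F : ℕ → Lp ℝ 2 P)
    (hF : ∀ k, IsMultipleIntegral X P q (f k) (F k))
    (hvar : Tendsto (fun k => ∫ ω, (F k ω) ^ 2 ∂P) atTop (𝓝 1)) :
    (∀ k, MemD2 X P 4 (F k)) ∧
    ∀ D2F : ℕ → Ω → HilbertTensor H H, (∀ k, IsSecondMalliavinDeriv X P (F k) (D2F k)) →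
      List.TFAE [
        TendstoInDistribution (fun k ω => F k ω) atTop (id : ℝ → ℝ) (fun _ => P)
          (gaussianReal 0 1),
        Tendsto (fun k => eLpNorm (fun ω => ‖contraction b (D2F k ω) (D2F k ω)‖) 2 P)
          atTop (𝓝 0),
        Tendsto (fun k => eLpNorm (fun ω => ‖toOp (D2F k ω)‖) 4 P) atTop (𝓝 0)] := by
  refine ⟨fun k => ?_, fun D2F hD2F => ?_⟩
  · obtain ⟨D₁, D₂, hD, -⟩ := hX.exists_isMalliavinTwice hq (hF k)
    exact ⟨D₁, D₂, hD⟩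
  have hpos : ∀ k : ℕ, (0 : ℝ≥0∞) < ((k : ℝ≥0∞) + 1)⁻¹ := fun k =>
    ENNReal.inv_pos.2 (by finiteness)
  have hinv : Tendsto (fun k : ℕ => ((k : ℝ≥0∞) + 1)⁻¹) atTop (𝓝 0) := by
    have := (tendsto_add_atTop_iff_nat 1).2 ENNReal.tendsto_inv_nat_nhds_zero
    simpa using this
  -- The accuracy `1/(k+1)` tends to `0` and is at most `1`, the two properties that
  -- `tfae_of_wick_approx` asks for.
  choose c hc hcF hcD using fun k => hX.exists_wick_approx hq (hF k) (hD2F k) (hpos k)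
  have hD : ∀ k, AEStronglyMeasurable (D2F k) P := fun k => by
    obtain ⟨D₁, h⟩ := hD2F k
    exact h.2.2.1.1
  exact hX.tfae_of_wick_approx hq b (fun k => Lp.memLp (F k)) hD hc hvar
    (fun k => (hcD k).trans (ENNReal.inv_le_one.2 le_add_self))
    (tendsto_of_tendsto_of_tendsto_of_le_of_le tendsto_const_nhds hinv (fun _ => zero_le) hcF)
    (tendsto_of_tendsto_of_tendsto_of_le_of_le tendsto_const_nhds hinv (fun _ => zero_le) hcD)
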